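/- **Setting.** Write $\mathbb R_+=(0,\infty)$, $D_2=\{\zeta\in\mathbb C^2:\operatorname{Im}\zeta_2-|\zeta_1|^2>0\}$ and $\mathcal D=\mathbb C\times(\mathbb R+i\mathbb R_+)$, all with Lebesgue measure. Let $n\ge 1$. The space $\mathcal A^2_{(1,n)}(D_2)$ consists of those $f\in L^2(D_2)$ that are (represented by) $C^\infty$ functions on $D_2$ satisfying $$\Big(\frac{\partial}{\partial\bar\zeta_1}-2i\zeta_1\frac{\partial}{\partial\bar\zeta_2}\Big)f=0,\qquad \Big(\frac{\partial}{\partial\bar\zeta_2}\Big)^{n}f=0 .$$ Let $h_0(y)=\pi^{-1/4}e^{-y^2/2}$, $\ell_m(y)=(-1)^mL_m(y)e^{-y/2}$ with the Laguerre polynomials $L_m(y)=\frac{e^y}{m!}\frac{d^m}{dy^m}(e^{-y}y^m)$, and $N=(\ell_0,\dots,\ell_{n-1})^T$. The Bargmann-type operator is $R_{(1,n)}=R_{0(1,n)}^*\,U:L^2(D_2)\to (L^2(\mathbb R\times\mathbb R_+))^n$, where $U=V_2V_1U_1U_0:L^2(D_2)\to L^2(\mathcal D)$ and, in the coordinates $w_m=u_m+iv_m$,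 $\xi_m=t_m+is_m$, $z_m=x_m+iy_m$ ($m=1,2$) on $\mathcal D$, * $(U_0f)(w)=f(w_1,\,w_2+i|w_1|^2)$; * $U_1=F\otimes I\otimes F\otimes I$ with respect to $(u_1,v_1,u_2,v_2)$, where $(Fg)(t)=\frac1{\sqrt{2\pi}}\int_{\mathbb R} g(x)e^{-itx}\,dx$ is the unitary Fourier transform of $L^2(\mathbb R)$; * $(V_1f)(\xi)=(2|t_2|)^{-1/2}f\big(\xi_1,\,t_2+i\tfrac{s_2}{2|t_2|}\big)$; * $(V_2g)(z)=g\big(\sqrt{|x_2|}(x_1+y_1)+\tfrac{i}{2\sqrt{|x_2|}}(-x_1+y_1),\,z_2\big)$; * $R_{0(1,n)}:(L^2(\mathbb R\times\mathbb R_+))^n\to L^2(\mathcal D)$ is $(R_{0(1,n)}g)(x_1,y_1,x_2,y_2)=\chi_{\mathbb R_+}(x_2)\,h_0(y_1)\,N(y_2)^Tg(x_1,x_2)$. **Theorem.** Let $c:\mathbb R\times\mathbb R_+\to\mathbb C$ be such that $\tilde c(\zeta)=c(\operatorname{Im}\zeta_1,\operatorname{Im}\zeta_2-|\zeta_1|^2)$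 belongs to $L^\infty(D_2)$. Then: 1. For all $x_1\in\mathbb R$, $x_2>0$, every entry of the integrand below is integrable over $(y_1,y_2)\in\mathbb R\times\mathbb R_+$, so that $$\gamma^{c}(x_1,x_2)=\int_{\mathbb R}\int_{\mathbb R_+}c\Big(\frac{-x_1+y_1}{2\sqrt{x_2}},\frac{y_2}{2x_2}\Big)\,h_0(y_1)^2\,N(y_2)N(y_2)^T\,dy_2\,dy_1\in M_n(\mathbb C)$$ is well defined. 2. $\mathcal A^2_{(1,n)}(D_2)$ admits an orthogonal projection $B_{(1,n)}$ from $L^2(D_2)$ onto it (i.e. it is closed), and $R_{(1,n)}$ maps $\mathcal A^2_{(1,n)}(D_2)$ unitarily onto $(L^2(\mathbb R\times\mathbb R_+))^n$, with inverse $R_{(1,n)}^*$. 3. The Toeplitz operator $T_c f=B_{(1,n)}(\tilde c f)$ on $\mathcal A^2_{(1,n)}(D_2)$ is unitarily equivalent, via $R_{(1,n)}$, to multiplication by $\gamma^c$: for every $g\in (L^2(\mathbb R\times\mathbb R_+))^n$, $$\big(R_{(1,n)}T_cR_{(1,n)}^*g\big)(x_1,x_2)=\gamma^c(x_1,x_2)\,g(x_1,x_2)\quad\text{for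 a.e. }(x_1,x_2)\in\mathbb R\times\mathbb R_+ .$$ -/

import Mathlib

noncomputable section

namespace Siegel

open MeasureTheory Set Filter Topology
open scoped ENNReal TensorProduct

section WeightedComp
variable {α β : Type*} [MeasurableSpace α] [MeasurableSpace β] {μ : Measure α} {ν : Measure β}

/-- `w` and `ψ` satisfy the change of variables formula `∫ w² (f ∘ ψ) dμ = ∫ f dν`. -/
structure IsWeighted (w : α → ℝ) (ψ : α → β) (μ : Measure α) (ν : Measure β) : Prop where
  measurable_weight : Measurable w
  quasi : Measure.QuasiMeasurePreserving ψ μ ν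
  lintegral_eq : ∀ f : β → ℝ≥0∞, Measurable f →
    ∫⁻ x, ENNReal.ofReal (w x ^ 2) * f (ψ x) ∂μ = ∫⁻ y, f y ∂ν

theorem IsWeighted.eLpNorm_eq {w : α → ℝ} {ψ : α → β} (h : IsWeighted w ψ μ ν) {f : β → ℂ}
    (hf : AEStronglyMeasurable f ν) :
    eLpNorm (fun x => (w x : ℂ) * f (ψ x)) 2 μ = eLpNorm f 2 ν := by
  have hm : AEMeasurable (fun y => ‖f y‖ₑ ^ (2 : ℝ)) ν := (hf.enorm).pow_const _
  have key : ∫⁻ x, ENNReal.ofReal (w x ^ 2) * ‖f (ψ x)‖ₑ ^ (2 : ℝ) ∂μ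
      = ∫⁻ y, ‖f y‖ₑ ^ (2 : ℝ) ∂ν := by
    rw [lintegral_congr_ae hm.ae_eq_mk, ← h.lintegral_eq _ hm.measurable_mk]
    apply lintegral_congr_ae
    filter_upwards [h.quasi.ae_eq_comp hm.ae_eq_mk] with x hx
    simp only [Function.comp] at hx
    rw [hx]
  rw [eLpNorm_eq_lintegral_rpow_enorm_toReal (by norm_num) (by norm_num),
    eLpNorm_eq_lintegral_rpow_enorm_toReal (by norm_num) (by norm_num)]
  simp only [ENNReal.toReal_ofNat]
  rw [← key]
  congr 1
  apply lintegral_congr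
  intro x
  rw [enorm_mul, ENNReal.mul_rpow_of_nonneg _ _ (by norm_num)]
  congr 1
  rw [← ofReal_norm, ENNReal.ofReal_rpow_of_nonneg (norm_nonneg _) (by norm_num)]
  simp

theorem IsWeighted.memLp {w : α → ℝ} {ψ : α → β} (h : IsWeighted w ψ μ ν) {f : β → ℂ}
    (hf : MemLp f 2 ν) : MemLp (fun x => (w x : ℂ) * f (ψ x)) 2 μ := by
  refine ⟨?_, ?_⟩
  · exact (Complex.measurable_ofReal.comp h.measurable_weight).aestronglyMeasurable.mul
      (hf.1.comp_quasiMeasurePreserving h.quasi)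
  · rw [h.eLpNorm_eq hf.1]; exact hf.2

/-- The isometry `(V f)(x) = w(x) f(ψ(x))` from `L²(ν)` to `L²(μ)`. -/
def weightedComp (w : α → ℝ) (ψ : α → β) (h : IsWeighted w ψ μ ν) :
    Lp ℂ 2 ν →ₗᵢ[ℂ] Lp ℂ 2 μ where
  toFun f := (h.memLp (f := f) (Lp.memLp f)).toLp (fun x => (w x : ℂ) * f (ψ x))
  map_add' f g := by
    rw [← MemLp.toLp_add]
    apply MemLp.toLp_congr
    filter_upwards [h.quasi.ae_eq_comp (Lp.coeFn_add f g)] with x hx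
    simp only [Function.comp, Pi.add_apply] at hx ⊢
    rw [hx, mul_add]
  map_smul' c f := by
    rw [RingHom.id_apply, ← MemLp.toLp_const_smul]
    apply MemLp.toLp_congr
    filter_upwards [h.quasi.ae_eq_comp (Lp.coeFn_smul c f)] with x hx
    simp only [Function.comp, Pi.smul_apply, smul_eq_mul] at hx ⊢
    rw [hx]; ring
  norm_map' f := by
    change ‖(h.memLp (Lp.memLp f)).toLp (fun x => (w x : ℂ) * f (ψ x))‖ = ‖f‖
    rw [Lp.norm_toLp, Lp.norm_def, h.eLpNorm_eq (Lp.memLp f).1]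

theorem weightedComp_ae (w : α → ℝ) (ψ : α → β) (h : IsWeighted w ψ μ ν) (f : Lp ℂ 2 ν) :
    weightedComp w ψ h f =ᵐ[μ] fun x => (w x : ℂ) * f (ψ x) :=
  MemLp.coeFn_toLp (h.memLp (f := f) (Lp.memLp f))

theorem IsWeighted.of_ae_ne_zero {w : α → ℝ} {ψ : α → β} (hw : Measurable w) (hψ : Measurable ψ)
    (hw0 : ∀ᵐ x ∂μ, w x ≠ 0)
    (h : ∀ f : β → ℝ≥0∞, Measurable f →
      ∫⁻ x, ENNReal.ofReal (w x ^ 2) * f (ψ x) ∂μ = ∫⁻ y, f y ∂ν) : IsWeighted w ψ μ ν := by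
  refine ⟨hw, ⟨hψ, ?_⟩, h⟩
  refine Measure.AbsolutelyContinuous.mk fun s hs h0 => ?_
  rw [Measure.map_apply hψ hs]
  have h1 := h (s.indicator 1) (measurable_one.indicator hs)
  rw [lintegral_indicator_one hs, h0, lintegral_eq_zero_iff (by
    exact (hw.pow_const 2).ennreal_ofReal.mul ((measurable_one.indicator hs).comp hψ))] at h1
  refine measure_mono_null (t := {x | ¬ (w x ≠ 0 → x ∉ ψ ⁻¹' s)} ∪ {x | ¬ (w x ≠ 0)}) ?_ ?_
  · intro x hx
    by_cases hwx : w x = 0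
    · right; simpa using hwx
    · left; simpa using ⟨hwx, hx⟩
  · rw [measure_union_null_iff]
    refine ⟨?_, hw0⟩
    change ∀ᵐ x ∂μ, (w x ≠ 0 → x ∉ ψ ⁻¹' s)
    filter_upwards [h1] with x hx hwx hxs
    have hxs' : ψ x ∈ s := hxs
    simp only [indicator_of_mem hxs', Pi.one_apply, mul_one, Pi.zero_apply,
      ENNReal.ofReal_eq_zero] at hx
    exact absurd hx (not_le.2 (by positivity))

theorem IsWeighted.of_measurePreserving {ψ : α → β} (h : MeasurePreserving ψ μ ν) :
    IsWeighted (fun _ => 1) ψ μ ν :=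
  ⟨measurable_const, h.quasiMeasurePreserving, fun f hf => by simp [h.lintegral_comp hf]⟩

end WeightedComp

section Tensor
variable {α β : Type*} [MeasurableSpace α] [MeasurableSpace β] {μ : Measure α} {ν : Measure β}

theorem memLp_tensor {f : α → ℂ} {g : β → ℂ} (hf : MemLp f 2 μ) (hg : MemLp g 2 ν) :
    MemLp (fun p : α × β => f p.1 * g p.2) 2 (μ.prod ν) := by
  refine (memLp_two_iff_integrable_sq_norm (hf.1.comp_fst.mul hg.1.comp_snd)).2 ?_
  have h1 := (memLp_two_iff_integrable_sq_norm hf.1).1 hf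
  have h2 := (memLp_two_iff_integrable_sq_norm hg.1).1 hg
  simpa [mul_pow] using h1.mul_prod h2

/-- The function `(x, y) ↦ f(x) g(y)` in `L²(μ × ν)`. -/
def tensorFun (f : Lp ℂ 2 μ) (g : Lp ℂ 2 ν) : Lp ℂ 2 (μ.prod ν) :=
  (memLp_tensor (Lp.memLp f) (Lp.memLp g)).toLp (fun p => f p.1 * g p.2)

theorem tensorFun_ae (f : Lp ℂ 2 μ) (g : Lp ℂ 2 ν) :
    tensorFun f g =ᵐ[μ.prod ν] fun p => f p.1 * g p.2 :=
  MemLp.coeFn_toLp _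

variable [SigmaFinite μ] [SigmaFinite ν]

theorem inner_tensorFun (f f' : Lp ℂ 2 μ) (g g' : Lp ℂ 2 ν) :
    inner ℂ (tensorFun f g) (tensorFun f' g') = inner ℂ f f' * inner ℂ g g' := by
  simp only [L2.inner_def]
  rw [← integral_prod_mul]
  apply integral_congr_ae
  filter_upwards [tensorFun_ae f g, tensorFun_ae f' g'] with p h1 h2
  rw [h1, h2]
  simp only [RCLike.inner_apply, map_mul]
  ring

/-- The embedding `f ⊗ g ↦ f(x) g(y)` of the algebraic tensor product `L²(μ) ⊗ L²(ν)` into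
`L²(μ × ν)`. -/
def tensorEmb (μ : Measure α) (ν : Measure β) [SigmaFinite μ] [SigmaFinite ν] :
    (Lp ℂ 2 μ) ⊗[ℂ] (Lp ℂ 2 ν) →ₗ[ℂ] Lp ℂ 2 (μ.prod ν) :=
  TensorProduct.lift (LinearMap.mk₂ ℂ tensorFun
    (fun f f' g => by
      unfold tensorFun
      rw [← MemLp.toLp_add]
      apply MemLp.toLp_congr
      filter_upwards [(Measure.quasiMeasurePreserving_fst (ν := ν)).ae_eq_comp
        (Lp.coeFn_add f f')] with p hp
      simp only [Function.comp, Pi.add_apply] at hp ⊢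
      rw [hp, add_mul])
    (fun c f g => by
      unfold tensorFun
      rw [← MemLp.toLp_const_smul]
      apply MemLp.toLp_congr
      filter_upwards [(Measure.quasiMeasurePreserving_fst (ν := ν)).ae_eq_comp
        (Lp.coeFn_smul c f)] with p hp
      simp only [Function.comp, Pi.smul_apply, smul_eq_mul] at hp ⊢
      rw [hp, mul_assoc])
    (fun f g g' => by
      unfold tensorFun
      rw [← MemLp.toLp_add]
      apply MemLp.toLp_congr
      filter_upwards [(Measure.quasiMeasurePreserving_snd (μ := μ)).ae_eq_comp
        (Lp.coeFn_add g g')] with p hp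
      simp only [Function.comp, Pi.add_apply] at hp ⊢
      rw [hp, mul_add])
    (fun c f g => by
      unfold tensorFun
      rw [← MemLp.toLp_const_smul]
      apply MemLp.toLp_congr
      filter_upwards [(Measure.quasiMeasurePreserving_snd (μ := μ)).ae_eq_comp
        (Lp.coeFn_smul c g)] with p hp
      simp only [Function.comp, Pi.smul_apply, smul_eq_mul] at hp ⊢
      rw [hp, mul_left_comm]))

@[simp] theorem tensorEmb_tmul (f : Lp ℂ 2 μ) (g : Lp ℂ 2 ν) :
    tensorEmb μ ν (f ⊗ₜ g) = tensorFun f g := rfl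

theorem inner_tensorEmb (x y : (Lp ℂ 2 μ) ⊗[ℂ] (Lp ℂ 2 ν)) :
    inner ℂ (tensorEmb μ ν x) (tensorEmb μ ν y) = inner ℂ x y := by
  induction x with
  | zero => simp
  | add a b ha hb => rw [map_add, inner_add_left, inner_add_left, ha, hb]
  | tmul f g =>
    induction y with
    | zero => simp
    | add a b ha hb => rw [map_add, inner_add_right, inner_add_right, ha, hb]
    | tmul f' g' => simp [inner_tensorFun]

theorem norm_tensorEmb (x : (Lp ℂ 2 μ) ⊗[ℂ] (Lp ℂ 2 ν)) : ‖tensorEmb μ ν x‖ = ‖x‖ := by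
  rw [@norm_eq_sqrt_re_inner ℂ, @norm_eq_sqrt_re_inner ℂ _ _ _ _ x, inner_tensorEmb]

theorem denseRange_tensorEmb : DenseRange (tensorEmb μ ν) := by
  have htop : (LinearMap.range (tensorEmb μ ν)).topologicalClosure = ⊤ := by
    rw [Submodule.topologicalClosure_eq_top_iff, Submodule.eq_bot_iff]
    intro h hh
    rw [Submodule.mem_orthogonal] at hh
    set A := spanningSets μ
    set B := spanningSets ν
    have hfin : ∀ i, (μ.prod ν) (A i ×ˢ B i) < ∞ := fun i => by
      rw [Measure.prod_prod]
      exact ENNReal.mul_lt_top (measure_spanningSets_lt_top μ i) (measure_spanningSets_lt_top ν i)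
    have hAB : ∀ i, MeasurableSet (A i ×ˢ B i) := fun i =>
      (measurableSet_spanningSets μ i).prod (measurableSet_spanningSets ν i)
    have hint : ∀ i, IntegrableOn h (A i ×ˢ B i) (μ.prod ν) := fun i =>
      integrableOn_Lp_of_measure_ne_top h fact_one_le_two_ennreal.elim (hfin i).ne
    have hrect : ∀ s t, MeasurableSet s → MeasurableSet t → μ s ≠ ∞ → ν t ≠ ∞ →
        ∫ p in s ×ˢ t, h p ∂(μ.prod ν) = 0 := by
      intro s t hs ht hμs hνt
      have h0 := hh _ ⟨(indicatorConstLp 2 hs hμs (1 : ℂ)) ⊗ₜ (indicatorConstLp 2 ht hνt (1 : ℂ)),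
        rfl⟩
      rw [tensorEmb_tmul, L2.inner_def] at h0
      rw [← integral_indicator (hs.prod ht), ← h0]
      apply integral_congr_ae
      filter_upwards [tensorFun_ae (indicatorConstLp 2 hs hμs (1 : ℂ))
          (indicatorConstLp 2 ht hνt (1 : ℂ)),
        (Measure.quasiMeasurePreserving_fst (ν := ν)).ae_eq_comp
          (indicatorConstLp_coeFn (p := 2) (hs := hs) (hμs := hμs) (c := (1 : ℂ))),
        (Measure.quasiMeasurePreserving_snd (μ := μ)).ae_eq_comp
          (indicatorConstLp_coeFn (p := 2) (hs := ht) (hμs := hνt) (c := (1 : ℂ)))] with p h1 h2 h3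
      simp only [Function.comp] at h2 h3
      rw [h1, h2, h3]
      by_cases hp1 : p.1 ∈ s <;> by_cases hp2 : p.2 ∈ t <;>
        simp [indicator, hp1, hp2]
    have hall : ∀ i, ∀ s : Set (α × β), MeasurableSet s →
        ∫ p in s, h p ∂((μ.prod ν).restrict (A i ×ˢ B i)) = 0 := by
      intro i s hs
      induction s, hs using MeasurableSpace.induction_on_inter generateFrom_prod.symm isPiSystem_prod with
      | empty => simp
      | basic t ht =>
        obtain ⟨u, hu, v, hv, rfl⟩ := ht
        rw [Measure.restrict_restrict (hu.prod hv), prod_inter_prod]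
        refine hrect _ _ (hu.inter (measurableSet_spanningSets μ i))
          (hv.inter (measurableSet_spanningSets ν i)) ?_ ?_
        · exact ((measure_mono inter_subset_right).trans_lt (measure_spanningSets_lt_top μ i)).ne
        · exact ((measure_mono inter_subset_right).trans_lt (measure_spanningSets_lt_top ν i)).ne
      | compl t ht ih =>
        have e := integral_add_compl ht (hint i)
        rw [ih, zero_add] at e
        rw [e]
        exact hrect _ _ (measurableSet_spanningSets μ i) (measurableSet_spanningSets ν i)
          (measure_spanningSets_lt_top μ i).ne (measure_spanningSets_lt_top ν i).ne
      | iUnion f hd hf ih =>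
        rw [integral_iUnion hf hd (hint i).integrableOn]
        simp [ih]
    have hz : ∀ i, h =ᵐ[(μ.prod ν).restrict (A i ×ˢ B i)] 0 := fun i =>
      (hint i).ae_eq_zero_of_forall_setIntegral_eq_zero fun s hs _ => hall i s hs
    have hun : (⋃ i, A i ×ˢ B i) = univ := by
      rw [iUnion_prod_of_monotone (monotone_spanningSets μ) (monotone_spanningSets ν),
        iUnion_spanningSets, iUnion_spanningSets, univ_prod_univ]
    rw [Lp.eq_zero_iff_ae_eq_zero]
    have hz' := (ae_restrict_iUnion_iff (fun i => A i ×ˢ B i) (fun p => h p = 0)).2 hz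
    rwa [hun, Measure.restrict_univ] at hz'
  have := (Submodule.dense_iff_topologicalClosure_eq_top).2 htop
  rwa [LinearMap.coe_range] at this

/-- The tensor product `S ⊗ T` of two unitary operators, acting on `L²(μ × ν) = L²(μ) ⊗ L²(ν)`. -/
def tensorOp (S : Lp ℂ 2 μ ≃ₗᵢ[ℂ] Lp ℂ 2 μ) (T : Lp ℂ 2 ν ≃ₗᵢ[ℂ] Lp ℂ 2 ν) :
    Lp ℂ 2 (μ.prod ν) ≃ₗᵢ[ℂ] Lp ℂ 2 (μ.prod ν) :=
  LinearEquiv.extendOfIsometry (TensorProduct.congrIsometry S T).toLinearEquiv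
    (tensorEmb μ ν) (tensorEmb μ ν) denseRange_tensorEmb denseRange_tensorEmb
    (fun x => by
      rw [norm_tensorEmb, norm_tensorEmb]
      exact (TensorProduct.congrIsometry S T).norm_map x)

theorem tensorOp_apply (S : Lp ℂ 2 μ ≃ₗᵢ[ℂ] Lp ℂ 2 μ) (T : Lp ℂ 2 ν ≃ₗᵢ[ℂ] Lp ℂ 2 ν)
    (f : Lp ℂ 2 μ) (g : Lp ℂ 2 ν) :
    tensorOp S T (tensorFun f g) = tensorFun (S f) (T g) := by
  unfold tensorOp
  rw [← tensorEmb_tmul, LinearEquiv.extendOfIsometry_eq]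
  simp

end Tensor
section Transforms

/-- The Siegel domain `D₂`. -/
def D2 : Set (ℂ × ℂ) := {ζ | 0 < ζ.2.im - ‖ζ.1‖ ^ 2}

theorem isOpen_D2 : IsOpen D2 := isOpen_lt continuous_const (by fun_prop)

/-- The space `L²(D₂)`. -/
abbrev L2D : Type := Lp ℂ 2 ((volume : Measure (ℂ × ℂ)).restrict D2)

/-- Lebesgue measure on `ℝ₊ = (0, ∞)`. -/
abbrev volPos : Measure ℝ := volume.restrict (Ioi 0)

/-- Lebesgue measure on the flat domain `𝒟 = ℂ × Π`, where `Π` is the upper half-plane and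
`(u₁ + i v₁, u₂ + i v₂) ∈ 𝒟` is identified with the real coordinates `((u₁, v₁), (u₂, v₂))`. -/
abbrev flatMeasure : Measure ((ℝ × ℝ) × (ℝ × ℝ)) :=
  ((volume : Measure ℝ).prod (volume : Measure ℝ)).prod ((volume : Measure ℝ).prod volPos)

/-- The space `L²(𝒟)`. -/
abbrev L2Flat : Type := Lp ℂ 2 flatMeasure

/-- `κ(w₁, w₂) = (w₁, w₂ + i |w₁|²)`. -/
def kappa (w : (ℝ × ℝ) × (ℝ × ℝ)) : ℂ × ℂ :=
  (⟨w.1.1, w.1.2⟩, (⟨w.2.1, w.2.2⟩ : ℂ) + Complex.I * ‖(⟨w.1.1, w.1.2⟩ : ℂ)‖ ^ 2)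

theorem norm_mk_sq (a b : ℝ) : ‖(⟨a, b⟩ : ℂ)‖ ^ 2 = a ^ 2 + b ^ 2 := by
  rw [Complex.sq_norm, Complex.normSq_mk]; ring

theorem measurePreserving_kappa :
    MeasurePreserving kappa flatMeasure ((volume : Measure (ℂ × ℂ)).restrict D2) := by
  have hS : MeasurePreserving (fun p : (ℝ × ℝ) × (ℝ × ℝ) =>
      (p.1, (p.2 + (0, p.1.1 ^ 2 + p.1.2 ^ 2) : ℝ × ℝ)))
      (volume : Measure ((ℝ × ℝ) × (ℝ × ℝ))) volume := by
    refine MeasurePreserving.skew_product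
      (g := fun (a b : ℝ × ℝ) => b + ((0, a.1 ^ 2 + a.2 ^ 2) : ℝ × ℝ))
      (MeasurePreserving.id (volume : Measure (ℝ × ℝ))) ?_ (Eventually.of_forall fun a => ?_)
    · simp only [Function.uncurry_def]; fun_prop
    · exact (measurePreserving_add_right (volume : Measure (ℝ × ℝ)) _).map_eq
  have hE := (Complex.volume_preserving_equiv_real_prod.symm).prod
    (Complex.volume_preserving_equiv_real_prod.symm)
  have h := ((hE.comp hS).restrict_preimage isOpen_D2.measurableSet)
  have e1 : (Prod.map (Complex.measurableEquivRealProd.symm) (Complex.measurableEquivRealProd.symm)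
      ∘ fun p : (ℝ × ℝ) × (ℝ × ℝ) => (p.1, (p.2 + (0, p.1.1 ^ 2 + p.1.2 ^ 2) : ℝ × ℝ))) = kappa := by
    funext p
    have hn : ((‖(⟨p.1.1, p.1.2⟩ : ℂ)‖ : ℂ)) ^ 2 = ((p.1.1 ^ 2 + p.1.2 ^ 2 : ℝ) : ℂ) := by
      rw [← norm_mk_sq]; norm_cast
    simp only [Function.comp, Prod.map, kappa, hn]
    refine Prod.ext ?_ ?_
    · rfl
    · apply Complex.ext <;>
        simp only [Complex.measurableEquivRealProd, Complex.add_re, Complex.add_im,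
          Complex.mul_re, Complex.mul_im, Complex.I_re, Complex.I_im, Complex.ofReal_re,
          Complex.ofReal_im] <;> simp
  have e2 : kappa ⁻¹' D2 = univ ×ˢ (univ ×ˢ Ioi (0 : ℝ)) := by
    ext p
    have hn : ((‖(⟨p.1.1, p.1.2⟩ : ℂ)‖ : ℂ)) ^ 2 = ((‖(⟨p.1.1, p.1.2⟩ : ℂ)‖ ^ 2 : ℝ) : ℂ) := by
      norm_cast
    simp only [mem_preimage, D2, kappa, mem_ofPred_eq, hn, Complex.add_im, Complex.mul_im,
      Complex.I_re, Complex.I_im, Complex.ofReal_re, Complex.ofReal_im]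
    simp
  have e3 : (volume : Measure ((ℝ × ℝ) × (ℝ × ℝ))).restrict (univ ×ˢ (univ ×ˢ Ioi (0 : ℝ)))
      = flatMeasure := by
    rw [Measure.volume_eq_prod, ← Measure.prod_restrict, Measure.restrict_univ,
      Measure.volume_eq_prod, ← Measure.prod_restrict, Measure.restrict_univ]
  rw [e1, e2, e3] at h
  exact h

/-- `(U₀ f)(w) = f(κ(w))`. -/
def opU0 : L2D →ₗᵢ[ℂ] L2Flat :=
  weightedComp (fun _ => 1) kappa (.of_measurePreserving measurePreserving_kappa)

theorem isWeighted_dilation {a : ℝ} (ha : 0 < a) :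
    IsWeighted (fun _ : ℝ => √a) (fun t : ℝ => a * t) volume volume := by
  refine .of_ae_ne_zero measurable_const (by fun_prop)
    (Eventually.of_forall fun _ => (Real.sqrt_pos.2 ha).ne') fun f hf => ?_
  rw [lintegral_const_mul' _ _ ENNReal.ofReal_ne_top, Real.sq_sqrt ha.le]
  conv_rhs => rw [← Real.smul_map_volume_mul_left ha.ne', lintegral_smul_measure,
    lintegral_map hf (by fun_prop), abs_of_pos ha]
  rfl

/-- The unitary dilation `(D_a g)(t) = √a g(a t)` of `L²(ℝ)`, for `a > 0`. -/
def dilation (a : ℝ) (ha : 0 < a) :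
    Lp ℂ 2 (volume : Measure ℝ) ≃ₗᵢ[ℂ] Lp ℂ 2 (volume : Measure ℝ) :=
  LinearIsometryEquiv.ofSurjective
    (weightedComp (fun _ => √a) (fun t => a * t) (isWeighted_dilation ha)) fun g => by
      have ha' : 0 < a⁻¹ := inv_pos.2 ha
      refine ⟨weightedComp (fun _ => √(a⁻¹)) (fun t => a⁻¹ * t) (isWeighted_dilation ha') g, ?_⟩
      apply Lp.ext
      refine (weightedComp_ae _ _ _ _).trans ?_
      filter_upwards [(isWeighted_dilation ha).quasi.ae_eq_comp
        (weightedComp_ae _ _ (isWeighted_dilation ha') g)] with t ht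
      simp only [Function.comp] at ht
      rw [ht, inv_mul_cancel_left₀ ha.ne', ← mul_assoc, ← Complex.ofReal_mul,
        ← Real.sqrt_mul ha.le, mul_inv_cancel₀ ha.ne']
      simp

/-- The Fourier transform `(F g)(t) = (2π)^{-1/2} ∫ g(x) e^{-itx} dx` on `L²(ℝ)`. The `L²`
Fourier transform of Mathlib has the kernel `e^{-2πitx}`, so it is followed by the dilation with factor
`(2π)⁻¹`. -/
def fourierL2 : Lp ℂ 2 (volume : Measure ℝ) ≃ₗᵢ[ℂ] Lp ℂ 2 (volume : Measure ℝ) :=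
  (Lp.fourierTransformₗᵢ ℝ ℂ).trans (dilation (2 * Real.pi)⁻¹ (by positivity))

theorem fourierL2_schwartz (g : SchwartzMap ℝ ℂ) :
    fourierL2 (g.toLp 2) =ᵐ[volume] fun t =>
      ((1 / √(2 * Real.pi) : ℝ) : ℂ) * ∫ x, g x * Complex.exp (-(Complex.I * t * x)) := by
  have hp : (0 : ℝ) < (2 * Real.pi)⁻¹ := by positivity
  have h1 : fourierL2 (g.toLp 2) = weightedComp (fun _ => √((2 * Real.pi)⁻¹))
      (fun t => (2 * Real.pi)⁻¹ * t) (isWeighted_dilation hp)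
      ((FourierTransform.fourier g : SchwartzMap ℝ ℂ).toLp 2) := by
    rw [← SchwartzMap.toLp_fourier_eq]; rfl
  rw [h1]
  refine (weightedComp_ae _ _ _ _).trans ?_
  filter_upwards [(isWeighted_dilation hp).quasi.ae_eq_comp
    (SchwartzMap.coeFn_toLp (FourierTransform.fourier g : SchwartzMap ℝ ℂ) 2)] with t ht
  simp only [Function.comp] at ht
  rw [ht, SchwartzMap.fourier_coe, Real.fourier_real_eq_integral_exp_smul]
  congr 1
  · rw [Real.sqrt_inv, one_div]
  · apply integral_congr_ae
    refine Eventually.of_forall fun x => ?_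
    simp only [smul_eq_mul]
    rw [mul_comm]
    congr 2
    have : (Real.pi : ℂ) ≠ 0 := by exact_mod_cast Real.pi_ne_zero
    push_cast
    field_simp

/-- `U₁ = F ⊗ I ⊗ F ⊗ I`. -/
def opU1 : L2Flat ≃ₗᵢ[ℂ] L2Flat :=
  tensorOp (tensorOp fourierL2 (.refl ℂ _)) (tensorOp fourierL2 (.refl ℂ _))

/-- `ψ₁(ξ₁, t₂ + i s₂) = (ξ₁, t₂ + i s₂ / (2|t₂|))`. -/
def psi1 (ξ : (ℝ × ℝ) × (ℝ × ℝ)) : (ℝ × ℝ) × (ℝ × ℝ) :=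
  (ξ.1, (ξ.2.1, ξ.2.2 / (2 * |ξ.2.1|)))

/-- `ψ₂(x₁ + i y₁, z₂) = (√|x₂| (x₁ + y₁) + i (-x₁ + y₁) / (2√|x₂|), z₂)`, where `z₂ = x₂ + i y₂`. -/
def psi2 (z : (ℝ × ℝ) × (ℝ × ℝ)) : (ℝ × ℝ) × (ℝ × ℝ) :=
  ((√|z.2.1| * (z.1.1 + z.1.2), 1 / (2 * √|z.2.1|) * (-z.1.1 + z.1.2)), z.2)

theorem ae_ne_zero_fst : ∀ᵐ b ∂((volume : Measure ℝ).prod volPos), b.1 ≠ 0 :=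
  (Measure.quasiMeasurePreserving_fst (μ := (volume : Measure ℝ)) (ν := volPos)).ae
    (p := fun t => t ≠ 0) (by simp [ae_iff])

theorem isWeighted_psi1 :
    IsWeighted (fun ξ => 1 / √(2 * |ξ.2.1|)) psi1 flatMeasure flatMeasure := by
  have hm : Measurable psi1 := by unfold psi1; fun_prop
  have hw : Measurable (fun ξ : (ℝ × ℝ) × (ℝ × ℝ) => 1 / √(2 * |ξ.2.1|)) := by fun_prop
  refine .of_ae_ne_zero hw hm ?_ fun f hf => ?_
  · filter_upwards [(Measure.quasiMeasurePreserving_snd (μ := (volume : Measure ℝ).prod volume)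
      (ν := (volume : Measure ℝ).prod volPos)).ae ae_ne_zero_fst] with ξ hξ
    have : 0 < |ξ.2.1| := abs_pos.2 hξ
    positivity
  · rw [lintegral_prod _ (by
        exact ((hw.pow_const 2).ennreal_ofReal.mul (hf.comp hm)).aemeasurable),
      lintegral_prod _ hf.aemeasurable]
    refine lintegral_congr fun a => ?_
    rw [lintegral_prod _ (by
        exact (((hw.pow_const 2).ennreal_ofReal.mul (hf.comp hm)).comp
          measurable_prodMk_left).aemeasurable),
      lintegral_prod _ (by exact (hf.comp measurable_prodMk_left).aemeasurable)]
    refine lintegral_congr_ae ?_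
    have h0 : ∀ᵐ t : ℝ, t ≠ 0 := by simp [ae_iff]
    filter_upwards [h0] with t ht
    have hc : 0 < (2 * |t|)⁻¹ := by have := abs_pos.2 ht; positivity
    have hh : Measurable fun s => f (a, (t, s)) := by fun_prop
    have e : (1 / √(2 * |t|)) ^ 2 = (2 * |t|)⁻¹ := by
      rw [div_pow, Real.sq_sqrt (by positivity), one_pow, one_div]
    simp only [psi1, e]
    rw [lintegral_const_mul' _ _ ENNReal.ofReal_ne_top,
      ← lintegral_indicator measurableSet_Ioi, ← lintegral_indicator measurableSet_Ioi]
    conv_rhs => rw [← Real.smul_map_volume_mul_left hc.ne', lintegral_smul_measure,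
      lintegral_map (hh.indicator measurableSet_Ioi) (by fun_prop), abs_of_pos hc]
    rw [smul_eq_mul]
    congr 1
    refine lintegral_congr fun s => ?_
    by_cases hs : 0 < s
    · have hs' : 0 < (2 * |t|)⁻¹ * s := by positivity
      rw [indicator_of_mem (mem_Ioi.2 hs), indicator_of_mem (mem_Ioi.2 hs'), div_eq_inv_mul]
    · have hs' : ¬ 0 < (2 * |t|)⁻¹ * s := by
        rw [mul_pos_iff_of_pos_left hc]; exact hs
      rw [indicator_of_notMem (by simpa using hs), indicator_of_notMem (by simpa using hs')]

theorem measurePreserving_psi2 : MeasurePreserving psi2 flatMeasure flatMeasure := by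
  let g : ℝ × ℝ → ℝ × ℝ → ℝ × ℝ := fun b a =>
    (√|b.1| * (a.1 + a.2), 1 / (2 * √|b.1|) * (-a.1 + a.2))
  have hg : MeasurePreserving (fun p : (ℝ × ℝ) × (ℝ × ℝ) => (p.1, g p.1 p.2))
      (((volume : Measure ℝ).prod volPos).prod ((volume : Measure ℝ).prod volume))
      (((volume : Measure ℝ).prod volPos).prod ((volume : Measure ℝ).prod volume)) := by
    refine MeasurePreserving.skew_product (MeasurePreserving.id _) ?_ ?_
    · simp only [Function.uncurry_def, g]; fun_prop
    · filter_upwards [ae_ne_zero_fst] with b hb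
      have hr : 0 < √|b.1| := Real.sqrt_pos.2 (abs_pos.2 hb)
      set r := √|b.1| with hrdef
      let M : Matrix (Fin 2) (Fin 2) ℝ := !![r, r; -(1 / (2 * r)), 1 / (2 * r)]
      let L := Matrix.toLin (Module.Basis.finTwoProd ℝ) (Module.Basis.finTwoProd ℝ) M
      have hdet : LinearMap.det L = 1 := by
        rw [LinearMap.det_toLin, Matrix.det_fin_two_of]
        field_simp; norm_num
      have hL : g b = L := by
        funext a
        simp only [L, M, Matrix.toLin_finTwoProd_apply, g, ← hrdef]
        ext <;> simp <;> ring
      rw [hL, ← Measure.volume_eq_prod,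
        Measure.map_linearMap_addHaar_eq_smul_addHaar _ (by rw [hdet]; exact one_ne_zero), hdet]
      simp
  exact Measure.measurePreserving_swap.comp (hg.comp Measure.measurePreserving_swap)

/-- `(V₁ f)(ξ) = (2|t₂|)^{-1/2} f(ψ₁(ξ))`. -/
def opV1 : L2Flat →ₗᵢ[ℂ] L2Flat :=
  weightedComp (fun ξ => 1 / √(2 * |ξ.2.1|)) psi1 isWeighted_psi1

/-- `(V₂ g)(z) = g(ψ₂(z))`. -/
def opV2 : L2Flat →ₗᵢ[ℂ] L2Flat :=
  weightedComp (fun _ => 1) psi2 (.of_measurePreserving measurePreserving_psi2)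

/-- `U = V₂ V₁ U₁ U₀`. -/
def opU : L2D →ₗᵢ[ℂ] L2Flat :=
  opV2.comp (opV1.comp (opU1.toLinearIsometry.comp opU0))

end Transforms

section PolyBergman

/-- `∂/∂ζ̄₁`. -/
def dbar1 (F : ℂ × ℂ → ℂ) (ζ : ℂ × ℂ) : ℂ :=
  (1 / 2) * (fderiv ℝ F ζ (1, 0) + Complex.I * fderiv ℝ F ζ (Complex.I, 0))

/-- `∂/∂ζ̄₂`. -/
def dbar2 (F : ℂ × ℂ → ℂ) (ζ : ℂ × ℂ) : ℂ :=
  (1 / 2) * (fderiv ℝ F ζ (0, 1) + Complex.I * fderiv ℝ F ζ (0, Complex.I))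

/-- `∂/∂ζ̄₁ - 2i ζ₁ ∂/∂ζ̄₂`. -/
def tangentialCR (F : ℂ × ℂ → ℂ) (ζ : ℂ × ℂ) : ℂ :=
  dbar1 F ζ - 2 * Complex.I * ζ.1 * dbar2 F ζ

/-- `F` is smooth on `D₂` and satisfies there the two equations
`(∂/∂ζ̄₁ - 2i ζ₁ ∂/∂ζ̄₂)^{l₁} F = 0` and `(∂/∂ζ̄₂)^{l₂} F = 0`. -/
structure IsLAnalytic (l₁ l₂ : ℕ) (F : ℂ × ℂ → ℂ) : Prop where
  smooth : ContDiffOn ℝ (⊤ : ℕ∞) F D2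
  eq₁ : ∀ ζ ∈ D2, tangentialCR^[l₁] F ζ = 0
  eq₂ : ∀ ζ ∈ D2, dbar2^[l₂] F ζ = 0

/-- The properties of a first-order differential operator on `D₂` which make the solutions of
`P^l F = 0` a linear space. -/
structure IsLinearOp (P : (ℂ × ℂ → ℂ) → ℂ × ℂ → ℂ) : Prop where
  smooth : ∀ F, ContDiffOn ℝ (⊤ : ℕ∞) F D2 → ContDiffOn ℝ (⊤ : ℕ∞) (P F) D2
  lin : ∀ F G H, ∀ c : ℂ, ContDiffOn ℝ (⊤ : ℕ∞) F D2 → ContDiffOn ℝ (⊤ : ℕ∞) G D2 →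
    EqOn H (fun ζ => F ζ + c * G ζ) D2 → EqOn (P H) (fun ζ => P F ζ + c * P G ζ) D2

theorem IsLinearOp.iterate {P : (ℂ × ℂ → ℂ) → ℂ × ℂ → ℂ} (hP : IsLinearOp P) (l : ℕ) :
    IsLinearOp (P^[l]) := by
  induction l with
  | zero => exact ⟨fun F hF => hF, fun F G H c _ _ h => h⟩
  | succ l ih =>
    refine ⟨fun F hF => ?_, fun F G H c hF hG h => ?_⟩
    · rw [Function.iterate_succ_apply']; exact hP.smooth _ (ih.smooth F hF)
    · simp only [Function.iterate_succ_apply']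
      exact hP.lin _ _ _ c (ih.smooth F hF) (ih.smooth G hG) (ih.lin F G H c hF hG h)

theorem contDiffOn_fderiv_apply {F : ℂ × ℂ → ℂ} (hF : ContDiffOn ℝ (⊤ : ℕ∞) F D2) (v : ℂ × ℂ) :
    ContDiffOn ℝ (⊤ : ℕ∞) (fun ζ => fderiv ℝ F ζ v) D2 :=
  (hF.fderiv_of_isOpen isOpen_D2 (by simp)).clm_apply contDiffOn_const

theorem fderiv_lin {F G H : ℂ × ℂ → ℂ} {c : ℂ} (hF : ContDiffOn ℝ (⊤ : ℕ∞) F D2)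
    (hG : ContDiffOn ℝ (⊤ : ℕ∞) G D2) (h : EqOn H (fun ζ => F ζ + c * G ζ) D2) {ζ : ℂ × ℂ}
    (hζ : ζ ∈ D2) (v : ℂ × ℂ) : fderiv ℝ H ζ v = fderiv ℝ F ζ v + c * fderiv ℝ G ζ v := by
  have hn := isOpen_D2.mem_nhds hζ
  have dF : DifferentiableAt ℝ F ζ := (hF.contDiffAt hn).differentiableAt (by simp)
  have dG : DifferentiableAt ℝ G ζ := (hG.contDiffAt hn).differentiableAt (by simp)
  rw [(h.eventuallyEq_of_mem hn).fderiv_eq, fderiv_fun_add dF (dG.const_mul c),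
    fderiv_const_mul dG c]
  simp

theorem isLinearOp_dbar2 : IsLinearOp dbar2 := by
  refine ⟨fun F hF => ?_, fun F G H c hF hG h ζ hζ => ?_⟩
  · exact contDiffOn_const.mul ((contDiffOn_fderiv_apply hF _).add
      (contDiffOn_const.mul (contDiffOn_fderiv_apply hF _)))
  · simp only [dbar2, fderiv_lin hF hG h hζ]; ring

theorem isLinearOp_tangentialCR : IsLinearOp tangentialCR := by
  refine ⟨fun F hF => ?_, fun F G H c hF hG h ζ hζ => ?_⟩
  · refine ContDiffOn.sub ?_ (ContDiffOn.mul ?_ (isLinearOp_dbar2.smooth F hF))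
    · exact contDiffOn_const.mul ((contDiffOn_fderiv_apply hF _).add
        (contDiffOn_const.mul (contDiffOn_fderiv_apply hF _)))
    · exact (contDiff_const.mul contDiff_fst).contDiffOn
  · simp only [tangentialCR, isLinearOp_dbar2.lin F G H c hF hG h hζ]
    simp only [dbar1, fderiv_lin hF hG h hζ]; ring

theorem IsLAnalytic.lin {l₁ l₂ : ℕ} {F G : ℂ × ℂ → ℂ} (hF : IsLAnalytic l₁ l₂ F)
    (hG : IsLAnalytic l₁ l₂ G) (c : ℂ) : IsLAnalytic l₁ l₂ (fun ζ => F ζ + c * G ζ) := by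
  refine ⟨hF.smooth.add (contDiffOn_const.mul hG.smooth), fun ζ hζ => ?_, fun ζ hζ => ?_⟩
  · rw [(isLinearOp_tangentialCR.iterate l₁).lin F G _ c hF.smooth hG.smooth (eqOn_refl _ _) hζ]
    simp [hF.eq₁ ζ hζ, hG.eq₁ ζ hζ]
  · rw [(isLinearOp_dbar2.iterate l₂).lin F G _ c hF.smooth hG.smooth (eqOn_refl _ _) hζ]
    simp [hF.eq₂ ζ hζ, hG.eq₂ ζ hζ]

theorem isLAnalytic_zero (l₁ l₂ : ℕ) : IsLAnalytic l₁ l₂ 0 := by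
  have key : ∀ P, IsLinearOp P → ∀ l, ∀ ζ ∈ D2, P^[l] 0 ζ = 0 := fun P hP l ζ hζ => by
    have := (hP.iterate l).lin 0 0 0 (-1) contDiffOn_const contDiffOn_const
      (fun _ _ => by simp) hζ
    simpa using this
  exact ⟨contDiffOn_const, key _ isLinearOp_tangentialCR _, key _ isLinearOp_dbar2 _⟩

/-- The poly-Bergman-type space `A²_{(l₁,l₂)}(D₂)`: the elements of `L²(D₂)` which are represented
by an `(l₁,l₂)`-analytic function. -/
def polyBergman (l₁ l₂ : ℕ) : Submodule ℂ L2D where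
  carrier := {f | ∃ F, IsLAnalytic l₁ l₂ F ∧ f =ᵐ[volume.restrict D2] F}
  zero_mem' := ⟨0, isLAnalytic_zero _ _, Lp.coeFn_zero _ _ _⟩
  add_mem' := by
    rintro f g ⟨F, hF, hfF⟩ ⟨G, hG, hgG⟩
    refine ⟨_, hF.lin hG 1, ?_⟩
    filter_upwards [Lp.coeFn_add f g, hfF, hgG] with ζ h1 h2 h3
    rw [h1, Pi.add_apply, h2, h3, one_mul]
  smul_mem' := by
    rintro c f ⟨F, hF, hfF⟩
    refine ⟨_, (isLAnalytic_zero l₁ l₂).lin hF c, ?_⟩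
    filter_upwards [Lp.coeFn_smul c f, hfF] with ζ h1 h2
    rw [h1, Pi.smul_apply, h2, Pi.zero_apply, zero_add, smul_eq_mul]

end PolyBergman

section Bargmann

/-- The Laguerre polynomial `L_m(y) = (e^y / m!) (d/dy)^m (e^{-y} y^m)`. -/
def laguerre (m : ℕ) (y : ℝ) : ℝ :=
  Real.exp y / m.factorial * iteratedDeriv m (fun t => Real.exp (-t) * t ^ m) y

/-- The Laguerre function `ℓ_m(y) = (-1)^m L_m(y) e^{-y/2}`. -/
def laguerreFun (m : ℕ) (y : ℝ) : ℝ := (-1) ^ m * laguerre m y * Real.exp (-y / 2)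

/-- The Hermite function `h₀(y) = π^{-1/4} e^{-y²/2}`. -/
def hermiteFun0 (y : ℝ) : ℝ := 1 / √(√Real.pi) * Real.exp (-y ^ 2 / 2)

theorem laguerre_eq (m : ℕ) (y : ℝ) : laguerre m y =
    ∑ i ∈ Finset.range (m + 1), ((m.choose i : ℝ) * (-1) ^ i *
      (∏ j ∈ Finset.range (m - i), ((m : ℝ) - j)) / m.factorial) * y ^ (m - (m - i)) := by
  have he : ∀ i : ℕ, iteratedDeriv i (fun t : ℝ => Real.exp (-t)) y = (-1) ^ i * Real.exp (-y) := by
    intro i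
    have h := congrFun (iteratedDeriv_exp_const_mul i (-1)) y
    simpa using h
  unfold laguerre
  rw [iteratedDeriv_fun_mul (by fun_prop) (by fun_prop), Finset.mul_sum]
  refine Finset.sum_congr rfl fun i _ => ?_
  rw [he, iteratedDeriv_eq_iterate, iter_deriv_pow]
  have hexp : Real.exp y * Real.exp (-y) = 1 := by rw [← Real.exp_add]; simp
  calc _ = (Real.exp y * Real.exp (-y)) * (((m.choose i : ℝ) * (-1) ^ i *
      (∏ j ∈ Finset.range (m - i), ((m : ℝ) - j)) / m.factorial) * y ^ (m - (m - i))) := by ring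
    _ = _ := by rw [hexp, one_mul]

theorem memLp_pow_mul_exp (k : ℕ) :
    MemLp (fun y : ℝ => ((y ^ k * Real.exp (-y / 2) : ℝ) : ℂ)) 2 volPos := by
  have hc : Continuous (fun y : ℝ => ((y ^ k * Real.exp (-y / 2) : ℝ) : ℂ)) := by fun_prop
  refine (memLp_two_iff_integrable_sq_norm hc.aestronglyMeasurable).2 ?_
  have h := Real.GammaIntegral_convergent (s := 2 * k + 1) (by positivity)
  refine h.congr ?_
  filter_upwards [ae_restrict_mem measurableSet_Ioi] with y hy
  rw [Complex.norm_real, Real.norm_eq_abs, sq_abs, mul_pow, ← Real.exp_nat_mul,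
    show ((2 * k + 1 : ℝ) - 1) = ((2 * k : ℕ) : ℝ) by push_cast; ring, Real.rpow_natCast]
  rw [show ((2 : ℕ) : ℝ) * (-y / 2) = -y by push_cast; ring]
  ring

theorem memLp_laguerreFun (m : ℕ) : MemLp (fun y => (laguerreFun m y : ℂ)) 2 volPos := by
  have : (fun y => (laguerreFun m y : ℂ)) = fun y => ∑ i ∈ Finset.range (m + 1),
      (((-1) ^ m * ((m.choose i : ℝ) * (-1) ^ i *
      (∏ j ∈ Finset.range (m - i), ((m : ℝ) - j)) / m.factorial) : ℝ) : ℂ) *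
        ((y ^ (m - (m - i)) * Real.exp (-y / 2) : ℝ) : ℂ) := by
    funext y
    rw [laguerreFun, laguerre_eq, Finset.mul_sum, Finset.sum_mul, Complex.ofReal_sum]
    refine Finset.sum_congr rfl fun i _ => ?_
    push_cast
    ring
  rw [this]
  exact memLp_finsetSum _ fun i _ => (memLp_pow_mul_exp _).const_mul _

theorem memLp_hermiteFun0 : MemLp (fun y => (hermiteFun0 y : ℂ)) 2 (volume : Measure ℝ) := by
  have hc : Continuous (fun y : ℝ => (hermiteFun0 y : ℂ)) := by unfold hermiteFun0; fun_prop
  refine (memLp_two_iff_integrable_sq_norm hc.aestronglyMeasurable).2 ?_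
  have h := (integrable_exp_neg_mul_sq (b := 1) one_pos).const_mul ((1 / √(√Real.pi)) ^ 2)
  refine h.congr (Eventually.of_forall fun y => ?_)
  simp only [hermiteFun0]
  rw [Complex.norm_real, Real.norm_eq_abs, sq_abs, mul_pow, ← Real.exp_nat_mul]
  congr 2
  push_cast; ring

/-- Lebesgue measure on `ℝ × ℝ₊`. -/
abbrev halfMeasure : Measure (ℝ × ℝ) := (volume : Measure ℝ).prod volPos

/-- The Hilbert space `(L²(ℝ × ℝ₊))ⁿ`. -/
abbrev L2Half (n : ℕ) : Type := PiLp 2 (fun _ : Fin n => Lp ℂ 2 halfMeasure)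

theorem halfMeasure_eq : halfMeasure =
    ((volume : Measure ℝ).prod (volume : Measure ℝ)).restrict (univ ×ˢ Ioi 0) := by
  rw [← Measure.prod_restrict, Measure.restrict_univ]

theorem memLp_zeroExt {f : ℝ × ℝ → ℂ} (hf : MemLp f 2 halfMeasure) :
    MemLp ((univ ×ˢ Ioi (0 : ℝ)).indicator f) 2 ((volume : Measure ℝ).prod volume) := by
  rw [memLp_indicator_iff_restrict (MeasurableSet.univ.prod measurableSet_Ioi), ← halfMeasure_eq]
  exact hf

theorem ae_zeroExt {p : ℝ × ℝ → Prop} (h : ∀ᵐ x ∂halfMeasure, p x) :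
    ∀ᵐ x ∂((volume : Measure ℝ).prod (volume : Measure ℝ)), x ∈ univ ×ˢ Ioi (0 : ℝ) → p x := by
  rw [halfMeasure_eq] at h
  exact (ae_restrict_iff' (MeasurableSet.univ.prod measurableSet_Ioi)).1 h

/-- The isometric embedding `g ↦ χ_{ℝ₊}(x₂) g(x₁, x₂)` of `L²(ℝ × ℝ₊)` into `L²(ℝ × ℝ)`. -/
def zeroExt : Lp ℂ 2 halfMeasure →ₗᵢ[ℂ] Lp ℂ 2 ((volume : Measure ℝ).prod (volume : Measure ℝ)) where
  toFun f := (memLp_zeroExt (Lp.memLp f)).toLp ((univ ×ˢ Ioi (0 : ℝ)).indicator f)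
  map_add' f g := by
    rw [← MemLp.toLp_add]
    apply MemLp.toLp_congr
    filter_upwards [ae_zeroExt (Lp.coeFn_add f g)] with x hx
    by_cases h : x ∈ univ ×ˢ Ioi (0 : ℝ)
    · simp only [Pi.add_apply, indicator_of_mem h, hx h]
    · simp only [Pi.add_apply, indicator_of_notMem h, add_zero]
  map_smul' c f := by
    rw [RingHom.id_apply, ← MemLp.toLp_const_smul]
    apply MemLp.toLp_congr
    filter_upwards [ae_zeroExt (Lp.coeFn_smul c f)] with x hx
    by_cases h : x ∈ univ ×ˢ Ioi (0 : ℝ)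
    · simp only [Pi.smul_apply, indicator_of_mem h, hx h]
    · simp only [Pi.smul_apply, indicator_of_notMem h, smul_zero]
  norm_map' f := by
    change ‖(memLp_zeroExt (Lp.memLp f)).toLp ((univ ×ˢ Ioi (0 : ℝ)).indicator f)‖ = ‖f‖
    rw [Lp.norm_toLp, Lp.norm_def,
      eLpNorm_indicator_eq_eLpNorm_restrict (MeasurableSet.univ.prod measurableSet_Ioi),
      ← halfMeasure_eq]

theorem zeroExt_ae (f : Lp ℂ 2 halfMeasure) :
    zeroExt f =ᵐ[(volume : Measure ℝ).prod volume] (univ ×ˢ Ioi (0 : ℝ)).indicator f :=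
  MemLp.coeFn_toLp (memLp_zeroExt (Lp.memLp f))

/-- `((x₁, y₁), (x₂, y₂)) ↦ ((x₁, x₂), (y₁, y₂))`. -/
def rearrange (p : (ℝ × ℝ) × (ℝ × ℝ)) : (ℝ × ℝ) × (ℝ × ℝ) := ((p.1.1, p.2.1), (p.1.2, p.2.2))

theorem measurePreserving_rearrange : MeasurePreserving rearrange flatMeasure
    (((volume : Measure ℝ).prod volume).prod halfMeasure) := by
  have h1 := measurePreserving_prodAssoc (volume : Measure ℝ) (volume : Measure ℝ) halfMeasure
  have h2 := (measurePreserving_prodAssoc (volume : Measure ℝ) (volume : Measure ℝ) volPos).symm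
  have h3 := (Measure.measurePreserving_swap (μ := (volume : Measure ℝ))
    (ν := (volume : Measure ℝ))).prod (MeasurePreserving.id volPos)
  have h4 := measurePreserving_prodAssoc (volume : Measure ℝ) (volume : Measure ℝ) volPos
  have h5 := (measurePreserving_prodAssoc (volume : Measure ℝ) (volume : Measure ℝ)
    halfMeasure).symm
  exact h5.comp (((MeasurePreserving.id (volume : Measure ℝ)).prod (h4.comp (h3.comp h2))).comp h1)

/-- For `b ∈ L²(ℝ × ℝ₊)`, the operator `g ↦ χ_{ℝ₊}(x₂) g(x₁, x₂) b(y₁, y₂)` from `L²(ℝ × ℝ₊)`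
to `L²(𝒟)`. -/
def embedWith (b : Lp ℂ 2 halfMeasure) : Lp ℂ 2 halfMeasure →L[ℂ] L2Flat :=
  LinearMap.mkContinuous
    ((Lp.compMeasurePreservingₗᵢ ℂ rearrange measurePreserving_rearrange).toLinearMap ∘ₗ
      (tensorEmb _ _) ∘ₗ ((TensorProduct.mk ℂ _ _).flip b) ∘ₗ zeroExt.toLinearMap)
    ‖b‖ fun g => by
      have : ‖tensorEmb ((volume : Measure ℝ).prod (volume : Measure ℝ)) halfMeasure
          (zeroExt g ⊗ₜ b)‖ = ‖b‖ * ‖g‖ := by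
        rw [norm_tensorEmb, TensorProduct.norm_tmul, zeroExt.norm_map, mul_comm]
      rw [← this]
      exact ((Lp.compMeasurePreservingₗᵢ ℂ rearrange measurePreserving_rearrange).norm_map _).le

theorem embedWith_ae (b g : Lp ℂ 2 halfMeasure) : embedWith b g =ᵐ[flatMeasure] fun p =>
    (univ ×ˢ Ioi (0 : ℝ)).indicator g (p.1.1, p.2.1) * b (p.1.2, p.2.2) := by
  have h0 : embedWith b g = Lp.compMeasurePreservingₗᵢ ℂ rearrange measurePreserving_rearrange
      (tensorFun (zeroExt g) b) := rfl
  rw [h0]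
  refine (Lp.coeFn_compMeasurePreserving _ measurePreserving_rearrange).trans ?_
  have hq := measurePreserving_rearrange.quasiMeasurePreserving
  filter_upwards [hq.ae_eq_comp (tensorFun_ae (zeroExt g) b),
    hq.ae_eq_comp ((Measure.quasiMeasurePreserving_fst (ν := halfMeasure)).ae_eq_comp
      (zeroExt_ae g))] with p h1 h2
  simp only [Function.comp] at h1 h2 ⊢
  rw [h1, h2]
  rfl

/-- The function `h₀(y₁) ℓ_k(y₂)` in `L²(ℝ × ℝ₊)`. -/
def basisFun (k : ℕ) : Lp ℂ 2 halfMeasure :=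
  tensorFun (memLp_hermiteFun0.toLp _) ((memLp_laguerreFun k).toLp _)

/-- The embedding `R_{0(1,n)} : (L²(ℝ × ℝ₊))ⁿ → L²(𝒟)`,
`g ↦ χ_{ℝ₊}(x₂) h₀(y₁) ∑ₖ ℓ_k(y₂) g_k(x₁, x₂)`, where `k` runs from `0` to `n - 1`. -/
def opR0 (n : ℕ) : L2Half n →L[ℂ] L2Flat :=
  ∑ k : Fin n, (embedWith (basisFun k)).comp (PiLp.proj 2 _ k)

theorem opR0_ae (n : ℕ) (g : L2Half n) : opR0 n g =ᵐ[flatMeasure] fun p =>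
    (Ioi (0 : ℝ)).indicator 1 p.2.1 * (hermiteFun0 p.1.2 : ℂ) *
      ∑ k : Fin n, (laguerreFun k p.2.2 : ℂ) * g k (p.1.1, p.2.1) := by
  have hq := measurePreserving_rearrange.quasiMeasurePreserving
  have hk : ∀ k : Fin n, embedWith (basisFun k) (g k) =ᵐ[flatMeasure] fun p =>
      (Ioi (0 : ℝ)).indicator 1 p.2.1 * (hermiteFun0 p.1.2 : ℂ) *
        ((laguerreFun k p.2.2 : ℂ) * g k (p.1.1, p.2.1)) := by
    intro k
    have hb : basisFun k =ᵐ[halfMeasure] fun q => (hermiteFun0 q.1 : ℂ) * laguerreFun k q.2 := by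
      refine (tensorFun_ae _ _).trans ?_
      filter_upwards [(Measure.quasiMeasurePreserving_fst (ν := volPos)).ae_eq_comp
          memLp_hermiteFun0.coeFn_toLp,
        (Measure.quasiMeasurePreserving_snd (μ := (volume : Measure ℝ))).ae_eq_comp
          (memLp_laguerreFun k).coeFn_toLp] with q h1 h2
      simp only [Function.comp] at h1 h2
      rw [h1, h2]
    filter_upwards [embedWith_ae (basisFun k) (g k), hq.ae_eq_comp
      ((Measure.quasiMeasurePreserving_snd
        (μ := (volume : Measure ℝ).prod (volume : Measure ℝ))).ae_eq_comp hb)] with p h1 h2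
    simp only [Function.comp, rearrange] at h2
    rw [h1, h2]
    by_cases hp : p.2.1 ∈ Ioi (0 : ℝ)
    · rw [indicator_of_mem (by exact ⟨mem_univ _, hp⟩), indicator_of_mem hp, Pi.one_apply]; ring
    · rw [indicator_of_notMem (by exact fun h => hp h.2), indicator_of_notMem hp]; ring
  have hsum : opR0 n g = ∑ k : Fin n, embedWith (basisFun k) (g k) := by
    simp [opR0]
  have hae : ∀ s : Finset (Fin n), (∑ k ∈ s, embedWith (basisFun k) (g k) : L2Flat)
      =ᵐ[flatMeasure] ∑ k ∈ s, ⇑(embedWith (basisFun k) (g k)) := by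
    intro s
    induction s using Finset.cons_induction with
    | empty => simpa using Lp.coeFn_zero ℂ 2 flatMeasure
    | cons a s ha ih =>
      rw [Finset.sum_cons, Finset.sum_cons]
      exact (Lp.coeFn_add _ _).trans (EventuallyEq.rfl.add ih)
  rw [hsum]
  refine (hae _).trans ?_
  filter_upwards [ae_all_iff.2 hk] with p hp
  simp only [Finset.sum_apply, hp, Finset.mul_sum]

/-- The Bargmann-type operator `R_{(1,n)} = R_{0(1,n)}^* U : L²(D₂) → (L²(ℝ × ℝ₊))ⁿ`. -/
def opR (n : ℕ) : L2D →L[ℂ] L2Half n :=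
  (ContinuousLinearMap.adjoint (opR0 n)).comp opU.toContinuousLinearMap

end Bargmann

section Toeplitz

/-- The function `c̃(ζ) = c(Im ζ₁, Im ζ₂ - |ζ₁|²)`. Only the values of `c` on `ℝ × ℝ₊` matter
on `D₂`. -/
def nilpotentSymbol (c : ℝ → ℝ → ℂ) (ζ : ℂ × ℂ) : ℂ := c ζ.1.im (ζ.2.im - ‖ζ.1‖ ^ 2)

/-- Multiplication `f ↦ a f` on `L²(D₂)` by `a ∈ L^∞(D₂)`. -/
def mulOp (a : Lp ℂ ∞ ((volume : Measure (ℂ × ℂ)).restrict D2)) : L2D →L[ℂ] L2D :=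
  (ContinuousLinearMap.mul ℂ ℂ).holderL (volume.restrict D2) ∞ 2 2 a

/-- The Toeplitz operator `T_a f = B(a f)` on `A²_{(1,n)}(D₂)`, where `B` is the orthogonal
projection from `L²(D₂)` onto `A²_{(1,n)}(D₂)`. -/
def toeplitz (n : ℕ) [(polyBergman 1 n).HasOrthogonalProjection]
    (a : Lp ℂ ∞ ((volume : Measure (ℂ × ℂ)).restrict D2)) : polyBergman 1 n →L[ℂ] polyBergman 1 n :=
  (polyBergman 1 n).orthogonalProjectionOnto.comp ((mulOp a).comp (polyBergman 1 n).subtypeL)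

/-- The integrand `c((-x₁ + y₁) / (2√x₂), y₂ / (2x₂)) h₀(y₁)² N(y₂) N(y₂)ᵀ` at the place `(j, k)`,
where `N = (ℓ₀, …, ℓ_{n-1})ᵀ`. -/
def gammaIntegrand (c : ℝ → ℝ → ℂ) (j k : ℕ) (x₁ x₂ y₁ y₂ : ℝ) : ℂ :=
  c ((-x₁ + y₁) / (2 * √x₂)) (y₂ / (2 * x₂)) * (hermiteFun0 y₁ : ℂ) ^ 2 *
    ((laguerreFun j y₂ : ℂ) * (laguerreFun k y₂ : ℂ))

/-- The matrix-valued function `γ^c`. -/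
def gammaMatrix (n : ℕ) (c : ℝ → ℝ → ℂ) (x₁ x₂ : ℝ) : Matrix (Fin n) (Fin n) ℂ :=
  Matrix.of fun j k => ∫ y₁ : ℝ, ∫ y₂ in Ioi (0 : ℝ), gammaIntegrand c j k x₁ x₂ y₁ y₂

end Toeplitz

end Siegel

end

/-!
Put `ρ(ζ) = Im ζ₂ - |ζ₁|²`, `v = Im ζ₁`, and let `R₀ = opR0 n`, so that `R = R₀^* U`. The operator
`U` is an isometry on `L²(D₂)`, and `R₀` is an isometry because `h₀` and the functions `ℓ_j` are
orthonormal (`adjoint_opR0_opR0`). The theorem therefore amounts to the equality `U(A²_{(1,n)}(D₂))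
= range R₀`.

The link between the two sides are the Fourier-Laplace integrals `expInt k (ζ) = ∫ k(p, t) exp(i p
ζ₁ + t ζ₁² + i t ζ₂) dp dt` over `t > 0`, which are holomorphic on `D₂`. Along the slices on which
`v` and `ρ` are constant, a product `b(v, ρ) expInt k` is an inverse Fourier transform in `(Re ζ₁,
Re ζ₂)`, so that its image under `U₁ U₀` is explicit, and it is square integrable as soon as this
image is (`sliceFourier_spectral`, `SliceFourier.exists_opU1_opU0_eq`).

*The range of `R₀` lies in `U(A²_{(1,n)}(D₂))`* (`exists_mem_polyBergman_opU_eq`). Both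
differential operators of the definition annihilate holomorphic functions, the first one
annihilates `ρ`, and `∂ρ/∂ζ̄₂ = i/2`. Hence the sums `∑_{i < n} ρ^i expInt k_i` solve the two
equations. In the variables of `𝒟`, the image of such a sum is `h₀(y₁)` times a polynomial of
degree less than `n` in `y₂` times `e^{-y₂/2}`, with coefficients that depend on `(x₁, x₂)` and can
be prescribed by the choice of the densities `k_i`.

*`R` is injective on `A²_{(1,n)}(D₂)`* (`eq_zero_of_opR_eq_zero`). Let `f ∈ A²_{(1,n)}(D₂)` with `R
f = 0`. Then `f` is orthogonal to `ρ^m expInt k` for all `m < n` and all bounded densities `k`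
supported in a compact box (`BoxBounded`). Integration by parts without boundary terms, justified
by cutoff functions (`integral_mul_iterate_dbar2_eq_zero`, `integral_mul_tangentialCR_eq_zero`),
turns the two equations into recursions for the moments of `f`: the equation of order `n` in `ζ̄₂`
yields the moments with `m ≥ n`, the tangential equation those with an additional factor `v^l`. So
`f` is orthogonal to `v^l ρ^m expInt k` for all `l` and `m`. The same equation in `ζ̄₂` shows that
`f` is orthogonal to all `v^l ρ^m conj(expInt k)`, with no assumption on `R f`. On the side of the
Fourier transform, the first family concerns the frequencies `t₂ > 0` and the second one the
frequencies `t₂ < 0`. For fixed frequencies, the weights have Gaussian decay in `v` and exponential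
decay in `ρ`, so that the moment problems in `v` and in `ρ` are determinate
(`ae_eq_zero_of_moments`) and both families are complete (`ae_eq_zero_of_integral_conj_spectral`).
Hence `f = 0` (`eq_zero_of_mem_polyBergman`).

It follows that `U` maps `A²_{(1,n)}(D₂)` onto the range of `R₀`, that the restriction of `R` is
unitary (`bargmann`), and that `A²_{(1,n)}(D₂)` is complete. For the Toeplitz operator, `U₁`
commutes with the multiplication by functions of `(v₁, v₂)`, in which it acts trivially
(`opU1_mul_ae`). Consequently `U` turns the multiplication by `c̃` into the multiplication by an
explicit function on `𝒟` (`opU_mulOp_ae`), and the compression of the latter by `R₀` is an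
integration over `(y₁, y₂)` against `h₀(y₁)² ℓ_j(y₂) ℓ_k(y₂)` (`adjoint_opR0_mul_ae`), which gives
the matrix `γ^c`.
-/

noncomputable section

namespace Siegel

open MeasureTheory Set Filter Topology
open scoped ENNReal TensorProduct

/-! ### Determinacy of the moment problem -/

/-- The determinacy of the moment problem for a real density with exponential decay: the complex
moment generating functions of the positive and of the negative part are analytic on a strip around
the imaginary axis and have the same derivatives at `0`, so that they agree on the imaginary axis.
-/
theorem ae_eq_zero_of_moments_real {μ : Measure ℝ} [SigmaFinite μ] {f : ℝ → ℝ} {δ : ℝ} (hδ : 0 < δ)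
    (hf : AEStronglyMeasurable f μ)
    (hint : Integrable (fun x => Real.exp (δ * |x|) * f x) μ)
    (hmom : ∀ l : ℕ, ∫ x, x ^ l * f x ∂μ = 0) : f =ᵐ[μ] 0 := by
  -- A density `h` with `0 ≤ h ≤ |f|` defines a finite measure whose moment generating function is
  -- finite on `[-δ, δ]`; this is used for the positive and the negative part of `f`.
  have hdens : ∀ h : ℝ → ℝ, AEStronglyMeasurable h μ → (∀ x, |h x| ≤ |f x|) → (∀ x, 0 ≤ h x) →
      ∃ ν : Measure ℝ, ν = μ.withDensity (fun x => ENNReal.ofReal (h x)) ∧ IsFiniteMeasure ν ∧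
        (0 : ℝ) ∈ interior (ProbabilityTheory.integrableExpSet id ν) ∧
        (Ioo (-δ) δ ⊆ interior (ProbabilityTheory.integrableExpSet id ν)) ∧
        ∀ l : ℕ, ∫ x, x ^ l ∂ν = ∫ x, x ^ l * h x ∂μ := by
    intro h hm hle h0
    have hmo : AEMeasurable (fun x => ENNReal.ofReal (h x)) μ := hm.aemeasurable.ennreal_ofReal
    have hI : ∀ t : ℝ, |t| ≤ δ → Integrable (fun x => Real.exp (t * x)  )
        (μ.withDensity (fun x => ENNReal.ofReal (h x))) := by
      intro t ht
      rw [integrable_withDensity_iff_integrable_smul₀' hmo (by simp)]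
      refine hint.mono (by fun_prop) (Eventually.of_forall fun x => ?_)
      rw [ENNReal.toReal_ofReal (h0 x), smul_eq_mul, norm_mul, norm_mul, mul_comm]
      refine mul_le_mul ?_ (hle x) (norm_nonneg _) (norm_nonneg _)
      rw [Real.norm_eq_abs, Real.norm_eq_abs, Real.abs_exp, Real.abs_exp]
      refine Real.exp_le_exp.2 ((le_abs_self _).trans ?_)
      rw [abs_mul]
      gcongr
    have hsub : Ioo (-δ) δ ⊆ interior (ProbabilityTheory.integrableExpSet id
        (μ.withDensity (fun x => ENNReal.ofReal (h x)))) :=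
      interior_maximal (fun t ht => hI t (abs_le.2 ⟨ht.1.le, ht.2.le⟩)) isOpen_Ioo
    refine ⟨_, rfl, ?_, hsub ⟨by linarith, hδ⟩, hsub, fun l => ?_⟩
    · have h1 := hI 0 (by simpa using hδ.le)
      simp only [zero_mul, Real.exp_zero] at h1
      exact (integrable_const_iff.1 h1).resolve_left one_ne_zero
    · rw [integral_withDensity_eq_integral_toReal_smul₀ hmo (by simp)]
      refine integral_congr_ae (Eventually.of_forall fun x => ?_)
      simp only [ENNReal.toReal_ofReal (h0 x), smul_eq_mul, mul_comm]
  have hposm : AEStronglyMeasurable (fun x => max (f x) 0) μ := hf.sup aestronglyMeasurable_const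
  have hnegm : AEStronglyMeasurable (fun x => max (-f x) 0) μ := hf.neg.sup aestronglyMeasurable_const
  obtain ⟨ν₁, e₁, fin₁, z₁, s₁, m₁⟩ := hdens _ hposm
    (fun x => by rw [abs_of_nonneg (le_max_right _ _)]; exact max_le (le_abs_self _) (abs_nonneg _))
    (fun x => le_max_right _ _)
  obtain ⟨ν₂, e₂, fin₂, z₂, s₂, m₂⟩ := hdens _ hnegm
    (fun x => by rw [abs_of_nonneg (le_max_right _ _)]; exact max_le (neg_le_abs _) (abs_nonneg _))
    (fun x => le_max_right _ _)
  set U : Set ℂ := {z | z.re ∈ Ioo (-δ) δ} with hU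
  have a₁ : AnalyticOnNhd ℂ (ProbabilityTheory.complexMGF id ν₁) U := fun z hz =>
    ProbabilityTheory.analyticAt_complexMGF (s₁ hz)
  have a₂ : AnalyticOnNhd ℂ (ProbabilityTheory.complexMGF id ν₂) U := fun z hz =>
    ProbabilityTheory.analyticAt_complexMGF (s₂ hz)
  have h0U : (0 : ℂ) ∈ U := by simp [hU, hδ]
  have hUc : IsPreconnected U :=
    ((convex_Ioo (-δ) δ).linear_preimage Complex.reLm).isPreconnected
  have hpow : ∀ l : ℕ, Integrable (fun x => x ^ l * f x) μ := by
    intro l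
    obtain ⟨C, hC⟩ : ∃ C : ℝ, ∀ x : ℝ, |x| ^ l ≤ C * Real.exp (δ * |x|) := by
      refine ⟨l.factorial / δ ^ l, fun x => ?_⟩
      have := Real.pow_div_factorial_le_exp (δ * |x|) (by positivity) l
      rw [mul_pow] at this
      rw [div_mul_eq_mul_div, le_div_iff₀ (by positivity)]
      rw [div_le_iff₀ (by positivity)] at this
      linarith
    refine (hint.const_mul C).mono (by fun_prop) (Eventually.of_forall fun x => ?_)
    have hC0 : 0 ≤ C * Real.exp (δ * |x|) := (by positivity : 0 ≤ |x| ^ l).trans (hC x)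
    rw [norm_mul, ← mul_assoc, norm_mul, norm_pow, Real.norm_eq_abs, Real.norm_eq_abs,
      Real.norm_of_nonneg hC0]
    exact mul_le_mul_of_nonneg_right (hC x) (abs_nonneg _)
  have hmeq : ∀ l : ℕ, ∫ x, x ^ l ∂ν₁ = ∫ x, x ^ l ∂ν₂ := by
    intro l
    rw [m₁, m₂, ← sub_eq_zero, ← integral_sub]
    · refine (integral_congr_ae (Eventually.of_forall fun x => ?_)).trans (hmom l)
      rw [← mul_sub]
      congr 1
      rcases le_total (f x) 0 with h | h
      · rw [max_eq_right h, max_eq_left (by linarith)]; ring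
      · rw [max_eq_left h, max_eq_right (by linarith)]; ring
    · refine (hpow l).mono (by fun_prop) (Eventually.of_forall fun x => ?_)
      rw [norm_mul, norm_mul, Real.norm_of_nonneg (le_max_right _ _)]
      gcongr
      exact max_le (le_abs_self _) (abs_nonneg _)
    · refine (hpow l).mono (by fun_prop) (Eventually.of_forall fun x => ?_)
      rw [norm_mul, norm_mul, Real.norm_of_nonneg (le_max_right _ _)]
      gcongr
      exact max_le (neg_le_abs _) (abs_nonneg _)
  have hder : ∀ l : ℕ, iteratedDeriv l (ProbabilityTheory.complexMGF id ν₁ -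
      ProbabilityTheory.complexMGF id ν₂) 0 = 0 := by
    intro l
    rw [iteratedDeriv_sub (a₁ 0 h0U).contDiffAt (a₂ 0 h0U).contDiffAt,
      ProbabilityTheory.iteratedDeriv_complexMGF (by simpa using z₁),
      ProbabilityTheory.iteratedDeriv_complexMGF (by simpa using z₂)]
    have e : ∀ ν : Measure ℝ, ∫ x, ((id x : ℝ) : ℂ) ^ l * Complex.exp (0 * (id x : ℝ)) ∂ν
        = ((∫ x, x ^ l ∂ν : ℝ) : ℂ) := by
      intro ν
      rw [← integral_complex_ofReal]
      simp
    rw [e, e, hmeq, sub_self]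
  -- All derivatives at `0` vanish, hence the difference vanishes near `0` and then on the strip.
  have hev : (ProbabilityTheory.complexMGF id ν₁ - ProbabilityTheory.complexMGF id ν₂)
      =ᶠ[𝓝 0] 0 := by
    have ha := (a₁ 0 h0U).sub (a₂ 0 h0U)
    have : analyticOrderAt (ProbabilityTheory.complexMGF id ν₁ -
        ProbabilityTheory.complexMGF id ν₂) 0 = ⊤ := by
      refine ENat.eq_top_iff_forall_ge.2 fun n => ?_
      exact (natCast_le_analyticOrderAt_iff_iteratedDeriv_eq_zero ha).2 fun i _ => hder i
    exact analyticOrderAt_eq_top.1 this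
  have hz := (a₁.sub a₂).eqOn_zero_of_preconnected_of_eventuallyEq_zero hUc h0U hev
  have hν : ν₁ = ν₂ := by
    refine Measure.ext_of_charFun (funext fun t => ?_)
    rw [← ProbabilityTheory.complexMGF_id_mul_I, ← ProbabilityTheory.complexMGF_id_mul_I]
    have := hz (x := (t : ℂ) * Complex.I) (by simp [hU, hδ])
    simpa [sub_eq_zero] using this
  rw [e₁, e₂, withDensity_eq_iff_of_sigmaFinite hposm.aemeasurable.ennreal_ofReal
    hnegm.aemeasurable.ennreal_ofReal] at hν
  filter_upwards [hν] with x hx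
  rw [ENNReal.ofReal_eq_ofReal_iff (le_max_right _ _) (le_max_right _ _)] at hx
  rcases le_total (f x) 0 with h | h
  · rw [max_eq_right h, max_eq_left (by linarith)] at hx; simp; linarith
  · rw [max_eq_left h, max_eq_right (by linarith)] at hx; simpa using hx

/-- The determinacy of the moment problem for a complex density with exponential decay. -/
theorem ae_eq_zero_of_moments {μ : Measure ℝ} [SigmaFinite μ] {f : ℝ → ℂ} {δ : ℝ} (hδ : 0 < δ)
    (hf : AEStronglyMeasurable f μ)
    (hint : Integrable (fun x => (Real.exp (δ * |x|) : ℂ) * f x) μ)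
    (hmom : ∀ l : ℕ, ∫ x, (x : ℂ) ^ l * f x ∂μ = 0) : f =ᵐ[μ] 0 := by
  have hpow : ∀ l : ℕ, Integrable (fun x : ℝ => (x : ℂ) ^ l * f x) μ := by
    intro l
    refine (hint.const_mul ((l.factorial / δ ^ l : ℝ) : ℂ)).mono (by fun_prop)
      (Eventually.of_forall fun x => ?_)
    have := Real.pow_div_factorial_le_exp (δ * |x|) (by positivity) l
    rw [mul_pow] at this
    rw [norm_mul, ← mul_assoc, norm_mul, norm_pow, ← Complex.ofReal_mul, Complex.norm_real,
      Complex.norm_real, Real.norm_eq_abs, Real.norm_of_nonneg (by positivity)]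
    refine mul_le_mul_of_nonneg_right ?_ (norm_nonneg _)
    rw [div_mul_eq_mul_div, le_div_iff₀ (by positivity)]
    rw [div_le_iff₀ (by positivity)] at this
    linarith
  have hre := ae_eq_zero_of_moments_real (f := fun x => (f x).re) hδ
    (Complex.continuous_re.comp_aestronglyMeasurable hf)
    (hint.re.congr (Eventually.of_forall fun x => Complex.re_ofReal_mul _ _)) (fun l => by
      have := congrArg Complex.re (hmom l)
      have e := integral_re (hpow l)
      simp only [RCLike.re_to_complex] at e
      rw [← e] at this
      simpa [← Complex.ofReal_pow] using this)
  have him := ae_eq_zero_of_moments_real (f := fun x => (f x).im) hδ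
    (Complex.continuous_im.comp_aestronglyMeasurable hf)
    (hint.im.congr (Eventually.of_forall fun x => Complex.im_ofReal_mul _ _)) (fun l => by
      have := congrArg Complex.im (hmom l)
      have e := integral_im (hpow l)
      simp only [RCLike.im_to_complex] at e
      rw [← e] at this
      simpa [← Complex.ofReal_pow] using this)
  filter_upwards [hre, him] with x h1 h2
  exact Complex.ext h1 h2

/-! ### Fourier-Laplace integrals on `D₂` -/

/-- The exponential `exp(i p ζ₁ + t ζ₁² + i t ζ₂)`, where `q = (p, t)`. -/
def expKer (q : ℝ × ℝ) (ζ : ℂ × ℂ) : ℂ :=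
  Complex.exp (Complex.I * q.1 * ζ.1 + q.2 * ζ.1 ^ 2 + Complex.I * q.2 * ζ.2)

/-- The holomorphic function `ζ ↦ ∫ k(p,t) exp(i p ζ₁ + t ζ₁² + i t ζ₂) dp dt` on `D₂`, where `t`
runs through `ℝ₊`. -/
def expInt (k : ℝ × ℝ → ℂ) (ζ : ℂ × ℂ) : ℂ := ∫ q, k q * expKer q ζ ∂halfMeasure

/-- The densities `k` for which the integral `expInt k` converges absolutely on `D₂`. -/
def Admissible (k : ℝ × ℝ → ℂ) : Prop :=
  ∀ v σ : ℝ, 2 * v ^ 2 < σ →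
    Integrable (fun q : ℝ × ℝ => (Real.exp (-(q.1 * v) - q.2 * σ) : ℂ) * k q) halfMeasure

/-- The height `Im ζ₂ - Re ζ₁²`; the point `ζ` lies in `D₂` if and only if it is greater than
`2 (Im ζ₁)²`. -/
def expHeight (ζ : ℂ × ℂ) : ℝ := ζ.2.im - (ζ.1 ^ 2).re

theorem mem_D2_iff_expHeight (ζ : ℂ × ℂ) : ζ ∈ D2 ↔ 2 * ζ.1.im ^ 2 < expHeight ζ := by
  have : ‖ζ.1‖ ^ 2 = ζ.1.re ^ 2 + ζ.1.im ^ 2 := norm_mk_sq _ _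
  simp only [D2, mem_ofPred_eq, expHeight, pow_two, Complex.mul_re]
  constructor <;> intro h <;> linarith

theorem norm_expKer (q : ℝ × ℝ) (ζ : ℂ × ℂ) :
    ‖expKer q ζ‖ = Real.exp (-(q.1 * ζ.1.im) - q.2 * expHeight ζ) := by
  rw [expKer, Complex.norm_exp, expHeight]
  congr 1
  simp [pow_two]
  ring

theorem continuous_expKer : Continuous fun x : (ℝ × ℝ) × (ℂ × ℂ) => expKer x.1 x.2 := by
  unfold expKer; fun_prop

theorem Admissible.aestronglyMeasurable {k : ℝ × ℝ → ℂ} (hk : Admissible k) :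
    AEStronglyMeasurable k halfMeasure := by
  have h := (hk 0 1 (by norm_num)).aestronglyMeasurable
  have h2 : AEStronglyMeasurable (fun q : ℝ × ℝ => (Real.exp q.2 : ℂ) *
      ((Real.exp (-(q.1 * 0) - q.2 * 1) : ℂ) * k q)) halfMeasure :=
    (by fun_prop : Continuous fun q : ℝ × ℝ => (Real.exp q.2 : ℂ)).aestronglyMeasurable.mul h
  refine h2.congr (Eventually.of_forall fun q => ?_)
  simp only
  rw [← mul_assoc, ← Complex.ofReal_mul, ← Real.exp_add]
  simp

theorem ae_snd_pos : ∀ᵐ q : ℝ × ℝ ∂halfMeasure, 0 < q.2 :=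
  (Measure.quasiMeasurePreserving_snd (μ := (volume : Measure ℝ)) (ν := volPos)).ae
    (ae_restrict_mem measurableSet_Ioi)

/-- The convergence of the integral at all points near `(v, σ)` yields exponential room. -/
theorem Admissible.exists_exp_room {k : ℝ × ℝ → ℂ} (hk : Admissible k) {v σ : ℝ}
    (h : 2 * v ^ 2 < σ) : ∃ δ > 0, Integrable (fun q : ℝ × ℝ =>
      Real.exp (-(q.1 * v) - q.2 * σ + δ * (|q.1| + |q.2|)) * ‖k q‖) halfMeasure := by
  have hc : ∀ᶠ δ in 𝓝[>] (0 : ℝ), 2 * (v + δ) ^ 2 < σ - δ ∧ 2 * (v - δ) ^ 2 < σ - δ := by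
    refine nhdsWithin_le_nhds ?_
    refine ((Continuous.tendsto' (by fun_prop) 0 (2 * v ^ 2) (by simp)).eventually_lt
      (Continuous.tendsto' (by fun_prop) 0 σ (by simp)) h).and
      ((Continuous.tendsto' (by fun_prop) 0 (2 * v ^ 2) (by simp)).eventually_lt
      (Continuous.tendsto' (by fun_prop) 0 σ (by simp)) h)
  obtain ⟨δ, ⟨h1, h2⟩, hδ⟩ := (hc.and self_mem_nhdsWithin).exists
  refine ⟨δ, hδ, ?_⟩
  have hδ' : 0 < δ := hδ
  have hm := hk.aestronglyMeasurable
  refine ((hk _ _ h1).norm.add (hk _ _ h2).norm).mono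
    (AEStronglyMeasurable.mul (by fun_prop) hm.norm) ?_
  filter_upwards [ae_snd_pos] with q hq
  simp only [Pi.add_apply]
  rw [norm_mul, norm_mul, norm_mul, norm_norm, ← add_mul, norm_mul, norm_norm]
  refine mul_le_mul_of_nonneg_right ?_ (norm_nonneg _)
  rw [Complex.norm_real, Complex.norm_real, Real.norm_of_nonneg (Real.exp_nonneg _),
    Real.norm_of_nonneg (Real.exp_nonneg _), Real.norm_of_nonneg (Real.exp_nonneg _),
    Real.norm_of_nonneg (by positivity), abs_of_pos hq]
  rcases le_total 0 q.1 with hp | hp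
  · rw [abs_of_nonneg hp]
    refine le_add_of_nonneg_of_le (Real.exp_nonneg _) (Real.exp_le_exp.2 (le_of_eq ?_))
    ring
  · rw [abs_of_nonpos hp]
    refine le_add_of_le_of_nonneg (Real.exp_le_exp.2 (le_of_eq ?_)) (Real.exp_nonneg _)
    ring

/-- Multiplication by a function of subexponential growth preserves the convergence. -/
theorem Admissible.mul {k m : ℝ × ℝ → ℂ} (hk : Admissible k)
    (hm : AEStronglyMeasurable m halfMeasure)
    (hb : ∀ δ : ℝ, 0 < δ → ∃ C : ℝ, ∀ q : ℝ × ℝ, ‖m q‖ ≤ C * Real.exp (δ * (|q.1| + |q.2|))) :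
    Admissible fun q => m q * k q := by
  intro v σ h
  obtain ⟨δ, hδ, hi⟩ := hk.exists_exp_room h
  obtain ⟨C, hC⟩ := hb δ hδ
  refine (hi.const_mul C).mono
    (AEStronglyMeasurable.mul (by fun_prop) (hm.mul hk.aestronglyMeasurable))
    (Eventually.of_forall fun q => ?_)
  have hC0 := (norm_nonneg _).trans (hC q)
  rw [norm_mul, norm_mul, Complex.norm_real, Real.norm_of_nonneg (Real.exp_nonneg _), Real.exp_add]
  calc _ ≤ Real.exp (-(q.1 * v) - q.2 * σ) * ((C * Real.exp (δ * (|q.1| + |q.2|))) * ‖k q‖) := by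
        gcongr; exact hC q
    _ = C * (Real.exp (-(q.1 * v) - q.2 * σ) * Real.exp (δ * (|q.1| + |q.2|)) * ‖k q‖) := by ring
    _ ≤ _ := le_abs_self _

/-- Linear growth is subexponential. -/
theorem abs_le_exp_abs_add {δ : ℝ} (hδ : 0 < δ) (a b : ℝ) :
    |a| + |b| ≤ δ⁻¹ * Real.exp (δ * (|a| + |b|)) := by
  rw [le_inv_mul_iff₀ hδ]
  linarith [Real.add_one_le_exp (δ * (|a| + |b|))]

theorem Admissible.mul_fst {k : ℝ × ℝ → ℂ} (hk : Admissible k) :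
    Admissible fun q => (q.1 : ℂ) * k q :=
  hk.mul (by fun_prop) fun δ hδ => ⟨δ⁻¹, fun q => by
    rw [Complex.norm_real, Real.norm_eq_abs]
    exact (le_add_of_nonneg_right (abs_nonneg _)).trans (abs_le_exp_abs_add hδ _ _)⟩

theorem Admissible.mul_snd {k : ℝ × ℝ → ℂ} (hk : Admissible k) :
    Admissible fun q => (q.2 : ℂ) * k q :=
  hk.mul (by fun_prop) fun δ hδ => ⟨δ⁻¹, fun q => by
    rw [Complex.norm_real, Real.norm_eq_abs]
    exact (le_add_of_nonneg_left (abs_nonneg _)).trans (abs_le_exp_abs_add hδ _ _)⟩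

theorem Admissible.const_mul {k : ℝ × ℝ → ℂ} (hk : Admissible k) (c : ℂ) :
    Admissible fun q => c * k q := by
  intro v σ h
  refine ((hk v σ h).const_mul c).congr (Eventually.of_forall fun q => ?_)
  simp only; ring

theorem Admissible.integrable {k : ℝ × ℝ → ℂ} (hk : Admissible k) {ζ : ℂ × ℂ} (hζ : ζ ∈ D2) :
    Integrable (fun q => k q * expKer q ζ) halfMeasure := by
  refine (hk _ _ ((mem_D2_iff_expHeight ζ).1 hζ)).mono (hk.aestronglyMeasurable.mul
    (continuous_expKer.comp (by fun_prop : Continuous fun q : ℝ × ℝ => (q, ζ))).aestronglyMeasurable)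
    (Eventually.of_forall fun q => ?_)
  rw [norm_mul, norm_mul, norm_expKer, Complex.norm_real, Real.norm_of_nonneg (Real.exp_nonneg _),
    mul_comm]

theorem hasFDerivAt_expKer (q : ℝ × ℝ) (ζ : ℂ × ℂ) :
    HasFDerivAt (expKer q) (expKer q ζ •
      ((Complex.I * q.1 + 2 * q.2 * ζ.1) • ContinuousLinearMap.fst ℂ ℂ ℂ +
        (Complex.I * q.2) • ContinuousLinearMap.snd ℂ ℂ ℂ)) ζ := by
  have h1 : HasFDerivAt (fun ζ : ℂ × ℂ => ζ.1) (ContinuousLinearMap.fst ℂ ℂ ℂ) ζ := hasFDerivAt_fst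
  have h2 : HasFDerivAt (fun ζ : ℂ × ℂ => ζ.2) (ContinuousLinearMap.snd ℂ ℂ ℂ) ζ := hasFDerivAt_snd
  have := (((h1.const_mul (Complex.I * q.1)).add ((h1.pow 2).const_mul (q.2 : ℂ))).add
    (h2.const_mul (Complex.I * q.2))).cexp
  refine this.congr_fderiv ?_
  ext
  · simp [expKer]; ring
  · simp [expKer]

/-- Differentiation under the integral sign: `expInt k` is holomorphic on `D₂`, with
`∂/∂ζ₁ = i p + 2 t ζ₁` and `∂/∂ζ₂ = i t` on the side of the densities. -/
theorem hasFDerivAt_expInt {k : ℝ × ℝ → ℂ} (hk : Admissible k) {ζ : ℂ × ℂ} (hζ : ζ ∈ D2) :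
    HasFDerivAt (expInt k)
      ((Complex.I * expInt (fun q => (q.1 : ℂ) * k q) ζ +
          2 * ζ.1 * expInt (fun q => (q.2 : ℂ) * k q) ζ) • ContinuousLinearMap.fst ℂ ℂ ℂ +
        (Complex.I * expInt (fun q => (q.2 : ℂ) * k q) ζ) • ContinuousLinearMap.snd ℂ ℂ ℂ) ζ := by
  obtain ⟨δ, hδ, hroom⟩ := hk.exists_exp_room ((mem_D2_iff_expHeight ζ).1 hζ)
  -- On the neighbourhood `s` of `ζ` the exponent changes by at most `δ/2 · (|p| + |t|)`; the other
  -- half of the room `δ` absorbs the factors `p` and `t` of the derivative.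
  set M : ℝ := ‖ζ.1‖ + 1
  set s : Set (ℂ × ℂ) := {ξ | |ξ.1.im - ζ.1.im| < δ / 2 ∧ |expHeight ξ - expHeight ζ| < δ / 2 ∧
    ‖ξ.1‖ < M}
  have hcH : Continuous expHeight := by unfold expHeight; fun_prop
  have hs : s ∈ 𝓝 ζ := by
    have ho : IsOpen s := by
      refine IsOpen.and ?_ (IsOpen.and ?_ ?_) <;> exact isOpen_lt (by fun_prop) continuous_const
    exact ho.mem_nhds ⟨by simp; linarith, by simp; linarith, by simp [M]⟩
  have hker : ∀ ξ, Continuous fun q : ℝ × ℝ => expKer q ξ := fun ξ =>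
    continuous_expKer.comp (by fun_prop : Continuous fun q : ℝ × ℝ => (q, ξ))
  have key := hasFDerivAt_integral_of_dominated_of_fderiv_le (𝕜 := ℂ) (μ := halfMeasure)
    (F := fun ξ q => k q * expKer q ξ)
    (F' := fun ξ q => k q • (expKer q ξ •
      ((Complex.I * q.1 + 2 * q.2 * ξ.1) • ContinuousLinearMap.fst ℂ ℂ ℂ +
        (Complex.I * q.2) • ContinuousLinearMap.snd ℂ ℂ ℂ)))
    (x₀ := ζ) (s := s)
    (bound := fun q => (((1 + 2 * M + 1) * (δ / 2)⁻¹) *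
      (Real.exp (-(q.1 * ζ.1.im) - q.2 * expHeight ζ + δ * (|q.1| + |q.2|)) * ‖k q‖))) hs
    (Eventually.of_forall fun ξ => hk.aestronglyMeasurable.mul (hker ξ).aestronglyMeasurable)
    (hk.integrable hζ)
    (hk.aestronglyMeasurable.smul (Continuous.aestronglyMeasurable (by
      have := hker ζ
      fun_prop)))
    ?_ (hroom.const_mul _) ?_
  · refine key.congr_fderiv ?_
    have e : ∀ q : ℝ × ℝ, k q • (expKer q ζ •
      ((Complex.I * q.1 + 2 * q.2 * ζ.1) • ContinuousLinearMap.fst ℂ ℂ ℂ +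
        (Complex.I * q.2) • ContinuousLinearMap.snd ℂ ℂ ℂ)) =
        (Complex.I * ((q.1 * k q) * expKer q ζ) + 2 * ζ.1 * ((q.2 * k q) * expKer q ζ)) •
          ContinuousLinearMap.fst ℂ ℂ ℂ +
        (Complex.I * ((q.2 * k q) * expKer q ζ)) • ContinuousLinearMap.snd ℂ ℂ ℂ := by
      intro q
      ext <;> simp <;> ring
    have i1 := hk.mul_fst.integrable hζ
    have i2 := hk.mul_snd.integrable hζ
    simp only [e]
    rw [integral_add, integral_smul_const, integral_smul_const, integral_add, integral_const_mul,
      integral_const_mul, integral_const_mul]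
    · rfl
    · exact i1.const_mul _
    · exact i2.const_mul _
    · exact ((i1.const_mul _).add (i2.const_mul _)).smul_const _
    · exact (i2.const_mul _).smul_const _
  · refine Eventually.of_forall fun q ξ hξ => ?_
    obtain ⟨hξ1, hξ2, hξ3⟩ := hξ
    rw [norm_smul, norm_smul, norm_expKer]
    have hn : ‖(Complex.I * q.1 + 2 * q.2 * ξ.1) • ContinuousLinearMap.fst ℂ ℂ ℂ +
        (Complex.I * q.2) • ContinuousLinearMap.snd ℂ ℂ ℂ‖ ≤ (1 + 2 * M + 1) * (|q.1| + |q.2|) := by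
      have hM : 0 ≤ M := by positivity
      calc _ ≤ ‖Complex.I * q.1 + 2 * q.2 * ξ.1‖ * 1 + ‖Complex.I * q.2‖ * 1 := by
            refine (norm_add_le _ _).trans ?_
            rw [norm_smul, norm_smul]
            gcongr
            · exact ContinuousLinearMap.norm_fst_le ..
            · exact ContinuousLinearMap.norm_snd_le ..
        _ ≤ (|q.1| + 2 * |q.2| * M) * 1 + |q.2| * 1 := by
            gcongr
            · refine (norm_add_le _ _).trans ?_
              simp only [norm_mul, Complex.norm_I, one_mul, Complex.norm_real, Real.norm_eq_abs,
                Complex.norm_ofNat]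
              gcongr
            · simp
        _ ≤ _ := by nlinarith [abs_nonneg q.1, abs_nonneg q.2, mul_nonneg hM (abs_nonneg q.1)]
    have hexp : Real.exp (-(q.1 * ξ.1.im) - q.2 * expHeight ξ) ≤
        Real.exp (-(q.1 * ζ.1.im) - q.2 * expHeight ζ + δ / 2 * (|q.1| + |q.2|)) := by
      refine Real.exp_le_exp.2 ?_
      have a1 : -(q.1 * (ξ.1.im - ζ.1.im)) ≤ |q.1| * (δ / 2) := by
        refine (neg_le_abs _).trans ?_
        rw [abs_mul]; gcongr
      have a2 : -(q.2 * (expHeight ξ - expHeight ζ)) ≤ |q.2| * (δ / 2) := by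
        refine (neg_le_abs _).trans ?_
        rw [abs_mul]; gcongr
      linarith
    have hlin := abs_le_exp_abs_add (half_pos hδ) q.1 q.2
    have hM : 0 ≤ M := by positivity
    calc _ ≤ ‖k q‖ * (Real.exp (-(q.1 * ζ.1.im) - q.2 * expHeight ζ + δ / 2 * (|q.1| + |q.2|)) *
          ((1 + 2 * M + 1) * ((δ / 2)⁻¹ * Real.exp (δ / 2 * (|q.1| + |q.2|))))) := by
          gcongr
          exact hn.trans (by gcongr)
      _ = ((1 + 2 * M + 1) * (δ / 2)⁻¹) * (Real.exp (-(q.1 * ζ.1.im) - q.2 * expHeight ζ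
          + δ / 2 * (|q.1| + |q.2|)) * Real.exp (δ / 2 * (|q.1| + |q.2|)) * ‖k q‖) := by ring
      _ = _ := by rw [← Real.exp_add]; ring_nf
  · refine Eventually.of_forall fun q ξ _ => ?_
    exact (hasFDerivAt_expKer q ξ).const_mul (k q)

theorem contDiffOn_expInt_nat (n : ℕ) : ∀ k : ℝ × ℝ → ℂ, Admissible k →
    ContDiffOn ℂ n (expInt k) D2 := by
  induction n with
  | zero =>
    intro k hk
    exact contDiffOn_zero.2 fun ζ hζ => (hasFDerivAt_expInt hk hζ).continuousAt.continuousWithinAt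
  | succ n ih =>
    intro k hk
    rw [show ((n + 1 : ℕ) : WithTop ℕ∞) = n + 1 by norm_cast, contDiffOn_succ_iff_fderiv_of_isOpen isOpen_D2]
    refine ⟨fun ζ hζ => (hasFDerivAt_expInt hk hζ).differentiableAt.differentiableWithinAt,
      by simp, ?_⟩
    refine ContDiffOn.congr ?_ fun ζ hζ => (hasFDerivAt_expInt hk hζ).fderiv
    have c1 := ih _ hk.mul_fst
    have c2 := ih _ hk.mul_snd
    have c3 : ContDiffOn ℂ n (fun ζ : ℂ × ℂ => ζ.1) D2 := contDiff_fst.contDiffOn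
    exact ContDiffOn.add
      (((contDiffOn_const.mul c1).add ((contDiffOn_const.mul c3).mul c2)).smul contDiffOn_const)
      ((contDiffOn_const.mul c2).smul contDiffOn_const)

theorem contDiffOn_expInt {k : ℝ × ℝ → ℂ} (hk : Admissible k) :
    ContDiffOn ℝ (⊤ : ℕ∞) (expInt k) D2 :=
  (contDiffOn_infty.2 fun n => contDiffOn_expInt_nat n k hk).restrict_scalars ℝ

/-! ### The operators `∂/∂ζ̄₂` and `∂/∂ζ̄₁ - 2i ζ₁ ∂/∂ζ̄₂` as derivations -/

/-- Linear operators on functions on `D₂` which satisfy the product rule and the chain rule for real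
functions of one variable, and which annihilate holomorphic functions. -/
structure IsDbarOp (P : (ℂ × ℂ → ℂ) → ℂ × ℂ → ℂ) : Prop extends IsLinearOp P where
  mul : ∀ F G ζ, DifferentiableAt ℝ F ζ → DifferentiableAt ℝ G ζ →
    P (fun ζ => F ζ * G ζ) ζ = P F ζ * G ζ + F ζ * P G ζ
  comp : ∀ (φ : ℝ → ℝ) (r : ℂ × ℂ → ℝ) ζ, DifferentiableAt ℝ φ (r ζ) → DifferentiableAt ℝ r ζ →
    P (fun ζ => (φ (r ζ) : ℂ)) ζ = ((deriv φ (r ζ) : ℝ) : ℂ) * P (fun ζ => (r ζ : ℂ)) ζ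
  zero_of_holo : ∀ F ζ, DifferentiableAt ℂ F ζ → P F ζ = 0

theorem fderiv_mul_apply_complex {F G : ℂ × ℂ → ℂ} {ζ : ℂ × ℂ} (hF : DifferentiableAt ℝ F ζ)
    (hG : DifferentiableAt ℝ G ζ) (v : ℂ × ℂ) : fderiv ℝ (fun ζ => F ζ * G ζ) ζ v =
      fderiv ℝ F ζ v * G ζ + F ζ * fderiv ℝ G ζ v := by
  rw [fderiv_fun_mul hF hG]
  simp; ring

theorem fderiv_ofReal_comp_apply {φ : ℝ → ℝ} {r : ℂ × ℂ → ℝ} {ζ : ℂ × ℂ}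
    (hφ : DifferentiableAt ℝ φ (r ζ)) (hr : DifferentiableAt ℝ r ζ) (v : ℂ × ℂ) :
    fderiv ℝ (fun ζ => (φ (r ζ) : ℂ)) ζ v =
      ((deriv φ (r ζ) : ℝ) : ℂ) * fderiv ℝ (fun ζ => (r ζ : ℂ)) ζ v := by
  have h1 : HasFDerivAt (fun ζ => (r ζ : ℂ)) (Complex.ofRealCLM.comp (fderiv ℝ r ζ)) ζ :=
    Complex.ofRealCLM.hasFDerivAt.comp ζ hr.hasFDerivAt
  have h2 : HasFDerivAt (fun ζ => (φ (r ζ) : ℂ))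
      (Complex.ofRealCLM.comp (deriv φ (r ζ) • fderiv ℝ r ζ)) ζ :=
    Complex.ofRealCLM.hasFDerivAt.comp ζ (hφ.hasDerivAt.comp_hasFDerivAt ζ hr.hasFDerivAt)
  rw [h1.fderiv, h2.fderiv]
  simp

theorem isDbarOp_dbar2 : IsDbarOp dbar2 where
  toIsLinearOp := isLinearOp_dbar2
  mul F G ζ hF hG := by simp only [dbar2, fderiv_mul_apply_complex hF hG]; ring
  comp φ r ζ hφ hr := by simp only [dbar2, fderiv_ofReal_comp_apply hφ hr]; ring
  zero_of_holo F ζ hF := by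
    have e : ((0 : ℂ), Complex.I) = Complex.I • ((0 : ℂ), (1 : ℂ)) := by simp
    simp only [dbar2, hF.fderiv_restrictScalars ℝ, ContinuousLinearMap.coe_restrictScalars']
    rw [e, map_smul, smul_eq_mul, ← mul_assoc, Complex.I_mul_I]; ring

theorem dbar1_eq_zero_of_holo {F : ℂ × ℂ → ℂ} {ζ : ℂ × ℂ} (hF : DifferentiableAt ℂ F ζ) :
    dbar1 F ζ = 0 := by
  have e : (Complex.I, (0 : ℂ)) = Complex.I • ((1 : ℂ), (0 : ℂ)) := by simp
  simp only [dbar1, hF.fderiv_restrictScalars ℝ, ContinuousLinearMap.coe_restrictScalars']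
  rw [e, map_smul, smul_eq_mul, ← mul_assoc, Complex.I_mul_I]; ring

theorem isDbarOp_tangentialCR : IsDbarOp tangentialCR where
  toIsLinearOp := isLinearOp_tangentialCR
  mul F G ζ hF hG := by
    simp only [tangentialCR, dbar1, dbar2, fderiv_mul_apply_complex hF hG]; ring
  comp φ r ζ hφ hr := by
    simp only [tangentialCR, dbar1, dbar2, fderiv_ofReal_comp_apply hφ hr]; ring
  zero_of_holo F ζ hF := by
    simp only [tangentialCR, dbar1_eq_zero_of_holo hF, isDbarOp_dbar2.zero_of_holo F ζ hF]; simp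

theorem hasFDerivAt_conj {F : ℂ × ℂ → ℂ} {ζ : ℂ × ℂ} {a b : ℂ}
    (hF : HasFDerivAt F (a • ContinuousLinearMap.fst ℂ ℂ ℂ + b • ContinuousLinearMap.snd ℂ ℂ ℂ) ζ) :
    HasFDerivAt (fun ζ => (starRingEnd ℂ) (F ζ)) ((Complex.conjCLE : ℂ →L[ℝ] ℂ).comp
      ((a • ContinuousLinearMap.fst ℂ ℂ ℂ +
        b • ContinuousLinearMap.snd ℂ ℂ ℂ).restrictScalars ℝ)) ζ :=
  (Complex.conjCLE : ℂ →L[ℝ] ℂ).hasFDerivAt.comp ζ (hF.restrictScalars ℝ)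

/-- For a holomorphic `F` with `∂F/∂ζ₁ = a`, the derivative `∂/∂ζ̄₁` of the conjugate is the
conjugate of `a`. -/
theorem dbar1_conj {F : ℂ × ℂ → ℂ} {ζ : ℂ × ℂ} {a b : ℂ}
    (hF : HasFDerivAt F (a • ContinuousLinearMap.fst ℂ ℂ ℂ + b • ContinuousLinearMap.snd ℂ ℂ ℂ) ζ) :
    dbar1 (fun ζ => (starRingEnd ℂ) (F ζ)) ζ = (starRingEnd ℂ) a := by
  rw [dbar1, (hasFDerivAt_conj hF).fderiv]
  simp
  linear_combination (-(1 / 2) * (starRingEnd ℂ) a) * Complex.I_mul_I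

theorem dbar2_conj {F : ℂ × ℂ → ℂ} {ζ : ℂ × ℂ} {a b : ℂ}
    (hF : HasFDerivAt F (a • ContinuousLinearMap.fst ℂ ℂ ℂ + b • ContinuousLinearMap.snd ℂ ℂ ℂ) ζ) :
    dbar2 (fun ζ => (starRingEnd ℂ) (F ζ)) ζ = (starRingEnd ℂ) b := by
  rw [dbar2, (hasFDerivAt_conj hF).fderiv]
  simp
  linear_combination (-(1 / 2) * (starRingEnd ℂ) b) * Complex.I_mul_I

/-- The defining function `ρ(ζ) = Im ζ₂ - |ζ₁|²` of `D₂`. -/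
def rho (ζ : ℂ × ℂ) : ℝ := ζ.2.im - ‖ζ.1‖ ^ 2

theorem rho_eq (ζ : ℂ × ℂ) : rho ζ = ζ.2.im - (ζ.1.re * ζ.1.re + ζ.1.im * ζ.1.im) := by
  rw [rho, Complex.sq_norm, Complex.normSq_apply]

theorem contDiff_re_complex {n : WithTop ℕ∞} : ContDiff ℝ n Complex.re := Complex.reCLM.contDiff

theorem contDiff_im_complex {n : WithTop ℕ∞} : ContDiff ℝ n Complex.im := Complex.imCLM.contDiff

theorem contDiff_ofReal_complex {n : WithTop ℕ∞} : ContDiff ℝ n (fun x : ℝ => (x : ℂ)) :=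
  Complex.ofRealCLM.contDiff

theorem contDiff_rho {n : WithTop ℕ∞} : ContDiff ℝ n rho := by
  rw [funext rho_eq]
  have h1 : ContDiff ℝ n fun ζ : ℂ × ℂ => ζ.1.re := contDiff_re_complex.comp contDiff_fst
  have h2 : ContDiff ℝ n fun ζ : ℂ × ℂ => ζ.1.im := contDiff_im_complex.comp contDiff_fst
  have h3 : ContDiff ℝ n fun ζ : ℂ × ℂ => ζ.2.im := contDiff_im_complex.comp contDiff_snd
  exact h3.sub ((h1.mul h1).add (h2.mul h2))

theorem continuous_rho : Continuous rho := contDiff_rho (n := 0).continuous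

theorem fderiv_clm_apply (A : ℂ × ℂ →L[ℝ] ℂ) (ζ v : ℂ × ℂ) : fderiv ℝ (fun ξ => A ξ) ζ v = A v := by
  rw [A.hasFDerivAt.fderiv]

theorem fderiv_im_fst (ζ v : ℂ × ℂ) : fderiv ℝ (fun ξ : ℂ × ℂ => (ξ.1.im : ℂ)) ζ v = (v.1.im : ℂ) :=
  fderiv_clm_apply (Complex.ofRealCLM.comp (Complex.imCLM.comp (ContinuousLinearMap.fst ℝ ℂ ℂ))) ζ v

theorem fderiv_re_fst (ζ v : ℂ × ℂ) : fderiv ℝ (fun ξ : ℂ × ℂ => (ξ.1.re : ℂ)) ζ v = (v.1.re : ℂ) :=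
  fderiv_clm_apply (Complex.ofRealCLM.comp (Complex.reCLM.comp (ContinuousLinearMap.fst ℝ ℂ ℂ))) ζ v

theorem fderiv_im_snd (ζ v : ℂ × ℂ) : fderiv ℝ (fun ξ : ℂ × ℂ => (ξ.2.im : ℂ)) ζ v = (v.2.im : ℂ) :=
  fderiv_clm_apply (Complex.ofRealCLM.comp (Complex.imCLM.comp (ContinuousLinearMap.snd ℝ ℂ ℂ))) ζ v

theorem fderiv_re_snd (ζ v : ℂ × ℂ) : fderiv ℝ (fun ξ : ℂ × ℂ => (ξ.2.re : ℂ)) ζ v = (v.2.re : ℂ) :=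
  fderiv_clm_apply (Complex.ofRealCLM.comp (Complex.reCLM.comp (ContinuousLinearMap.snd ℝ ℂ ℂ))) ζ v

theorem contDiff_ofReal_im_fst {n : WithTop ℕ∞} :
    ContDiff ℝ n fun ξ : ℂ × ℂ => (ξ.1.im : ℂ) :=
  (Complex.ofRealCLM.comp (Complex.imCLM.comp (ContinuousLinearMap.fst ℝ ℂ ℂ))).contDiff

theorem contDiff_ofReal_re_fst {n : WithTop ℕ∞} :
    ContDiff ℝ n fun ξ : ℂ × ℂ => (ξ.1.re : ℂ) :=
  (Complex.ofRealCLM.comp (Complex.reCLM.comp (ContinuousLinearMap.fst ℝ ℂ ℂ))).contDiff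

theorem contDiff_ofReal_im_snd {n : WithTop ℕ∞} :
    ContDiff ℝ n fun ξ : ℂ × ℂ => (ξ.2.im : ℂ) :=
  (Complex.ofRealCLM.comp (Complex.imCLM.comp (ContinuousLinearMap.snd ℝ ℂ ℂ))).contDiff

theorem contDiff_ofReal_rho {n : WithTop ℕ∞} : ContDiff ℝ n fun ξ : ℂ × ℂ => (rho ξ : ℂ) :=
  contDiff_ofReal_complex.comp contDiff_rho

theorem fderiv_normSq_fst (ζ v : ℂ × ℂ) :
    fderiv ℝ (fun ξ : ℂ × ℂ => ((‖ξ.1‖ ^ 2 : ℝ) : ℂ)) ζ v =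
      2 * (ζ.1.re * v.1.re + ζ.1.im * v.1.im) := by
  have e : (fun ξ : ℂ × ℂ => ((‖ξ.1‖ ^ 2 : ℝ) : ℂ)) = fun ξ =>
      (ξ.1.re : ℂ) * ξ.1.re + (ξ.1.im : ℂ) * ξ.1.im := by
    funext ξ
    rw [Complex.sq_norm, Complex.normSq_apply]; push_cast; ring
  have h1 : DifferentiableAt ℝ (fun ξ : ℂ × ℂ => (ξ.1.re : ℂ)) ζ :=
    (contDiff_ofReal_re_fst (n := 1)).differentiable (by simp) ζ
  have h2 : DifferentiableAt ℝ (fun ξ : ℂ × ℂ => (ξ.1.im : ℂ)) ζ :=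
    (contDiff_ofReal_im_fst (n := 1)).differentiable (by simp) ζ
  rw [e, fderiv_fun_add (h1.fun_mul h1) (h2.fun_mul h2), add_apply,
    fderiv_mul_apply_complex h1 h1, fderiv_mul_apply_complex h2 h2, fderiv_re_fst, fderiv_im_fst]
  ring

theorem contDiff_normSq_fst {n : WithTop ℕ∞} : ContDiff ℝ n fun ξ : ℂ × ℂ => ‖ξ.1‖ ^ 2 :=
  (contDiff_norm_sq ℝ).comp contDiff_fst

theorem fderiv_rho (ζ v : ℂ × ℂ) : fderiv ℝ (fun ξ : ℂ × ℂ => (rho ξ : ℂ)) ζ v =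
    v.2.im - 2 * (ζ.1.re * v.1.re + ζ.1.im * v.1.im) := by
  have e : (fun ξ : ℂ × ℂ => (rho ξ : ℂ)) = fun ξ => (ξ.2.im : ℂ) - ((‖ξ.1‖ ^ 2 : ℝ) : ℂ) := by
    funext ξ; simp [rho]
  have hd : DifferentiableAt ℝ (fun ξ : ℂ × ℂ => ((‖ξ.1‖ ^ 2 : ℝ) : ℂ)) ζ :=
    (contDiff_ofReal_complex.comp (contDiff_normSq_fst (n := 1))).differentiable (by simp) ζ
  rw [e, fderiv_fun_sub ((contDiff_ofReal_im_snd (n := 1)).differentiable (by simp) ζ) hd,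
    sub_apply, fderiv_normSq_fst, fderiv_im_snd]

theorem dbar2_rho (ζ : ℂ × ℂ) : dbar2 (fun ξ => (rho ξ : ℂ)) ζ = Complex.I / 2 := by
  simp only [dbar2, fderiv_rho]
  simp; ring

/-- The tangential operator annihilates the defining function. -/
theorem tangentialCR_rho (ζ : ℂ × ℂ) : tangentialCR (fun ξ => (rho ξ : ℂ)) ζ = 0 := by
  rw [tangentialCR, dbar2_rho, dbar1]
  simp only [fderiv_rho]
  have := Complex.re_add_im ζ.1
  simp
  linear_combination -ζ.1 * Complex.I_mul_I - this

theorem dbar2_im_fst (ζ : ℂ × ℂ) : dbar2 (fun ξ => (ξ.1.im : ℂ)) ζ = 0 := by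
  simp [dbar2, fderiv_im_fst]

theorem tangentialCR_im_fst (ζ : ℂ × ℂ) :
    tangentialCR (fun ξ => (ξ.1.im : ℂ)) ζ = Complex.I / 2 := by
  rw [tangentialCR, dbar2_im_fst, dbar1]
  simp [fderiv_im_fst]; ring

theorem dbar2_re_snd (ζ : ℂ × ℂ) : dbar2 (fun ξ => (ξ.2.re : ℂ)) ζ = 1 / 2 := by
  simp [dbar2, fderiv_re_snd]

theorem tangentialCR_re_snd (ζ : ℂ × ℂ) :
    tangentialCR (fun ξ => (ξ.2.re : ℂ)) ζ = -(Complex.I * ζ.1) := by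
  rw [tangentialCR, dbar2_re_snd, dbar1]
  simp [fderiv_re_snd]; ring

theorem dbar2_normSq_fst (ζ : ℂ × ℂ) : dbar2 (fun ξ => ((‖ξ.1‖ ^ 2 : ℝ) : ℂ)) ζ = 0 := by
  simp only [dbar2, fderiv_normSq_fst]; simp

theorem tangentialCR_normSq_fst (ζ : ℂ × ℂ) :
    tangentialCR (fun ξ => ((‖ξ.1‖ ^ 2 : ℝ) : ℂ)) ζ = ζ.1 := by
  rw [tangentialCR, dbar2_normSq_fst, dbar1]
  simp only [fderiv_normSq_fst]
  have := Complex.re_add_im ζ.1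
  simp
  linear_combination this

theorem IsLinearOp.congr {P : (ℂ × ℂ → ℂ) → ℂ × ℂ → ℂ} (hP : IsLinearOp P) {F G : ℂ × ℂ → ℂ}
    (hG : ContDiffOn ℝ (⊤ : ℕ∞) G D2) (h : EqOn F G D2) : EqOn (P F) (P G) D2 := by
  intro ζ hζ
  simpa using hP.lin G G F 0 hG hG (fun ξ hξ => by simp [h hξ]) hζ

theorem IsLinearOp.map_zero {P : (ℂ × ℂ → ℂ) → ℂ × ℂ → ℂ} (hP : IsLinearOp P) :
    EqOn (P fun _ => 0) (fun _ => 0) D2 := by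
  intro ζ hζ
  simpa using hP.lin (fun _ => 0) (fun _ => 0) (fun _ => 0) (-1) contDiffOn_const contDiffOn_const
    (fun _ _ => by simp) hζ

theorem IsLinearOp.map_const_mul {P : (ℂ × ℂ → ℂ) → ℂ × ℂ → ℂ} (hP : IsLinearOp P)
    {F : ℂ × ℂ → ℂ} (hF : ContDiffOn ℝ (⊤ : ℕ∞) F D2) (c : ℂ) :
    EqOn (P fun ζ => c * F ζ) (fun ζ => c * P F ζ) D2 := by
  intro ζ hζ
  simpa [hP.map_zero hζ] using hP.lin (fun _ => 0) F (fun ζ => c * F ζ) c contDiffOn_const hF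
    (fun _ _ => by simp) hζ

theorem IsLinearOp.map_sum {P : (ℂ × ℂ → ℂ) → ℂ × ℂ → ℂ} (hP : IsLinearOp P) {ι : Type*}
    (s : Finset ι) (F : ι → ℂ × ℂ → ℂ) (hF : ∀ i ∈ s, ContDiffOn ℝ (⊤ : ℕ∞) (F i) D2) :
    EqOn (P fun ζ => ∑ i ∈ s, F i ζ) (fun ζ => ∑ i ∈ s, P (F i) ζ) D2 := by
  induction s using Finset.cons_induction with
  | empty => simpa using hP.map_zero
  | cons a s ha ih =>
    intro ζ hζ
    have h1 := hP.lin (F a) (fun ζ => ∑ i ∈ s, F i ζ) (fun ζ => ∑ i ∈ Finset.cons a s ha, F i ζ) 1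
      (hF a (Finset.mem_cons_self a s))
      (ContDiffOn.sum fun i hi => hF i (Finset.mem_cons_of_mem hi))
      (fun _ _ => by simp [Finset.sum_cons]) hζ
    refine h1.trans ?_
    simp only
    rw [ih (fun i hi => hF i (Finset.mem_cons_of_mem hi)) hζ]
    simp [Finset.sum_cons]

theorem ContDiffOn.differentiableAt_D2 {F : ℂ × ℂ → ℂ} (hF : ContDiffOn ℝ (⊤ : ℕ∞) F D2)
    {ζ : ℂ × ℂ} (hζ : ζ ∈ D2) : DifferentiableAt ℝ F ζ :=
  (hF.contDiffAt (isOpen_D2.mem_nhds hζ)).differentiableAt (by simp)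

/-- The Leibniz rule for the iterates of a derivation. -/
theorem IsDbarOp.iterate_mul {P : (ℂ × ℂ → ℂ) → ℂ × ℂ → ℂ} (hP : IsDbarOp P) {F G : ℂ × ℂ → ℂ}
    (hF : ContDiffOn ℝ (⊤ : ℕ∞) F D2) (hG : ContDiffOn ℝ (⊤ : ℕ∞) G D2) (n : ℕ) :
    EqOn (P^[n] fun ζ => F ζ * G ζ)
      (fun ζ => ∑ ij ∈ Finset.HasAntidiagonal.antidiagonal n, n.choose ij.1 • (P^[ij.1] F ζ * P^[ij.2] G ζ)) D2 := by
  have sF := fun i => (hP.toIsLinearOp.iterate i).smooth F hF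
  have sG := fun i => (hP.toIsLinearOp.iterate i).smooth G hG
  induction n with
  | zero => intro ζ _; simp
  | succ n ih =>
    intro ζ hζ
    have hs : ∀ ij : ℕ × ℕ, ContDiffOn ℝ (⊤ : ℕ∞) (fun ζ => P^[ij.1] F ζ * P^[ij.2] G ζ) D2 :=
      fun ij => (sF _).mul (sG _)
    simp only [nsmul_eq_mul] at ih ⊢
    rw [Function.iterate_succ_apply', hP.toIsLinearOp.congr (ContDiffOn.sum fun ij _ =>
      contDiffOn_const.mul (hs ij)) ih hζ, hP.toIsLinearOp.map_sum _ _ (fun ij _ =>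
      contDiffOn_const.mul (hs ij)) hζ]
    have h := Finset.sum_antidiagonal_choose_succ_nsmul
      (fun i j => P^[i] F ζ * P^[j] G ζ) n
    simp only [nsmul_eq_mul] at h
    rw [h, ← Finset.sum_add_distrib]
    refine Finset.sum_congr rfl fun ij hij => ?_
    rw [hP.toIsLinearOp.map_const_mul (hs ij) _ hζ]
    beta_reduce
    rw [hP.mul _ _ _ (ContDiffOn.differentiableAt_D2 (sF _) hζ)
        (ContDiffOn.differentiableAt_D2 (sG _) hζ), Function.iterate_succ_apply',
        Function.iterate_succ_apply', Nat.choose_symm_of_eq_add (Finset.HasAntidiagonal.mem_antidiagonal.1 hij).symm]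
    ring

/-- The iterates of a derivation on `φ ∘ r`, where the derivative of `r` is a constant `c`. -/
theorem IsDbarOp.iterate_comp {P : (ℂ × ℂ → ℂ) → ℂ × ℂ → ℂ} (hP : IsDbarOp P) {φ : ℝ → ℝ}
    {r : ℂ × ℂ → ℝ} {c : ℂ} (hφ : ContDiff ℝ (⊤ : ℕ∞) φ) (hr : ContDiff ℝ (⊤ : ℕ∞) r)
    (hc : ∀ ζ ∈ D2, P (fun ζ => (r ζ : ℂ)) ζ = c) (n : ℕ) :
    EqOn (P^[n] fun ζ => (φ (r ζ) : ℂ)) (fun ζ => c ^ n * ((iteratedDeriv n φ (r ζ) : ℝ) : ℂ)) D2 := by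
  induction n with
  | zero => intro ζ _; simp
  | succ n ih =>
    intro ζ hζ
    have hd : ContDiff ℝ (⊤ : ℕ∞) (iteratedDeriv n φ) := by
      rw [iteratedDeriv_eq_iterate]; exact hφ.iterate_deriv n
    have hsm : ContDiffOn ℝ (⊤ : ℕ∞) (fun ζ => ((iteratedDeriv n φ (r ζ) : ℝ) : ℂ)) D2 :=
      (contDiff_ofReal_complex.comp (hd.comp hr)).contDiffOn
    rw [Function.iterate_succ_apply', hP.toIsLinearOp.congr (contDiffOn_const.mul hsm) ih hζ,
      hP.toIsLinearOp.map_const_mul hsm _ hζ]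
    beta_reduce
    rw [hP.comp _ _ _ (hd.differentiable (by simp) _) (hr.differentiable (by simp) _), hc ζ hζ, iteratedDeriv_succ]
    ring

theorem contDiffOn_conj {F : ℂ × ℂ → ℂ} (hF : ContDiffOn ℝ (⊤ : ℕ∞) F D2) :
    ContDiffOn ℝ (⊤ : ℕ∞) (fun ζ => (starRingEnd ℂ) (F ζ)) D2 :=
  Complex.conjCLE.contDiff.comp_contDiffOn hF

theorem dbar2_conj_expInt {k : ℝ × ℝ → ℂ} (hk : Admissible k) {ζ : ℂ × ℂ} (hζ : ζ ∈ D2) :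
    dbar2 (fun ζ => (starRingEnd ℂ) (expInt k ζ)) ζ =
      -Complex.I * (starRingEnd ℂ) (expInt (fun q => (q.2 : ℂ) * k q) ζ) := by
  rw [dbar2_conj (hasFDerivAt_expInt hk hζ)]
  simp

/-- The tangential operator acts on `conj(expInt k)` by a multiplication of `k` by `p` and `t`, and
produces a factor `v = Im ζ₁`, which raises the order of the moments in `v`. -/
theorem tangentialCR_conj_expInt {k : ℝ × ℝ → ℂ} (hk : Admissible k) {ζ : ℂ × ℂ} (hζ : ζ ∈ D2) :
    tangentialCR (fun ζ => (starRingEnd ℂ) (expInt k ζ)) ζ =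
      -Complex.I * (starRingEnd ℂ) (expInt (fun q => (q.1 : ℂ) * k q) ζ) -
      4 * Complex.I * ζ.1.im * (starRingEnd ℂ) (expInt (fun q => (q.2 : ℂ) * k q) ζ) := by
  rw [tangentialCR, dbar2_conj (hasFDerivAt_expInt hk hζ), dbar1_conj (hasFDerivAt_expInt hk hζ)]
  simp only [map_add, map_mul, Complex.conj_I, map_ofNat]
  have e1 := Complex.re_add_im ζ.1
  have e2 : (starRingEnd ℂ) ζ.1 = ζ.1.re - ζ.1.im * Complex.I := by
    apply Complex.ext <;> simp
  rw [e2]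
  set c := (starRingEnd ℂ) (expInt (fun q => (q.2 : ℂ) * k q) ζ)
  linear_combination (2 * c) * e1 + (2 * ζ.1 * c) * Complex.I_mul_I

/-! ### Integration by parts with cutoff functions -/

instance isAddHaarMeasure_volume_complex_prod : (volume : Measure (ℂ × ℂ)).IsAddHaarMeasure :=
  inferInstanceAs (((volume : Measure ℂ).prod (volume : Measure ℂ)).IsAddHaarMeasure)

/-- Smooth functions with compact support contained in `D₂`. -/
structure IsTest (G : ℂ × ℂ → ℂ) : Prop where
  smooth : ContDiff ℝ (⊤ : ℕ∞) G
  compact : HasCompactSupport G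
  subset : tsupport G ⊆ D2

theorem IsTest.mul_left {F G : ℂ × ℂ → ℂ} (hG : IsTest G) (hF : ContDiffOn ℝ (⊤ : ℕ∞) F D2) :
    IsTest fun ζ => F ζ * G ζ := by
  have hsub : tsupport (fun ζ => F ζ * G ζ) ⊆ tsupport G := tsupport_mul_subset_right
  refine ⟨contDiff_iff_contDiffAt.2 fun ζ => ?_, hG.compact.mul_left, hsub.trans hG.subset⟩
  by_cases hζ : ζ ∈ tsupport G
  · exact (hF.contDiffAt (isOpen_D2.mem_nhds (hG.subset hζ))).mul hG.smooth.contDiffAt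
  · refine (contDiffAt_const (c := (0 : ℂ))).congr_of_eventuallyEq ?_
    filter_upwards [notMem_tsupport_iff_eventuallyEq.1 hζ] with ξ hξ
    simp [hξ]

theorem IsTest.fderiv_apply {G : ℂ × ℂ → ℂ} (hG : IsTest G) (v : ℂ × ℂ) :
    IsTest fun ζ => fderiv ℝ G ζ v := by
  have hsub : tsupport (fun ζ => fderiv ℝ G ζ v) ⊆ tsupport G := tsupport_fderiv_apply_subset ℝ v
  exact ⟨(hG.smooth.fderiv_right (by simp)).clm_apply contDiff_const,
    hG.compact.fderiv_apply (𝕜 := ℝ) v, hsub.trans hG.subset⟩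

theorem IsTest.add {F G : ℂ × ℂ → ℂ} (hF : IsTest F) (hG : IsTest G) :
    IsTest fun ζ => F ζ + G ζ :=
  ⟨hF.smooth.add hG.smooth, hF.compact.add hG.compact,
    (tsupport_add F G).trans (union_subset hF.subset hG.subset)⟩

theorem IsTest.continuous {G : ℂ × ℂ → ℂ} (hG : IsTest G) : Continuous G := hG.smooth.continuous

theorem IsTest.integrable {G : ℂ × ℂ → ℂ} (hG : IsTest G) : Integrable G :=
  hG.continuous.integrable_of_hasCompactSupport hG.compact

theorem IsTest.dbar2 {G : ℂ × ℂ → ℂ} (hG : IsTest G) : IsTest (dbar2 G) :=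
  (((hG.fderiv_apply (0, Complex.I)).mul_left
    (contDiffOn_const (c := Complex.I))).add (hG.fderiv_apply (0, 1))).mul_left
    (contDiffOn_const (c := 1 / 2)) |> fun h => by
      refine (?_ : _ = Siegel.dbar2 G) ▸ h
      funext ζ; simp only [Siegel.dbar2]; ring

theorem IsTest.tangentialCR {G : ℂ × ℂ → ℂ} (hG : IsTest G) : IsTest (tangentialCR G) :=
  ((((hG.fderiv_apply (Complex.I, 0)).mul_left
    (contDiffOn_const (c := Complex.I))).add (hG.fderiv_apply (1, 0))).mul_left
    (contDiffOn_const (c := 1 / 2))).add (hG.dbar2.mul_left (F := fun ζ => -(2 * Complex.I * ζ.1))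
      (contDiff_const.mul contDiff_fst).neg.contDiffOn) |> fun h => by
      refine (?_ : _ = Siegel.tangentialCR G) ▸ h
      funext ζ; simp only [Siegel.tangentialCR, Siegel.dbar1]; ring

theorem IsTest.integral_fderiv {G : ℂ × ℂ → ℂ} (hG : IsTest G) (v : ℂ × ℂ) :
    ∫ ζ, fderiv ℝ G ζ v = 0 := by
  have h := integral_mul_fderiv_eq_neg_fderiv_mul_of_integrable (μ := (volume : Measure (ℂ × ℂ)))
    (f := fun _ => (1 : ℂ)) (g := G) (v := v) (by simp) (by simpa using (hG.fderiv_apply v).integrable)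
    (by simpa using hG.integrable) (fun _ _ => by fun_prop)
    (fun x _ => hG.smooth.differentiable (by simp) x)
  simpa using h

theorem IsTest.integral_fst_mul_fderiv {G : ℂ × ℂ → ℂ} (hG : IsTest G) (w : ℂ) :
    ∫ ζ : ℂ × ℂ, ζ.1 * fderiv ℝ G ζ (0, w) = 0 := by
  have hfst : ContDiffOn ℝ (⊤ : ℕ∞) (fun ζ : ℂ × ℂ => ζ.1) D2 := contDiff_fst.contDiffOn
  have hd : ∀ ζ : ℂ × ℂ, fderiv ℝ (fun ζ : ℂ × ℂ => ζ.1) ζ (0, w) = 0 := fun ζ => by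
    rw [show (fun ζ : ℂ × ℂ => ζ.1) = Prod.fst from rfl, fderiv_fst]; rfl
  have h := integral_mul_fderiv_eq_neg_fderiv_mul_of_integrable (μ := (volume : Measure (ℂ × ℂ)))
    (f := fun ζ : ℂ × ℂ => ζ.1) (g := G) (v := (0, w)) (by simp [hd])
    ((hG.fderiv_apply (0, w)).mul_left hfst).integrable
    (hG.mul_left hfst).integrable (fun _ _ => by fun_prop)
    (fun x _ => hG.smooth.differentiable (by simp) x)
  simpa [hd] using h

theorem IsTest.integral_dbar2 {G : ℂ × ℂ → ℂ} (hG : IsTest G) : ∫ ζ, Siegel.dbar2 G ζ = 0 := by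
  simp only [Siegel.dbar2, integral_const_mul]
  rw [integral_add (hG.fderiv_apply _).integrable ((hG.fderiv_apply _).integrable.const_mul _),
    integral_const_mul, hG.integral_fderiv, hG.integral_fderiv]
  simp

theorem IsTest.integral_tangentialCR {G : ℂ × ℂ → ℂ} (hG : IsTest G) :
    ∫ ζ, Siegel.tangentialCR G ζ = 0 := by
  have hfst : ContDiffOn ℝ (⊤ : ℕ∞) (fun ζ : ℂ × ℂ => ζ.1) D2 := contDiff_fst.contDiffOn
  have e : Siegel.tangentialCR G = fun ζ => (1 / 2) * fderiv ℝ G ζ (1, 0) +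
      (1 / 2 * Complex.I) * fderiv ℝ G ζ (Complex.I, 0) +
      (-Complex.I) * (ζ.1 * fderiv ℝ G ζ (0, 1)) + 1 * (ζ.1 * fderiv ℝ G ζ (0, Complex.I)) := by
    funext ζ
    simp only [Siegel.tangentialCR, Siegel.dbar1, Siegel.dbar2]
    linear_combination (-ζ.1 * fderiv ℝ G ζ (0, Complex.I)) * Complex.I_mul_I
  have i1 := (hG.fderiv_apply (1, 0)).integrable.const_mul (1 / 2)
  have i2 := (hG.fderiv_apply (Complex.I, 0)).integrable.const_mul (1 / 2 * Complex.I)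
  have i3 := ((hG.fderiv_apply (0, 1)).mul_left hfst).integrable.const_mul (-Complex.I)
  have i4 := ((hG.fderiv_apply (0, Complex.I)).mul_left hfst).integrable.const_mul 1
  rw [e]
  beta_reduce
  rw [integral_add (by exact (i1.add i2).add i3) i4, integral_add (by exact i1.add i2) i3,
    integral_add i1 i2]
  simp only [integral_const_mul, hG.integral_fderiv, hG.integral_fst_mul_fderiv]
  simp

/-- A local derivation which maps test functions to test functions with vanishing integral. -/
structure IsParts (P : (ℂ × ℂ → ℂ) → ℂ × ℂ → ℂ) : Prop extends IsDbarOp P where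
  test : ∀ G, IsTest G → IsTest (P G)
  integral : ∀ G, IsTest G → ∫ ζ, P G ζ = 0
  germ : ∀ F G ζ, F =ᶠ[𝓝 ζ] G → P F ζ = P G ζ

theorem isParts_dbar2 : IsParts dbar2 where
  toIsDbarOp := isDbarOp_dbar2
  test _ hG := hG.dbar2
  integral _ hG := hG.integral_dbar2
  germ F G ζ h := by simp only [dbar2, h.fderiv_eq]

theorem isParts_tangentialCR : IsParts tangentialCR where
  toIsDbarOp := isDbarOp_tangentialCR
  test _ hG := hG.tangentialCR
  integral _ hG := hG.integral_tangentialCR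
  germ F G ζ h := by simp only [tangentialCR, dbar1, dbar2, h.fderiv_eq]

theorem IsParts.germ_iterate {P : (ℂ × ℂ → ℂ) → ℂ × ℂ → ℂ} (hP : IsParts P) (n : ℕ)
    {F G : ℂ × ℂ → ℂ} {ζ : ℂ × ℂ} (h : F =ᶠ[𝓝 ζ] G) : P^[n] F =ᶠ[𝓝 ζ] P^[n] G := by
  induction n with
  | zero => exact h
  | succ n ih =>
    rw [Function.iterate_succ_apply', Function.iterate_succ_apply']
    exact ih.eventuallyEq_nhds.mono fun ξ hξ => hP.germ _ _ _ hξ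

theorem IsTest.setIntegral {G : ℂ × ℂ → ℂ} (hG : IsTest G) : ∫ ζ in D2, G ζ = ∫ ζ, G ζ :=
  setIntegral_eq_integral_of_forall_compl_eq_zero fun _ hζ =>
    image_eq_zero_of_notMem_tsupport fun h => hζ (hG.subset h)

/-- Integration by parts against a test function. -/
theorem IsParts.integral_mul {P : (ℂ × ℂ → ℂ) → ℂ × ℂ → ℂ} (hP : IsParts P) {F G : ℂ × ℂ → ℂ}
    (hF : ContDiffOn ℝ (⊤ : ℕ∞) F D2) (hG : IsTest G) :
    ∫ ζ in D2, P F ζ * G ζ = -∫ ζ in D2, F ζ * P G ζ := by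
  have t1 := hG.mul_left (hP.smooth F hF)
  have t2 := (hP.test G hG).mul_left hF
  have h0 := hP.integral _ (hG.mul_left hF)
  rw [← (hP.test _ (hG.mul_left hF)).setIntegral] at h0
  rw [eq_neg_iff_add_eq_zero, ← integral_add t1.integrable.integrableOn t2.integrable.integrableOn,
    ← h0]
  refine setIntegral_congr_fun isOpen_D2.measurableSet fun ζ hζ => ?_
  exact (hP.mul F G ζ (ContDiffOn.differentiableAt_D2 hF hζ)
    (hG.smooth.differentiable (by simp) ζ)).symm

theorem IsParts.integral_iterate_mul {P : (ℂ × ℂ → ℂ) → ℂ × ℂ → ℂ} (hP : IsParts P) (n : ℕ) :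
    ∀ {F G : ℂ × ℂ → ℂ}, ContDiffOn ℝ (⊤ : ℕ∞) F D2 → IsTest G →
    ∫ ζ in D2, P^[n] F ζ * G ζ = (-1) ^ n * ∫ ζ in D2, F ζ * P^[n] G ζ := by
  induction n with
  | zero => intro F G _ _; simp
  | succ n ih =>
    intro F G hF hG
    rw [Function.iterate_succ_apply', hP.integral_mul ((hP.toIsLinearOp.iterate n).smooth F hF) hG,
      ih hF (hP.test G hG), ← Function.iterate_succ_apply]
    ring

/-- A smooth function with value `1` on `(-∞, 1]` and value `0` on `[2, ∞)`. -/
def cut (x : ℝ) : ℝ := Real.smoothTransition (2 - x)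

theorem contDiff_cut : ContDiff ℝ (⊤ : ℕ∞) cut :=
  Real.smoothTransition.contDiff.comp (contDiff_const.sub contDiff_id)

theorem cut_eq_one {x : ℝ} (h : x ≤ 1) : cut x = 1 :=
  Real.smoothTransition.one_of_one_le (by linarith)

theorem cut_eq_zero {x : ℝ} (h : 2 ≤ x) : cut x = 0 :=
  Real.smoothTransition.zero_of_nonpos (by linarith)

theorem iteratedDeriv_cut_eq_zero {j : ℕ} {x : ℝ} (h : 2 < x) : iteratedDeriv j cut x = 0 := by
  have : cut =ᶠ[𝓝 x] fun _ => 0 := by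
    filter_upwards [lt_mem_nhds h] with y hy using cut_eq_zero hy.le
  rw [this.iteratedDeriv_eq, iteratedDeriv_const]; simp

theorem continuous_iteratedDeriv_cut (j : ℕ) : Continuous (iteratedDeriv j cut) :=
  contDiff_cut.continuous_iteratedDeriv j (by exact_mod_cast le_top)

theorem iteratedDeriv_cut_bounded (j : ℕ) : ∃ C : ℝ, 0 ≤ C ∧ ∀ x, |iteratedDeriv j cut x| ≤ C := by
  have hc : Continuous (fun x => |iteratedDeriv j cut x|) := (continuous_iteratedDeriv_cut j).abs
  obtain ⟨C, hC⟩ := (isCompact_Icc (a := (0 : ℝ)) (b := 3)).bddAbove_image hc.continuousOn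
  have hC' : ∀ x ∈ Icc (0 : ℝ) 3, |iteratedDeriv j cut x| ≤ C := fun x hx => hC ⟨x, hx, rfl⟩
  have hC0 : 0 ≤ C := (abs_nonneg _).trans (hC' 0 (by simp))
  refine ⟨C + 1, by linarith, fun x => ?_⟩
  rcases lt_or_ge x 0 with h | h
  · have : cut =ᶠ[𝓝 x] fun _ => 1 := by
      filter_upwards [gt_mem_nhds h] with y hy using cut_eq_one (by linarith)
    rw [this.iteratedDeriv_eq, iteratedDeriv_const]
    split_ifs <;> simp <;> linarith
  · rcases le_or_gt x 3 with h3 | h3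
    · linarith [hC' x ⟨h, h3⟩]
    · rw [iteratedDeriv_cut_eq_zero (by linarith)]; simp; linarith

/-- The cutoff of height: the value is `1` if `2 / N ≤ ρ ≤ N`. -/
def cutRho (N : ℕ) (ζ : ℂ × ℂ) : ℂ :=
  ((fun x => 1 - cut x) (N * rho ζ) : ℝ) * (cut (rho ζ / N) : ℝ)

/-- The cutoff in the horizontal directions, of size `N` in `ζ₁` and of size `N²` in `Re ζ₂`. -/
def cutHor (N : ℕ) (ζ : ℂ × ℂ) : ℂ :=
  (cut (ζ.2.re / N ^ 2) : ℝ) * (cut (-ζ.2.re / N ^ 2) : ℝ) * (cut (‖ζ.1‖ ^ 2 / N ^ 2) : ℝ)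

/-- The cutoff functions which exhaust `D₂`. -/
def cutoff (N : ℕ) (ζ : ℂ × ℂ) : ℂ := cutRho N ζ * cutHor N ζ

theorem contDiff_re_snd {n : WithTop ℕ∞} : ContDiff ℝ n fun ζ : ℂ × ℂ => ζ.2.re :=
  contDiff_re_complex.comp contDiff_snd

theorem contDiff_cut_comp {r : ℂ × ℂ → ℝ} (hr : ContDiff ℝ (⊤ : ℕ∞) r) :
    ContDiff ℝ (⊤ : ℕ∞) fun ζ => ((cut (r ζ) : ℝ) : ℂ) :=
  contDiff_ofReal_complex.comp (contDiff_cut.comp hr)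

theorem contDiff_one_sub_cut : ContDiff ℝ (⊤ : ℕ∞) fun x => 1 - cut x :=
  contDiff_const.sub contDiff_cut

theorem contDiff_cutRho (N : ℕ) : ContDiff ℝ (⊤ : ℕ∞) (cutRho N) :=
  (contDiff_ofReal_complex.comp (contDiff_one_sub_cut.comp (contDiff_const.mul contDiff_rho))).mul
    (contDiff_cut_comp (contDiff_rho.div_const _))

theorem contDiff_cutHor (N : ℕ) : ContDiff ℝ (⊤ : ℕ∞) (cutHor N) :=
  ((contDiff_cut_comp (contDiff_re_snd.div_const _)).mul
    (contDiff_cut_comp (contDiff_re_snd.neg.div_const _))).mul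
    (contDiff_cut_comp (contDiff_normSq_fst.div_const _))

/-- The support of `cutoff N` lies in a compact set on which `ρ ≥ 1/N`. -/
theorem isTest_cutoff {N : ℕ} (hN : 1 ≤ N) : IsTest (cutoff N) := by
  have hN' : (0 : ℝ) < N := by exact_mod_cast hN
  set K : Set (ℂ × ℂ) := {ζ | 1 / N ≤ rho ζ ∧ rho ζ ≤ 2 * N ∧ |ζ.2.re| ≤ 2 * N ^ 2 ∧
    ‖ζ.1‖ ^ 2 ≤ 2 * N ^ 2} with hK
  have hcl : IsClosed K := by
    have := continuous_rho
    refine IsClosed.and ?_ (IsClosed.and ?_ (IsClosed.and ?_ ?_)) <;>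
      exact isClosed_le (by fun_prop) (by fun_prop)
  have hbd : Bornology.IsBounded K := by
    refine (Metric.isBounded_closedBall (x := (0 : ℂ × ℂ)) (r := 2 * N ^ 2 + 2 * N + 2 * N ^ 2 + 1)).subset ?_
    rintro ζ ⟨h1, h2, h3, h4⟩
    rw [mem_closedBall_zero_iff, Prod.norm_def, max_le_iff]
    have him : ζ.2.im = rho ζ + ‖ζ.1‖ ^ 2 := by rw [rho]; ring
    have hr0 : 0 ≤ rho ζ := (by positivity : (0 : ℝ) ≤ 1 / N).trans h1
    refine ⟨?_, ?_⟩
    · nlinarith [sq_nonneg (‖ζ.1‖ - 1)]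
    · refine (Complex.norm_le_abs_re_add_abs_im _).trans ?_
      rw [him, abs_of_nonneg (by positivity : 0 ≤ rho ζ + ‖ζ.1‖ ^ 2)]
      linarith
  have hzero : ∀ ζ, ζ ∉ K → cutoff N ζ = 0 := by
    intro ζ hζ
    by_contra hne
    refine hζ ?_
    simp only [cutoff, cutRho, cutHor, mul_ne_zero_iff, ne_eq, Complex.ofReal_eq_zero] at hne
    obtain ⟨⟨h1, h2⟩, ⟨h3, h4⟩, h5⟩ := hne
    refine ⟨?_, ?_, abs_le.2 ⟨?_, ?_⟩, ?_⟩ <;> by_contra hc <;> push Not at hc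
    · refine h1 ?_
      rw [lt_div_iff₀ hN'] at hc
      rw [cut_eq_one (by linarith)]; simp
    · exact h2 (cut_eq_zero (by rw [le_div_iff₀ hN']; linarith))
    · exact h4 (cut_eq_zero (by rw [le_div_iff₀ (by positivity)]; linarith))
    · exact h3 (cut_eq_zero (by rw [le_div_iff₀ (by positivity)]; linarith))
    · exact h5 (cut_eq_zero (by rw [le_div_iff₀ (by positivity)]; linarith))
  have hsub : tsupport (cutoff N) ⊆ K := closure_minimal (fun ζ hζ => by
    by_contra h; exact hζ (hzero ζ h)) hcl
  refine ⟨(contDiff_cutRho N).mul (contDiff_cutHor N), ?_, fun ζ hζ => ?_⟩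
  · exact (Metric.isCompact_of_isClosed_isBounded hcl hbd).of_isClosed_subset
      (isClosed_tsupport _) hsub
  · exact (by positivity : (0 : ℝ) < 1 / N).trans_le (hsub hζ).1

/-- Near a point of `D₂`, all but finitely many of the cutoff functions are identically `1`. -/
theorem cutoff_eventually_eq_one {ζ : ℂ × ℂ} (hζ : ζ ∈ D2) :
    ∀ᶠ N : ℕ in atTop, cutoff N =ᶠ[𝓝 ζ] fun _ => 1 := by
  have hρ : 0 < rho ζ := hζ
  have t : Tendsto (fun N : ℕ => (N : ℝ)) atTop atTop := tendsto_natCast_atTop_atTop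
  have t2 : Tendsto (fun N : ℕ => (N : ℝ) ^ 2) atTop atTop :=
    (tendsto_pow_atTop (by norm_num)).comp t
  filter_upwards [t.eventually_gt_atTop (2 / rho ζ), t.eventually_gt_atTop (rho ζ),
    t2.eventually_gt_atTop |ζ.2.re|, t2.eventually_gt_atTop (‖ζ.1‖ ^ 2),
    eventually_ge_atTop 1] with N h1 h2 h3 h4 hN
  have hN' : (0 : ℝ) < N := by exact_mod_cast hN
  rw [div_lt_iff₀ hρ] at h1
  have hc := continuous_rho
  have ho : IsOpen {ξ : ℂ × ℂ | 2 < N * rho ξ ∧ rho ξ < N ∧ |ξ.2.re| < (N : ℝ) ^ 2 ∧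
      ‖ξ.1‖ ^ 2 < (N : ℝ) ^ 2} := by
    refine IsOpen.and ?_ (IsOpen.and ?_ (IsOpen.and ?_ ?_)) <;>
      exact isOpen_lt (by fun_prop) (by fun_prop)
  filter_upwards [ho.mem_nhds ⟨h1, h2, h3, h4⟩] with ξ hξ
  obtain ⟨g1, g2, g3, g4⟩ := hξ
  have g3' := abs_lt.1 g3
  simp only [cutoff, cutRho, cutHor]
  rw [cut_eq_zero g1.le, cut_eq_one (x := rho ξ / N) (by rw [div_le_one hN']; exact g2.le),
    cut_eq_one (x := ξ.2.re / N ^ 2) (by rw [div_le_one (by positivity)]; exact g3'.2.le),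
    cut_eq_one (x := -ξ.2.re / N ^ 2) (by rw [div_le_one (by positivity)]; linarith),
    cut_eq_one (x := ‖ξ.1‖ ^ 2 / N ^ 2) (by rw [div_le_one (by positivity)]; exact g4.le)]
  simp

/-- If `P^n F = 0`, then `F` annihilates `P^n Θ`, provided that the functions `P^n (χ_N Θ)` have a
common square integrable majorant; the test functions `χ_N Θ` converge to `Θ`. -/
theorem IsParts.integral_mul_iterate_eq_zero {P : (ℂ × ℂ → ℂ) → ℂ × ℂ → ℂ} (hP : IsParts P)
    (n : ℕ) {F Θ : ℂ × ℂ → ℂ} (hF : ContDiffOn ℝ (⊤ : ℕ∞) F D2)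
    (hF2 : MemLp F 2 (volume.restrict D2)) (hPF : ∀ ζ ∈ D2, P^[n] F ζ = 0)
    (hΘ : ContDiffOn ℝ (⊤ : ℕ∞) Θ D2) {b : ℂ × ℂ → ℝ} (hb : MemLp b 2 (volume.restrict D2))
    (hle : ∀ N : ℕ, 1 ≤ N → ∀ ζ ∈ D2, ‖P^[n] (fun ξ => Θ ξ * cutoff N ξ) ζ‖ ≤ b ζ) :
    ∫ ζ in D2, F ζ * P^[n] Θ ζ = 0 := by
  have h0 : ∀ N : ℕ, 1 ≤ N → ∫ ζ in D2, F ζ * P^[n] (fun ξ => Θ ξ * cutoff N ξ) ζ = 0 := by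
    intro N hN
    have h := hP.integral_iterate_mul n hF ((isTest_cutoff hN).mul_left hΘ)
    have h1 : ∫ ζ in D2, P^[n] F ζ * (Θ ζ * cutoff N ζ) = 0 := by
      rw [← integral_zero (ℂ × ℂ) ℂ (μ := volume.restrict D2)]
      refine setIntegral_congr_fun isOpen_D2.measurableSet fun ζ hζ => ?_
      simp [hPF ζ hζ]
    rw [h1] at h
    simpa using h.symm
  have ht : Tendsto (fun N : ℕ => ∫ ζ in D2, F ζ * P^[n] (fun ξ => Θ ξ * cutoff N ξ) ζ) atTop
      (𝓝 (∫ ζ in D2, F ζ * P^[n] Θ ζ)) := by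
    refine tendsto_integral_filter_of_dominated_convergence (fun ζ => ‖F ζ‖ * b ζ) ?_ ?_ ?_ ?_
    · filter_upwards [eventually_ge_atTop 1] with N hN
      have hs := (hP.toIsLinearOp.iterate n).smooth _
        ((isTest_cutoff hN).mul_left hΘ).smooth.contDiffOn
      exact (hF.continuousOn.mul hs.continuousOn).aestronglyMeasurable isOpen_D2.measurableSet
    · filter_upwards [eventually_ge_atTop 1] with N hN
      filter_upwards [ae_restrict_mem isOpen_D2.measurableSet] with ζ hζ
      rw [norm_mul]
      exact mul_le_mul_of_nonneg_left (hle N hN ζ hζ) (norm_nonneg _)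
    · exact hF2.norm.integrable_mul hb
    · filter_upwards [ae_restrict_mem isOpen_D2.measurableSet] with ζ hζ
      refine tendsto_const_nhds.congr' ?_
      filter_upwards [cutoff_eventually_eq_one hζ] with N hN
      have e : Θ =ᶠ[𝓝 ζ] fun ξ => Θ ξ * cutoff N ξ := by
        filter_upwards [hN] with ξ hξ
        rw [hξ, mul_one]
      rw [(hP.germ_iterate n e).eq_of_nhds]
  refine tendsto_nhds_unique ht (tendsto_const_nhds.congr' ?_)
  filter_upwards [eventually_ge_atTop 1] with N hN using (h0 N hN).symm

/-! ### Estimates for the cutoff functions -/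

/-- Families of functions whose derivatives `(∂/∂ζ̄₂)^j` are of the order `(1 + 1/ρ)^j`, uniformly
in the family. -/
structure IsTame (S : ℕ → ℂ × ℂ → ℂ) : Prop where
  smooth : ∀ N, ContDiff ℝ (⊤ : ℕ∞) (S N)
  bound : ∀ j : ℕ, ∃ C : ℝ, 0 ≤ C ∧ ∀ N : ℕ, 1 ≤ N → ∀ ζ ∈ D2,
    ‖dbar2^[j] (S N) ζ‖ ≤ C * (1 + (rho ζ)⁻¹) ^ j

theorem IsTame.mul {S T : ℕ → ℂ × ℂ → ℂ} (hS : IsTame S) (hT : IsTame T) :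
    IsTame fun N ζ => S N ζ * T N ζ := by
  refine ⟨fun N => (hS.smooth N).mul (hT.smooth N), fun j => ?_⟩
  choose C hC0 hC using hS.bound
  choose C' hC0' hC' using hT.bound
  refine ⟨∑ ij ∈ Finset.HasAntidiagonal.antidiagonal j, j.choose ij.1 * (C ij.1 * C' ij.2),
    Finset.sum_nonneg fun ij _ => mul_nonneg (by positivity) (mul_nonneg (hC0 _) (hC0' _)),
    fun N hN ζ hζ => ?_⟩
  have hρ : 0 < rho ζ := hζ
  rw [isDbarOp_dbar2.iterate_mul (hS.smooth N).contDiffOn (hT.smooth N).contDiffOn j hζ,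
    Finset.sum_mul]
  refine (norm_sum_le _ _).trans (Finset.sum_le_sum fun ij hij => ?_)
  rw [nsmul_eq_mul, norm_mul, norm_mul, Complex.norm_natCast,
    ← Finset.HasAntidiagonal.mem_antidiagonal.1 hij, pow_add]
  have h1 := hC ij.1 N hN ζ hζ
  have h2 := hC' ij.2 N hN ζ hζ
  calc _ ≤ (((ij.1 + ij.2).choose ij.1 : ℕ) : ℝ) *
        ((C ij.1 * (1 + (rho ζ)⁻¹) ^ ij.1) * (C' ij.2 * (1 + (rho ζ)⁻¹) ^ ij.2)) := by
        gcongr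
        exact mul_nonneg (hC0 _) (by positivity)
    _ = _ := by ring

/-- Cutoffs of a quantity with constant derivative of modulus at most `1`. -/
theorem isTame_cut {r : ℕ → ℂ × ℂ → ℝ} {c : ℕ → ℂ} (hr : ∀ N, ContDiff ℝ (⊤ : ℕ∞) (r N))
    (hc : ∀ N, ∀ ζ ∈ D2, dbar2 (fun ζ => (r N ζ : ℂ)) ζ = c N) (hc1 : ∀ N, 1 ≤ N → ‖c N‖ ≤ 1) :
    IsTame fun N ζ => ((cut (r N ζ) : ℝ) : ℂ) := by
  refine ⟨fun N => contDiff_cut_comp (hr N), fun j => ?_⟩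
  obtain ⟨C, hC0, hC⟩ := iteratedDeriv_cut_bounded j
  refine ⟨C, hC0, fun N hN ζ hζ => ?_⟩
  have hρ : 0 < rho ζ := hζ
  rw [isDbarOp_dbar2.iterate_comp contDiff_cut (hr N) (hc N) j hζ]
  simp only [norm_mul, norm_pow, Complex.norm_real, Real.norm_eq_abs]
  have h1 : ‖c N‖ ^ j ≤ 1 := pow_le_one₀ (norm_nonneg _) (hc1 N hN)
  have h2 : 1 ≤ (1 + (rho ζ)⁻¹) ^ j := one_le_pow₀ (by simp [hρ.le])
  calc _ ≤ 1 * C := mul_le_mul h1 (hC _) (abs_nonneg _) zero_le_one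
    _ = C * 1 := by ring
    _ ≤ _ := by gcongr

theorem dbar2_div_const (F : ℂ × ℂ → ℂ) (hF : ContDiffOn ℝ (⊤ : ℕ∞) F D2) (c : ℂ) {ζ : ℂ × ℂ}
    (hζ : ζ ∈ D2) : dbar2 (fun ζ => F ζ / c) ζ = dbar2 F ζ / c := by
  have := isLinearOp_dbar2.map_const_mul hF c⁻¹ hζ
  simp only [div_eq_inv_mul]
  exact this

/-- The cutoff near the boundary: its derivatives of order `j` are of the size `N^j`, but they
vanish unless `N ρ ≤ 2`, so that `N` is bounded by `2/ρ` on their support. -/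
theorem isTame_one_sub_cut : IsTame fun N ζ => (((fun x => 1 - cut x) (N * rho ζ) : ℝ) : ℂ) := by
  have hr : ∀ N : ℕ, ContDiff ℝ (⊤ : ℕ∞) fun ζ => (N : ℝ) * rho ζ := fun N =>
    contDiff_const.mul contDiff_rho
  refine ⟨fun N => contDiff_ofReal_complex.comp (contDiff_one_sub_cut.comp (hr N)), fun j => ?_⟩
  obtain ⟨C, hC0, hC⟩ := iteratedDeriv_cut_bounded j
  refine ⟨C + 1, by linarith, fun N hN ζ hζ => ?_⟩
  have hρ : 0 < rho ζ := hζ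
  have hN' : (0 : ℝ) < N := by exact_mod_cast hN
  have hd : ∀ ξ ∈ D2, dbar2 (fun ζ => (((N : ℝ) * rho ζ : ℝ) : ℂ)) ξ = N * (Complex.I / 2) := by
    intro ξ hξ
    have := isLinearOp_dbar2.map_const_mul (contDiff_ofReal_rho (n := (⊤ : ℕ∞))).contDiffOn (N : ℂ) hξ
    push_cast
    rw [this]
    beta_reduce
    rw [dbar2_rho]
  have he := isDbarOp_dbar2.iterate_comp contDiff_one_sub_cut (hr N) hd j hζ
  refine (congrArg norm he).trans_le ?_
  rcases j with _ | j
  · simp only [pow_zero, one_mul, mul_one, iteratedDeriv_zero, Complex.norm_real, Real.norm_eq_abs]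
    have := hC (N * rho ζ)
    rw [iteratedDeriv_zero] at this
    have h3 := abs_sub (1 : ℝ) (cut (N * rho ζ))
    rw [abs_one] at h3
    linarith
  · have hdd : iteratedDeriv (j + 1) (fun x => 1 - cut x) = fun x => -iteratedDeriv (j + 1) cut x := by
      funext x
      have h1 : deriv (fun x => 1 - cut x) = fun x => -deriv cut x := by
        funext y
        rw [deriv_const_sub]
      rw [iteratedDeriv_succ', h1, iteratedDeriv_fun_neg, ← iteratedDeriv_succ']
    rw [hdd]
    simp only [norm_mul, norm_pow, Complex.norm_natCast, norm_div, Complex.norm_I, Complex.norm_real,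
      Complex.norm_ofNat, Real.norm_eq_abs, abs_neg]
    rcases le_or_gt (N * rho ζ) 2 with h2 | h2
    · have h3 : (N : ℝ) * (1 / 2) ≤ 1 + (rho ζ)⁻¹ := by
        have : (N : ℝ) * (1 / 2) ≤ (rho ζ)⁻¹ := by
          rw [← one_div, le_div_iff₀ hρ]; linarith
        linarith
      calc _ ≤ (1 + (rho ζ)⁻¹) ^ (j + 1) * C := by
            gcongr
            exact hC _
        _ ≤ _ := by
            rw [mul_comm]
            gcongr
            linarith
    · rw [iteratedDeriv_cut_eq_zero h2, abs_zero, mul_zero]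
      positivity

theorem isTame_cutoff : IsTame cutoff := by
  have hN1 : ∀ N : ℕ, 1 ≤ N → (1 : ℝ) ≤ N := fun N hN => by exact_mod_cast hN
  have hR : IsTame cutRho := by
    refine isTame_one_sub_cut.mul (isTame_cut (r := fun N ζ => rho ζ / N)
      (c := fun N => Complex.I / 2 / N) (fun N => contDiff_rho.div_const _) (fun N ζ hζ => ?_)
      fun N hN => ?_)
    · push_cast
      rw [dbar2_div_const _ contDiff_ofReal_rho.contDiffOn _ hζ, dbar2_rho]
    · have := hN1 N hN
      simp only [norm_div, Complex.norm_I, Complex.norm_ofNat, Complex.norm_natCast]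
      rw [div_le_one (by linarith)]; linarith
  have hre : ContDiffOn ℝ (⊤ : ℕ∞) (fun ζ : ℂ × ℂ => (ζ.2.re : ℂ)) D2 :=
    (contDiff_ofReal_complex.comp contDiff_re_snd).contDiffOn
  have hH : IsTame cutHor := by
    refine ((isTame_cut (r := fun N ζ => ζ.2.re / N ^ 2)
      (c := fun N => 1 / 2 / N ^ 2) (fun N => contDiff_re_snd.div_const _) (fun N ζ hζ => ?_)
      fun N hN => ?_).mul (isTame_cut (r := fun N ζ => -ζ.2.re / N ^ 2)
      (c := fun N => -1 * (1 / 2) / N ^ 2) (fun N => contDiff_re_snd.neg.div_const _)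
      (fun N ζ hζ => ?_) fun N hN => ?_)).mul (isTame_cut (r := fun N ζ => ‖ζ.1‖ ^ 2 / N ^ 2)
      (c := fun N => 0 / N ^ 2) (fun N => contDiff_normSq_fst.div_const _) (fun N ζ hζ => ?_)
      fun N hN => ?_)
    · push_cast
      rw [dbar2_div_const _ hre _ hζ, dbar2_re_snd]
    · have := one_le_pow₀ (hN1 N hN) (n := 2)
      simp only [norm_div, norm_one, Complex.norm_ofNat, norm_pow, Complex.norm_natCast]
      rw [div_le_one (by linarith)]; linarith
    · have h1 := isLinearOp_dbar2.map_const_mul hre (-1) hζ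
      simp only [dbar2_re_snd] at h1
      rw [← h1, ← dbar2_div_const _ (contDiffOn_const.mul hre) _ hζ]
      push_cast
      simp only [neg_one_mul]
    · have := one_le_pow₀ (hN1 N hN) (n := 2)
      simp only [norm_div, norm_mul, norm_neg, norm_one, Complex.norm_ofNat, norm_pow,
        Complex.norm_natCast]
      rw [div_le_one (by linarith)]; linarith
    · have hn : ContDiffOn ℝ (⊤ : ℕ∞) (fun ξ : ℂ × ℂ => ((‖ξ.1‖ ^ 2 : ℝ) : ℂ)) D2 :=
        (contDiff_ofReal_complex.comp contDiff_normSq_fst).contDiffOn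
      simp only [Complex.ofReal_div]
      rw [dbar2_div_const _ hn _ hζ, dbar2_normSq_fst]
      push_cast; rfl
    · simp
  exact hR.mul hH

/-- Integration by parts for `(∂/∂ζ̄₂)^n`, without boundary terms: each derivative of a cutoff
function costs a factor `1/ρ`, which is compensated by the decay of `Θ` at the boundary. -/
theorem integral_mul_iterate_dbar2_eq_zero (n : ℕ) {F Θ : ℂ × ℂ → ℂ}
    (hF : ContDiffOn ℝ (⊤ : ℕ∞) F D2) (hF2 : MemLp F 2 (volume.restrict D2))
    (hPF : ∀ ζ ∈ D2, dbar2^[n] F ζ = 0) (hΘ : ContDiffOn ℝ (⊤ : ℕ∞) Θ D2)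
    (hΘ2 : ∀ i j, i + j ≤ n → MemLp (fun ζ => ((rho ζ)⁻¹ ^ j : ℂ) * dbar2^[i] Θ ζ) 2
      (volume.restrict D2)) :
    ∫ ζ in D2, F ζ * dbar2^[n] Θ ζ = 0 := by
  choose C hC0 hC using isTame_cutoff.bound
  refine isParts_dbar2.integral_mul_iterate_eq_zero n hF hF2 hPF hΘ
    (b := fun ζ => ∑ ij ∈ Finset.HasAntidiagonal.antidiagonal n,
      (n.choose ij.1 * (C ij.2 * 2 ^ (ij.2 - 1))) * (‖((rho ζ)⁻¹ ^ 0 : ℂ) * dbar2^[ij.1] Θ ζ‖ +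
        ‖((rho ζ)⁻¹ ^ ij.2 : ℂ) * dbar2^[ij.1] Θ ζ‖)) ?_ fun N hN ζ hζ => ?_
  · refine memLp_finsetSum _ fun ij hij => ?_
    have := Finset.HasAntidiagonal.mem_antidiagonal.1 hij
    exact ((hΘ2 ij.1 0 (by omega)).norm.add (hΘ2 ij.1 ij.2 (by omega)).norm).const_mul _
  · have hρ : 0 < rho ζ := hζ
    rw [isDbarOp_dbar2.iterate_mul hΘ (isTame_cutoff.smooth N).contDiffOn n hζ]
    refine (norm_sum_le _ _).trans (Finset.sum_le_sum fun ij _ => ?_)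
    rw [nsmul_eq_mul, norm_mul, norm_mul, Complex.norm_natCast, pow_zero, one_mul, norm_mul,
      norm_pow, Complex.norm_real, Real.norm_of_nonneg (inv_nonneg.2 hρ.le)]
    have h1 := hC ij.2 N hN ζ hζ
    have h2 := add_pow_le zero_le_one (inv_nonneg.2 hρ.le) ij.2
    rw [one_pow] at h2
    calc _ ≤ (n.choose ij.1 : ℝ) * (‖dbar2^[ij.1] Θ ζ‖ *
          (C ij.2 * (2 ^ (ij.2 - 1) * (1 + (rho ζ)⁻¹ ^ ij.2)))) := by
          gcongr
          exact h1.trans (mul_le_mul_of_nonneg_left h2 (hC0 _))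
      _ = _ := by ring

theorem norm_cut_le_one (x : ℝ) : ‖((cut x : ℝ) : ℂ)‖ ≤ 1 := by
  rw [Complex.norm_real, cut, Real.norm_of_nonneg (Real.smoothTransition.nonneg _)]
  exact Real.smoothTransition.le_one _

theorem norm_one_sub_cut_le_one (x : ℝ) : ‖((1 - cut x : ℝ) : ℂ)‖ ≤ 1 := by
  have h0 : 0 ≤ cut x := Real.smoothTransition.nonneg _
  have h1 : cut x ≤ 1 := Real.smoothTransition.le_one _
  rw [Complex.norm_real, Real.norm_of_nonneg (by linarith)]
  linarith

theorem norm_cutRho_le_one (N : ℕ) (ζ : ℂ × ℂ) : ‖cutRho N ζ‖ ≤ 1 := by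
  rw [cutRho, norm_mul]
  exact mul_le_one₀ (norm_one_sub_cut_le_one _) (norm_nonneg _) (norm_cut_le_one _)

theorem norm_cutHor_le_one (N : ℕ) (ζ : ℂ × ℂ) : ‖cutHor N ζ‖ ≤ 1 := by
  rw [cutHor, norm_mul, norm_mul]
  exact mul_le_one₀ (mul_le_one₀ (norm_cut_le_one _) (norm_nonneg _) (norm_cut_le_one _))
    (norm_nonneg _) (norm_cut_le_one _)

theorem tangentialCR_cut_comp {r : ℂ × ℂ → ℝ} (hr : ContDiff ℝ (⊤ : ℕ∞) r) (ζ : ℂ × ℂ) :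
    tangentialCR (fun ζ => ((cut (r ζ) : ℝ) : ℂ)) ζ =
      ((deriv cut (r ζ) : ℝ) : ℂ) * tangentialCR (fun ζ => (r ζ : ℂ)) ζ :=
  isDbarOp_tangentialCR.comp cut r ζ (contDiff_cut.differentiable (by simp) _)
    (hr.differentiable (by simp) _)

theorem tangentialCR_div_const (F : ℂ × ℂ → ℂ) (hF : ContDiffOn ℝ (⊤ : ℕ∞) F D2) (c : ℂ)
    {ζ : ℂ × ℂ} (hζ : ζ ∈ D2) : tangentialCR (fun ζ => F ζ / c) ζ = tangentialCR F ζ / c := by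
  have := isLinearOp_tangentialCR.map_const_mul hF c⁻¹ hζ
  simp only [div_eq_inv_mul]
  exact this

/-- The tangential operator does not see the cutoff near the boundary, since it annihilates `ρ`. -/
theorem tangentialCR_cutRho (N : ℕ) {ζ : ℂ × ℂ} (hζ : ζ ∈ D2) : tangentialCR (cutRho N) ζ = 0 := by
  have hsr : ContDiffOn ℝ (⊤ : ℕ∞) (fun ξ : ℂ × ℂ => (rho ξ : ℂ)) D2 :=
    contDiff_ofReal_rho.contDiffOn
  have h1 : ContDiff ℝ (⊤ : ℕ∞) fun ζ => (N : ℝ) * rho ζ := contDiff_const.mul contDiff_rho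
  have h2 : ContDiff ℝ (⊤ : ℕ∞) fun ζ => rho ζ / N := contDiff_rho.div_const _
  have e1 : tangentialCR (fun ζ => (((fun x => 1 - cut x) (N * rho ζ) : ℝ) : ℂ)) ζ = 0 := by
    rw [isDbarOp_tangentialCR.comp (fun x => 1 - cut x) (fun ζ => N * rho ζ) ζ
      (contDiff_one_sub_cut.differentiable (by simp) _) (h1.differentiable (by simp) _)]
    have := isLinearOp_tangentialCR.map_const_mul hsr (N : ℂ) hζ
    push_cast
    rw [this]
    beta_reduce
    rw [tangentialCR_rho]; simp
  have e2 : tangentialCR (fun ζ => ((cut (rho ζ / N) : ℝ) : ℂ)) ζ = 0 := by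
    rw [tangentialCR_cut_comp h2]
    push_cast
    rw [tangentialCR_div_const _ hsr _ hζ, tangentialCR_rho]; simp
  have := isDbarOp_tangentialCR.mul _ _ ζ
    ((contDiff_ofReal_complex.comp (contDiff_one_sub_cut.comp h1)).differentiable (by simp) ζ)
    ((contDiff_cut_comp h2).differentiable (by simp) ζ)
  refine this.trans ?_
  simp only [Function.comp_def] at e1 ⊢
  rw [e1, e2]; simp

/-- The tangential derivatives of `Re ζ₂` and of `|ζ₁|²` have modulus `|ζ₁|`, which is at most `2N`
on the support of the cutoff; the division by `N²` keeps the products bounded. -/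
theorem tangentialCR_cutHor_bounded : ∃ C : ℝ, 0 ≤ C ∧ ∀ N : ℕ, 1 ≤ N → ∀ ζ ∈ D2,
    ‖tangentialCR (cutHor N) ζ‖ ≤ C := by
  obtain ⟨C, hC0, hC⟩ := iteratedDeriv_cut_bounded 1
  simp only [iteratedDeriv_one] at hC
  refine ⟨6 * C, by linarith, fun N hN ζ hζ => ?_⟩
  have hN' : (1 : ℝ) ≤ N := by exact_mod_cast hN
  have hN0 : (0 : ℝ) < N := by linarith
  have hre : ContDiffOn ℝ (⊤ : ℕ∞) (fun ζ : ℂ × ℂ => (ζ.2.re : ℂ)) D2 :=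
    (contDiff_ofReal_complex.comp contDiff_re_snd).contDiffOn
  have hn : ContDiffOn ℝ (⊤ : ℕ∞) (fun ξ : ℂ × ℂ => ((‖ξ.1‖ ^ 2 : ℝ) : ℂ)) D2 :=
    (contDiff_ofReal_complex.comp contDiff_normSq_fst).contDiffOn
  have r1 : ContDiff ℝ (⊤ : ℕ∞) fun ζ : ℂ × ℂ => ζ.2.re / (N : ℝ) ^ 2 := contDiff_re_snd.div_const _
  have r2 : ContDiff ℝ (⊤ : ℕ∞) fun ζ : ℂ × ℂ => -ζ.2.re / (N : ℝ) ^ 2 :=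
    contDiff_re_snd.neg.div_const _
  have r3 : ContDiff ℝ (⊤ : ℕ∞) fun ζ : ℂ × ℂ => ‖ζ.1‖ ^ 2 / (N : ℝ) ^ 2 :=
    contDiff_normSq_fst.div_const _
  have e1 : tangentialCR (fun ζ => ((cut (ζ.2.re / N ^ 2) : ℝ) : ℂ)) ζ =
      ((deriv cut (ζ.2.re / N ^ 2) : ℝ) : ℂ) * (-(Complex.I * ζ.1) / N ^ 2) := by
    rw [tangentialCR_cut_comp r1]
    push_cast
    rw [tangentialCR_div_const _ hre _ hζ, tangentialCR_re_snd]
  have e2 : tangentialCR (fun ζ => ((cut (-ζ.2.re / N ^ 2) : ℝ) : ℂ)) ζ =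
      ((deriv cut (-ζ.2.re / N ^ 2) : ℝ) : ℂ) * (Complex.I * ζ.1 / N ^ 2) := by
    rw [tangentialCR_cut_comp r2]
    have h1 := isLinearOp_tangentialCR.map_const_mul hre (-1) hζ
    simp only [tangentialCR_re_snd, neg_one_mul] at h1
    push_cast
    rw [tangentialCR_div_const _ hre.neg _ hζ, h1, neg_neg]
  have e3 : tangentialCR (fun ζ => ((cut (‖ζ.1‖ ^ 2 / N ^ 2) : ℝ) : ℂ)) ζ =
      ((deriv cut (‖ζ.1‖ ^ 2 / N ^ 2) : ℝ) : ℂ) * (ζ.1 / N ^ 2) := by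
    rw [tangentialCR_cut_comp r3]
    simp only [Complex.ofReal_div]
    rw [tangentialCR_div_const _ hn _ hζ, tangentialCR_normSq_fst]
    push_cast; rfl
  have d1 := (contDiff_cut_comp r1).differentiable (by simp) ζ
  have d2 := (contDiff_cut_comp r2).differentiable (by simp) ζ
  have d3 := (contDiff_cut_comp r3).differentiable (by simp) ζ
  have e := isDbarOp_tangentialCR.mul _ _ ζ (d1.fun_mul d2) d3
  have e' := isDbarOp_tangentialCR.mul _ _ ζ d1 d2
  rw [e', e1, e2, e3] at e
  refine (congrArg norm e).trans_le ?_
  -- Outside the support in `ζ₁`, where `|ζ₁|` is not bounded by `2N`, the derivative vanishes.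
  by_cases hbig : 2 * (N : ℝ) ^ 2 < ‖ζ.1‖ ^ 2
  · have h2 : 2 < ‖ζ.1‖ ^ 2 / (N : ℝ) ^ 2 := by rw [lt_div_iff₀ (by positivity)]; exact hbig
    have h3 : deriv cut (‖ζ.1‖ ^ 2 / (N : ℝ) ^ 2) = 0 := by
      rw [← iteratedDeriv_one]; exact iteratedDeriv_cut_eq_zero h2
    rw [cut_eq_zero h2.le, h3]
    simp; linarith
  · have hb : ‖ζ.1‖ / (N : ℝ) ^ 2 ≤ 2 := by
      push Not at hbig
      rw [div_le_iff₀ (by positivity)]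
      have : ‖ζ.1‖ ≤ 2 * N := abs_le_of_sq_le_sq' (by nlinarith) (by positivity) |>.2
      nlinarith
    have hD : ∀ x : ℝ, ‖((deriv cut x : ℝ) : ℂ)‖ ≤ C := fun x => by
      rw [Complex.norm_real]; exact hC x
    have m1 : ‖((deriv cut (ζ.2.re / N ^ 2) : ℝ) : ℂ) * (-(Complex.I * ζ.1) / N ^ 2)‖ ≤ C * 2 := by
      rw [norm_mul, norm_div, norm_neg, norm_mul, Complex.norm_I, one_mul, norm_pow,
        Complex.norm_natCast]
      exact mul_le_mul (hD _) hb (by positivity) hC0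
    have m2 : ‖((deriv cut (-ζ.2.re / N ^ 2) : ℝ) : ℂ) * (Complex.I * ζ.1 / N ^ 2)‖ ≤ C * 2 := by
      rw [norm_mul, norm_div, norm_mul, Complex.norm_I, one_mul, norm_pow,
        Complex.norm_natCast]
      exact mul_le_mul (hD _) hb (by positivity) hC0
    have m3 : ‖((deriv cut (‖ζ.1‖ ^ 2 / N ^ 2) : ℝ) : ℂ) * (ζ.1 / N ^ 2)‖ ≤ C * 2 := by
      rw [norm_mul, norm_div, norm_pow, Complex.norm_natCast]
      exact mul_le_mul (hD _) hb (by positivity) hC0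
    have hc2 : 0 ≤ C * 2 := by linarith
    have n12 : ‖((deriv cut (ζ.2.re / N ^ 2) : ℝ) : ℂ) * (-(Complex.I * ζ.1) / N ^ 2) *
        ((cut (-ζ.2.re / N ^ 2) : ℝ) : ℂ) + ((cut (ζ.2.re / N ^ 2) : ℝ) : ℂ) *
        (((deriv cut (-ζ.2.re / N ^ 2) : ℝ) : ℂ) * (Complex.I * ζ.1 / N ^ 2))‖ ≤ C * 2 + C * 2 := by
      refine (norm_add_le _ _).trans (add_le_add ?_ ?_)
      · rw [norm_mul]
        simpa using mul_le_mul m1 (norm_cut_le_one _) (norm_nonneg _) hc2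
      · rw [norm_mul]
        simpa using mul_le_mul (norm_cut_le_one _) m2 (norm_nonneg _) zero_le_one
    refine (norm_add_le _ _).trans ?_
    have k1 := mul_le_mul n12 (norm_cut_le_one (‖ζ.1‖ ^ 2 / N ^ 2)) (norm_nonneg _) (by linarith)
    have k2 := mul_le_mul (mul_le_one₀ (norm_cut_le_one (ζ.2.re / N ^ 2)) (norm_nonneg _)
      (norm_cut_le_one (-ζ.2.re / N ^ 2))) m3 (norm_nonneg _) zero_le_one
    rw [← norm_mul] at k1
    rw [← norm_mul, ← norm_mul] at k2
    linarith

/-- Integration by parts for `∂/∂ζ̄₁ - 2i ζ₁ ∂/∂ζ̄₂`, without boundary terms. -/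
theorem integral_mul_tangentialCR_eq_zero {F Θ : ℂ × ℂ → ℂ}
    (hF : ContDiffOn ℝ (⊤ : ℕ∞) F D2) (hF2 : MemLp F 2 (volume.restrict D2))
    (hPF : ∀ ζ ∈ D2, tangentialCR F ζ = 0) (hΘ : ContDiffOn ℝ (⊤ : ℕ∞) Θ D2)
    (hΘ2 : MemLp Θ 2 (volume.restrict D2)) (hPΘ2 : MemLp (tangentialCR Θ) 2 (volume.restrict D2)) :
    ∫ ζ in D2, F ζ * tangentialCR Θ ζ = 0 := by
  obtain ⟨C, hC0, hC⟩ := tangentialCR_cutHor_bounded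
  refine isParts_tangentialCR.integral_mul_iterate_eq_zero 1 hF hF2 hPF hΘ
    (b := fun ζ => ‖tangentialCR Θ ζ‖ + C * ‖Θ ζ‖) (hPΘ2.norm.add (hΘ2.norm.const_mul C))
    fun N hN ζ hζ => ?_
  have dR := (contDiff_cutRho N).differentiable (by simp) ζ
  have dH := (contDiff_cutHor N).differentiable (by simp) ζ
  have e1 := isDbarOp_tangentialCR.mul Θ (cutoff N) ζ (ContDiffOn.differentiableAt_D2 hΘ hζ)
    (dR.mul dH)
  have e2 := isDbarOp_tangentialCR.mul (cutRho N) (cutHor N) ζ dR dH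
  have e3 : tangentialCR (cutoff N) ζ = cutRho N ζ * tangentialCR (cutHor N) ζ := by
    refine e2.trans ?_
    rw [tangentialCR_cutRho N hζ]; simp
  rw [Function.iterate_one, e1, e3]
  have hc1 : ‖cutoff N ζ‖ ≤ 1 := by
    rw [cutoff, norm_mul]
    exact mul_le_one₀ (norm_cutRho_le_one N ζ) (norm_nonneg _) (norm_cutHor_le_one N ζ)
  refine (norm_add_le _ _).trans (add_le_add ?_ ?_)
  · rw [norm_mul]
    exact mul_le_of_le_one_right (norm_nonneg _) hc1
  · rw [norm_mul, norm_mul, mul_comm]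
    refine mul_le_mul_of_nonneg_right ?_ (norm_nonneg _)
    simpa using mul_le_mul (norm_cutRho_le_one N ζ) (hC N hN ζ hζ) (norm_nonneg _) zero_le_one

/-! ### Testing against tensor products -/

section TensorTest
variable {α β : Type*} [MeasurableSpace α] [MeasurableSpace β] {μ : Measure α} {ν : Measure β}
  [SigmaFinite μ] [SigmaFinite ν]

theorem norm_tensorFun (f : Lp ℂ 2 μ) (g : Lp ℂ 2 ν) : ‖tensorFun f g‖ = ‖f‖ * ‖g‖ := by
  rw [← tensorEmb_tmul, norm_tensorEmb, TensorProduct.norm_tmul]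

/-- The operator `f ↦ f ⊗ g`. -/
def tensorLeft (g : Lp ℂ 2 ν) : Lp ℂ 2 μ →L[ℂ] Lp ℂ 2 (μ.prod ν) :=
  LinearMap.mkContinuous (tensorEmb μ ν ∘ₗ (TensorProduct.mk ℂ _ _).flip g) ‖g‖ fun f =>
    ((norm_tensorFun f g).trans (mul_comm _ _)).le

/-- The operator `g ↦ f ⊗ g`. -/
def tensorRight (f : Lp ℂ 2 μ) : Lp ℂ 2 ν →L[ℂ] Lp ℂ 2 (μ.prod ν) :=
  LinearMap.mkContinuous (tensorEmb μ ν ∘ₗ (TensorProduct.mk ℂ _ _) f) ‖f‖ fun g =>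
    (norm_tensorFun f g).le

/-- A closed subspace that contains the tensors `f ⊗ g` is the whole space. -/
theorem mem_of_tensorFun_mem (K : Submodule ℂ (Lp ℂ 2 (μ.prod ν)))
    (hK : IsClosed (K : Set (Lp ℂ 2 (μ.prod ν)))) (h : ∀ f g, tensorFun f g ∈ K)
    (x : Lp ℂ 2 (μ.prod ν)) : x ∈ K := by
  have hr : Set.range (tensorEmb μ ν) ⊆ K := by
    rintro _ ⟨y, rfl⟩
    induction y with
    | zero => simp
    | add a b ha hb => rw [map_add]; exact K.add_mem ha hb
    | tmul f g => exact h f g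
  have := closure_minimal hr hK
  rw [(denseRange_tensorEmb (μ := μ) (ν := ν)).closure_range] at this
  exact this (mem_univ x)

theorem isClosed_orthogonal_comap {E F : Type*} [NormedAddCommGroup E] [InnerProductSpace ℂ E]
    [NormedAddCommGroup F] [InnerProductSpace ℂ F] (T : E →L[ℂ] F) (x : F) :
    IsClosed (((ℂ ∙ x)ᗮ.comap T.toLinearMap : Submodule ℂ E) : Set E) :=
  (Submodule.isClosed_orthogonal _).preimage T.continuous

theorem mem_orthogonal_comap {E F : Type*} [NormedAddCommGroup E] [InnerProductSpace ℂ E]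
    [NormedAddCommGroup F] [InnerProductSpace ℂ F] (T : E →L[ℂ] F) (x : F) (e : E) :
    e ∈ ((ℂ ∙ x)ᗮ.comap T.toLinearMap : Submodule ℂ E) ↔ inner ℂ (T e) x = 0 := by
  rw [Submodule.mem_comap, Submodule.mem_orthogonal_singleton_iff_inner_left]
  rfl

theorem eq_zero_of_inner_tensorFun {x : Lp ℂ 2 (μ.prod ν)}
    (h : ∀ f g, inner ℂ (tensorFun f g) x = 0) : x = 0 := by
  have := mem_of_tensorFun_mem _ (isClosed_orthogonal_comap (ContinuousLinearMap.id ℂ _) x)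
    (fun f g => (mem_orthogonal_comap _ _ _).2 (h f g)) x
  exact inner_self_eq_zero.1 ((mem_orthogonal_comap _ _ _).1 this)

end TensorTest

/-- The product `a(u₁) b(v₁) c(u₂) d(v₂)` in `L²(𝒟)`. -/
def tensor4 (a b c : Lp ℂ 2 (volume : Measure ℝ)) (d : Lp ℂ 2 volPos) : L2Flat :=
  tensorFun (tensorFun a b) (tensorFun c d)

theorem tensor4_ae (a b c : Lp ℂ 2 (volume : Measure ℝ)) (d : Lp ℂ 2 volPos) :
    tensor4 a b c d =ᵐ[flatMeasure] fun w => a w.1.1 * b w.1.2 * (c w.2.1 * d w.2.2) := by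
  refine (tensorFun_ae _ _).trans ?_
  filter_upwards [(Measure.quasiMeasurePreserving_fst (μ := (volume : Measure ℝ).prod volume)
      (ν := (volume : Measure ℝ).prod volPos)).ae_eq_comp (tensorFun_ae a b),
    (Measure.quasiMeasurePreserving_snd (μ := (volume : Measure ℝ).prod volume)
      (ν := (volume : Measure ℝ).prod volPos)).ae_eq_comp (tensorFun_ae c d)] with w h1 h2
  simp only [Function.comp] at h1 h2
  rw [h1, h2]

theorem opU1_tensor4 (a b c : Lp ℂ 2 (volume : Measure ℝ)) (d : Lp ℂ 2 volPos) :
    opU1 (tensor4 a b c d) = tensor4 (fourierL2 a) b (fourierL2 c) d := by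
  rw [tensor4, opU1, tensorOp_apply, tensorOp_apply, tensorOp_apply]
  rfl

/-- The products `a ⊗ b ⊗ c ⊗ d`, where `a` and `c` run through a dense set, span a dense subspace
of `L²(𝒟)`. -/
theorem eq_zero_of_inner_tensor4 {S : Set (Lp ℂ 2 (volume : Measure ℝ))} (hS : Dense S)
    {x : L2Flat} (h : ∀ a ∈ S, ∀ b, ∀ c ∈ S, ∀ d, inner ℂ (tensor4 a b c d) x = 0) : x = 0 := by
  -- The conditions on `a` and on `c` are removed one after the other, by continuity.
  have h1 : ∀ a, ∀ b, ∀ c ∈ S, ∀ d, inner ℂ (tensor4 a b c d) x = 0 := by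
    intro a b c hc d
    let T := (tensorLeft (tensorFun c d)).comp (tensorLeft (μ := (volume : Measure ℝ)) b)
    have hcl := isClosed_orthogonal_comap T x
    have hsub : S ⊆ (((ℂ ∙ x)ᗮ.comap T.toLinearMap : Submodule ℂ _) : Set _) := fun a ha =>
      (mem_orthogonal_comap T x a).2 (h a ha b c hc d)
    have := closure_minimal hsub hcl
    rw [hS.closure_eq] at this
    exact (mem_orthogonal_comap T x a).1 (this (mem_univ a))
  have h2 : ∀ a b c d, inner ℂ (tensor4 a b c d) x = 0 := by
    intro a b c d
    let T := (tensorRight (tensorFun a b)).comp (tensorLeft (μ := (volume : Measure ℝ)) d)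
    have hcl := isClosed_orthogonal_comap T x
    have hsub : S ⊆ (((ℂ ∙ x)ᗮ.comap T.toLinearMap : Submodule ℂ _) : Set _) := fun c hc =>
      (mem_orthogonal_comap T x c).2 (h1 a b c hc d)
    have := closure_minimal hsub hcl
    rw [hS.closure_eq] at this
    exact (mem_orthogonal_comap T x c).1 (this (mem_univ c))
  refine eq_zero_of_inner_tensorFun fun p q => ?_
  have h3 : ∀ a b q, inner ℂ (tensorFun (tensorFun a b) q) x = 0 := fun a b q =>
    (mem_orthogonal_comap (tensorRight (tensorFun a b)) x q).1
      (mem_of_tensorFun_mem _ (isClosed_orthogonal_comap (tensorRight (tensorFun a b)) x)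
        (fun c d => (mem_orthogonal_comap _ x _).2 (h2 a b c d)) q)
  exact (mem_orthogonal_comap (tensorLeft q) x p).1
    (mem_of_tensorFun_mem _ (isClosed_orthogonal_comap (tensorLeft q) x)
      (fun a b => (mem_orthogonal_comap _ x _).2 (h3 a b q)) p)

/-- `((x₁, y₁), (x₂, y₂)) ↦ ((x₁, x₂), (y₁, y₂))` as an equivalence. -/
def rearrangeEquiv : (ℝ × ℝ) × (ℝ × ℝ) ≃ᵐ (ℝ × ℝ) × (ℝ × ℝ) where
  toFun := rearrange
  invFun := rearrange
  left_inv _ := rfl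
  right_inv _ := rfl
  measurable_toFun := by change Measurable rearrange; unfold rearrange; fun_prop
  measurable_invFun := by change Measurable rearrange; unfold rearrange; fun_prop

theorem integral_rearrange (f : (ℝ × ℝ) × (ℝ × ℝ) → ℂ) :
    ∫ w, f (rearrange w) ∂flatMeasure =
      ∫ y, f y ∂(((volume : Measure ℝ).prod volume).prod halfMeasure) :=
  measurePreserving_rearrange.integral_comp rearrangeEquiv.measurableEmbedding f

theorem integrable_rearrange_iff {f : (ℝ × ℝ) × (ℝ × ℝ) → ℂ} :
    Integrable (fun w => f (rearrange w)) flatMeasure ↔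
      Integrable f (((volume : Measure ℝ).prod volume).prod halfMeasure) :=
  measurePreserving_rearrange.integrable_comp_emb rearrangeEquiv.measurableEmbedding

/-- Fubini's theorem on `𝒟` in the form `∫ dv₁ dv₂ ∫ du₁ du₂`. -/
theorem integral_flat_eq {f : (ℝ × ℝ) × (ℝ × ℝ) → ℂ} (hf : Integrable f flatMeasure) :
    ∫ w, f w ∂flatMeasure = ∫ X, ∫ T, f ((T.1, X.1), (T.2, X.2))
      ∂((volume : Measure ℝ).prod volume) ∂halfMeasure := by
  have h1 := integral_rearrange (fun y => f (rearrange y))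
  have hi : Integrable (fun y => f (rearrange y))
      (((volume : Measure ℝ).prod volume).prod halfMeasure) := integrable_rearrange_iff.1 hf
  rw [integral_prod_symm _ hi] at h1
  exact h1

theorem ae_ae_of_ae_flat {p : (ℝ × ℝ) × (ℝ × ℝ) → Prop} (h : ∀ᵐ w ∂flatMeasure, p w) :
    ∀ᵐ X ∂halfMeasure, ∀ᵐ T ∂((volume : Measure ℝ).prod volume), p ((T.1, X.1), (T.2, X.2)) := by
  have h1 : ∀ᵐ y ∂(((volume : Measure ℝ).prod volume).prod halfMeasure), p (rearrange y) := by
    rw [← measurePreserving_rearrange.map_eq]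
    exact (rearrangeEquiv.measurableEmbedding.ae_map_iff (μ := flatMeasure)).2 h
  exact Measure.ae_ae_of_ae_prod
    ((Measure.measurePreserving_swap (μ := halfMeasure)
      (ν := (volume : Measure ℝ).prod volume)).quasiMeasurePreserving.ae h1)

/-! ### The partial Fourier transform of concrete functions -/

/-- Lebesgue measure on the plane of the frequency variables. -/
abbrev planeMeasure : Measure (ℝ × ℝ) := (volume : Measure ℝ).prod volume

theorem conj_fourierL2_schwartz (a : SchwartzMap ℝ ℂ) :
    (fun t => (starRingEnd ℂ) (fourierL2 (a.toLp 2) t)) =ᵐ[volume] fun t =>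
      ((1 / √(2 * Real.pi) : ℝ) : ℂ) *
        ∫ x, (starRingEnd ℂ) (a x) * Complex.exp (Complex.I * (t * x)) := by
  filter_upwards [fourierL2_schwartz a] with t ht
  rw [ht, map_mul, Complex.conj_ofReal, ← integral_conj]
  congr 1
  refine integral_congr_ae (Eventually.of_forall fun x => ?_)
  simp only [map_mul]
  rw [← Complex.exp_conj]
  congr 2
  simp; ring

theorem integrable_mul_exp_I {α : Type*} [MeasurableSpace α] {μ : Measure α} {g : α → ℂ}
    (hg : Integrable g μ) {φ : α → ℝ} (hφ : AEMeasurable φ μ) :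
    Integrable (fun x => g x * Complex.exp (Complex.I * φ x)) μ := by
  refine hg.mul_bdd (c := 1) (by fun_prop) (Eventually.of_forall fun x => ?_)
  rw [mul_comm, Complex.norm_exp_ofReal_mul_I]

/-- The two-dimensional Fourier transform is symmetric. -/
theorem integral_conj_fourierL2_mul (a c : SchwartzMap ℝ ℂ) {g : ℝ × ℝ → ℂ}
    (hg : Integrable g planeMeasure) :
    ∫ T, (starRingEnd ℂ) (fourierL2 (a.toLp 2) T.1) *
        (starRingEnd ℂ) (fourierL2 (c.toLp 2) T.2) * g T ∂planeMeasure =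
      ∫ U : ℝ × ℝ, (starRingEnd ℂ) (a U.1) * (starRingEnd ℂ) (c U.2) *
        ((1 / (2 * Real.pi) : ℝ) * ∫ T : ℝ × ℝ, g T *
          Complex.exp (Complex.I * ((T.1 * U.1 + T.2 * U.2 : ℝ) : ℂ)) ∂planeMeasure) ∂planeMeasure := by
  set h : ℝ × ℝ → ℂ := fun U => (starRingEnd ℂ) (a U.1) * (starRingEnd ℂ) (c U.2) with hh
  have ia : Integrable (fun x => (starRingEnd ℂ) (a x)) (volume : Measure ℝ) :=
    (Complex.conjCLE : ℂ →L[ℝ] ℂ).integrable_comp a.integrable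
  have ic : Integrable (fun x => (starRingEnd ℂ) (c x)) (volume : Measure ℝ) :=
    (Complex.conjCLE : ℂ →L[ℝ] ℂ).integrable_comp c.integrable
  have hi : Integrable h planeMeasure := ia.mul_prod ic
  have e1 : ∀ᵐ T ∂planeMeasure, (starRingEnd ℂ) (fourierL2 (a.toLp 2) T.1) *
      (starRingEnd ℂ) (fourierL2 (c.toLp 2) T.2) * g T = (1 / (2 * Real.pi) : ℝ) *
      ∫ U : ℝ × ℝ, h U * g T *
        Complex.exp (Complex.I * ((T.1 * U.1 + T.2 * U.2 : ℝ) : ℂ)) ∂planeMeasure := by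
    filter_upwards [(Measure.quasiMeasurePreserving_fst (μ := (volume : Measure ℝ))
        (ν := (volume : Measure ℝ))).ae (conj_fourierL2_schwartz a),
      (Measure.quasiMeasurePreserving_snd (μ := (volume : Measure ℝ))
        (ν := (volume : Measure ℝ))).ae (conj_fourierL2_schwartz c)] with T h1 h2
    rw [h1, h2]
    have hs : (((1 / √(2 * Real.pi) : ℝ) : ℂ)) * ((1 / √(2 * Real.pi) : ℝ) : ℂ) =
        ((1 / (2 * Real.pi) : ℝ) : ℂ) := by
      rw [← Complex.ofReal_mul, div_mul_div_comm, one_mul, Real.mul_self_sqrt (by positivity)]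
    have e : ∀ U : ℝ × ℝ, h U * g T * Complex.exp (Complex.I * ((T.1 * U.1 + T.2 * U.2 : ℝ) : ℂ)) =
        g T * (((starRingEnd ℂ) (a U.1) * Complex.exp (Complex.I * (T.1 * U.1))) *
        ((starRingEnd ℂ) (c U.2) * Complex.exp (Complex.I * (T.2 * U.2)))) := by
      intro U
      have : Complex.exp (Complex.I * ((T.1 * U.1 + T.2 * U.2 : ℝ) : ℂ)) =
          Complex.exp (Complex.I * (T.1 * U.1)) * Complex.exp (Complex.I * (T.2 * U.2)) := by
        rw [← Complex.exp_add]; congr 1; push_cast; ring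
      rw [this, hh]; ring
    simp only [e]
    rw [integral_const_mul, integral_prod_mul
      (f := fun x : ℝ => (starRingEnd ℂ) (a x) * Complex.exp (Complex.I * (T.1 * x)))
      (g := fun x : ℝ => (starRingEnd ℂ) (c x) * Complex.exp (Complex.I * (T.2 * x))), ← hs]
    ring
  rw [integral_congr_ae e1, integral_const_mul, integral_integral_swap]
  · rw [← integral_const_mul]
    refine integral_congr_ae (Eventually.of_forall fun U => ?_)
    simp only
    rw [← mul_assoc, mul_comm (h U), mul_assoc, ← integral_const_mul (h U)]
    simp only [mul_assoc]
  · have := integrable_mul_exp_I (hg.mul_prod hi)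
      (φ := fun z : (ℝ × ℝ) × (ℝ × ℝ) => z.1.1 * z.2.1 + z.1.2 * z.2.2) (by fun_prop)
    refine this.congr (Eventually.of_forall fun z => ?_)
    simp only [Function.uncurry]
    ring

theorem ae_flat_snd_pos : ∀ᵐ w : (ℝ × ℝ) × (ℝ × ℝ) ∂flatMeasure, 0 < w.2.2 :=
  (Measure.quasiMeasurePreserving_snd (μ := (volume : Measure ℝ).prod volume)
    (ν := (volume : Measure ℝ).prod volPos)).ae ae_snd_pos

theorem aestronglyMeasurable_of_continuousOn_flat {G : (ℝ × ℝ) × (ℝ × ℝ) → ℂ}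
    (hc : ContinuousOn G {w | 0 < w.2.2}) : AEStronglyMeasurable G flatMeasure := by
  have hS : MeasurableSet {w : (ℝ × ℝ) × (ℝ × ℝ) | 0 < w.2.2} :=
    (isOpen_lt continuous_const (by fun_prop)).measurableSet
  have := hc.aestronglyMeasurable (μ := flatMeasure) hS
  rwa [Measure.restrict_eq_self_of_ae_mem (s := {w : (ℝ × ℝ) × (ℝ × ℝ) | 0 < w.2.2})
    ae_flat_snd_pos] at this

theorem inner_tensor4_opU1_symm (a b c : Lp ℂ 2 (volume : Measure ℝ)) (d : Lp ℂ 2 volPos)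
    (y : L2Flat) : inner ℂ (tensor4 a b c d) (opU1.symm y) =
      inner ℂ (tensor4 (fourierL2 a) b (fourierL2 c) d) y := by
  rw [← opU1_tensor4, LinearIsometryEquiv.inner_map_eq_flip]

theorem inner_tensor4 (a b c : Lp ℂ 2 (volume : Measure ℝ)) (d : Lp ℂ 2 volPos)
    (y : L2Flat) : inner ℂ (tensor4 a b c d) y =
      ∫ w, (starRingEnd ℂ) (a w.1.1 * b w.1.2 * (c w.2.1 * d w.2.2)) * y w ∂flatMeasure ∧
    Integrable (fun w => (starRingEnd ℂ) (a w.1.1 * b w.1.2 * (c w.2.1 * d w.2.2)) * y w)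
      flatMeasure := by
  have e1 : ∀ᵐ w ∂flatMeasure, inner ℂ (tensor4 a b c d w) (y w) =
      (starRingEnd ℂ) (a w.1.1 * b w.1.2 * (c w.2.1 * d w.2.2)) * y w := by
    filter_upwards [tensor4_ae a b c d] with w h1
    rw [h1, RCLike.inner_apply, mul_comm]
  exact ⟨by rw [L2.inner_def, integral_congr_ae e1],
    (L2.integrable_inner (𝕜 := ℂ) (tensor4 a b c d) y).congr e1⟩

/-- The relation between the slices of `Gh` and of `G'`, at fixed second and fourth coordinates: the
slices of `Gh` are integrable, and those of `G'` are their inverse Fourier transforms. No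
square integrability is assumed. -/
def SliceFourier (Gh G' : (ℝ × ℝ) × (ℝ × ℝ) → ℂ) : Prop :=
  ∀ᵐ X ∂halfMeasure,
    Integrable (fun T : ℝ × ℝ => Gh ((T.1, X.1), (T.2, X.2))) planeMeasure ∧
    ∀ U : ℝ × ℝ, G' ((U.1, X.1), (U.2, X.2)) = (1 / (2 * Real.pi) : ℝ) *
      ∫ T : ℝ × ℝ, Gh ((T.1, X.1), (T.2, X.2)) *
        Complex.exp (Complex.I * ((T.1 * U.1 + T.2 * U.2 : ℝ) : ℂ)) ∂planeMeasure

/-- Against tensors whose first and third factor are Schwartz functions, `G'` has the same pairings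
as `U₁⁻¹ y`, where `y = Gh`: Fubini's theorem reduces this to the symmetry of the Fourier transform
on the slices. -/
theorem SliceFourier.pairing {Gh G' : (ℝ × ℝ) × (ℝ × ℝ) → ℂ} (h : SliceFourier Gh G')
    {y : L2Flat} (hy : y =ᵐ[flatMeasure] Gh) (a c : SchwartzMap ℝ ℂ)
    (b : Lp ℂ 2 (volume : Measure ℝ)) (d : Lp ℂ 2 volPos)
    (hi : Integrable (fun w => (starRingEnd ℂ) (a w.1.1 * b w.1.2 * (c w.2.1 * d w.2.2)) * G' w)
      flatMeasure) :
    ∫ w, (starRingEnd ℂ) (a w.1.1 * b w.1.2 * (c w.2.1 * d w.2.2)) * G' w ∂flatMeasure =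
      inner ℂ (tensor4 (a.toLp 2) b (c.toLp 2) d) (opU1.symm y) := by
  obtain ⟨e2, i2⟩ := inner_tensor4 (fourierL2 (a.toLp 2)) b (fourierL2 (c.toLp 2)) d y
  rw [inner_tensor4_opU1_symm, e2, integral_flat_eq i2, integral_flat_eq hi]
  refine integral_congr_ae ?_
  filter_upwards [h, ae_ae_of_ae_flat hy] with X hX hyX
  have h1 := integral_conj_fourierL2_mul a c hX.1
  have h2 := ((integral_const_mul ((starRingEnd ℂ) (b X.1 * d X.2)) _).trans
    (congrArg (fun z => (starRingEnd ℂ) (b X.1 * d X.2) * z) h1)).trans (integral_const_mul _ _).symm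
  refine Eq.trans ?_ (h2.symm.trans ?_)
  · refine integral_congr_ae (Eventually.of_forall fun U => ?_)
    simp only
    rw [hX.2 U]
    simp only [map_mul]
    ring
  · refine integral_congr_ae ?_
    filter_upwards [hyX] with T hT
    simp only [map_mul, hT]
    ring

theorem flatMeasure_box_lt_top (a b c d : ℝ) :
    flatMeasure ((Icc a b ×ˢ Icc a b) ×ˢ (Icc a b ×ˢ Icc c d)) < ∞ := by
  rw [Measure.prod_prod, Measure.prod_prod, Measure.prod_prod]
  have h1 : (volume : Measure ℝ) (Icc a b) < ∞ := isCompact_Icc.measure_lt_top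
  have h2 : volPos (Icc c d) < ∞ :=
    (Measure.restrict_apply_le _ _).trans_lt isCompact_Icc.measure_lt_top
  exact ENNReal.mul_lt_top (ENNReal.mul_lt_top h1 h1) (ENNReal.mul_lt_top h1 h2)

/-- An element `G0` of `L²(𝒟)` and a function `G'` with the same pairings against the tensors agree
after multiplication by a weight `m` of product form for which `m G'` is square integrable: the
weight is moved to the test tensors, which form a dense family. -/
theorem ae_eq_mul_of_pairing {G0 : L2Flat} {G' : (ℝ × ℝ) × (ℝ × ℝ) → ℂ}
    (key : ∀ (a c : SchwartzMap ℝ ℂ) (b : Lp ℂ 2 (volume : Measure ℝ)) (d : Lp ℂ 2 volPos),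
      Integrable (fun w => (starRingEnd ℂ) (a w.1.1 * b w.1.2 * (c w.2.1 * d w.2.2)) * G' w)
        flatMeasure →
      ∫ w, (starRingEnd ℂ) (a w.1.1 * b w.1.2 * (c w.2.1 * d w.2.2)) * G' w ∂flatMeasure =
        inner ℂ (tensor4 (a.toLp 2) b (c.toLp 2) d) G0)
    {β : ℝ → ℝ} (hβ : (fun x => ((β x : ℝ) : ℂ)).HasTemperateGrowth) (hβ1 : ∀ x, |β x| ≤ 1)
    {I J : Set ℝ} (hI : MeasurableSet I) (hJ : MeasurableSet J)
    {m : (ℝ × ℝ) × (ℝ × ℝ) → ℝ} (hm : ∀ w, m w =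
      β w.1.1 * I.indicator 1 w.1.2 * (β w.2.1 * J.indicator 1 w.2.2))
    (hL2 : MemLp (fun w => (m w : ℂ) * G' w) 2 flatMeasure) :
    ∀ᵐ w ∂flatMeasure, (m w : ℂ) * G0 w = m w * G' w := by
  have hβm : Measurable β := by
    have h := hβ.1.continuous.measurable
    have h2 := Complex.measurable_re.comp h
    exact h2
  have hmm : Measurable m := by
    have h1 : Measurable (I.indicator (1 : ℝ → ℝ)) := measurable_one.indicator hI
    have h2 : Measurable (J.indicator (1 : ℝ → ℝ)) := measurable_one.indicator hJ
    rw [funext hm]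
    fun_prop
  have hm1 : ∀ w, |m w| ≤ 1 := by
    intro w
    have i1 : ∀ (I : Set ℝ) x, |I.indicator (1 : ℝ → ℝ) x| ≤ 1 := fun I x => by
      by_cases h : x ∈ I <;> simp [h]
    rw [hm, abs_mul, abs_mul, abs_mul]
    exact mul_le_one₀ (mul_le_one₀ (hβ1 _) (abs_nonneg _) (i1 _ _)) (by positivity)
      (mul_le_one₀ (hβ1 _) (abs_nonneg _) (i1 _ _))
  have hL2' : MemLp (fun w => (m w : ℂ) * G0 w) 2 flatMeasure := by
    refine (Lp.memLp G0).mono ((Complex.measurable_ofReal.comp hmm).aestronglyMeasurable.mul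
      (Lp.memLp G0).1) (Eventually.of_forall fun w => ?_)
    rw [norm_mul, Complex.norm_real]
    exact mul_le_of_le_one_left (norm_nonneg _) (hm1 w)
  obtain ⟨y1, hy1⟩ : ∃ y : L2Flat, y =ᵐ[flatMeasure] fun w => (m w : ℂ) * G0 w :=
    ⟨hL2'.toLp _, hL2'.coeFn_toLp⟩
  obtain ⟨y2, hy2⟩ : ∃ y : L2Flat, y =ᵐ[flatMeasure] fun w => (m w : ℂ) * G' w :=
    ⟨hL2.toLp _, hL2.coeFn_toLp⟩
  have hzero : y1 - y2 = 0 := by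
    refine eq_zero_of_inner_tensor4 (S := Set.range (SchwartzMap.toLpCLM ℝ (E := ℝ) ℂ 2 volume))
      (SchwartzMap.denseRange_toLpCLM (F := ℂ) (E := ℝ) (p := 2) (μ := volume)
        ENNReal.ofNat_ne_top)
      ?_
    rintro _ ⟨a, rfl⟩ b _ ⟨c, rfl⟩ d
    rw [SchwartzMap.toLpCLM_apply, SchwartzMap.toLpCLM_apply]
    set A := SchwartzMap.smulLeftCLM ℂ (fun x => ((β x : ℝ) : ℂ)) a with hA
    set C := SchwartzMap.smulLeftCLM ℂ (fun x => ((β x : ℝ) : ℂ)) c with hC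
    have hAe : ∀ x, A x = β x * a x := fun x => by
      rw [hA, SchwartzMap.smulLeftCLM_apply_apply hβ]; rfl
    have hCe : ∀ x, C x = β x * c x := fun x => by
      rw [hC, SchwartzMap.smulLeftCLM_apply_apply hβ]; rfl
    obtain ⟨A', eA', hA'⟩ : ∃ y : Lp ℂ 2 (volume : Measure ℝ), SchwartzMap.toLp A 2 volume = y ∧
        y =ᵐ[volume] A := ⟨_, rfl, SchwartzMap.coeFn_toLp A 2 volume⟩
    obtain ⟨a', ea', ha'⟩ : ∃ y : Lp ℂ 2 (volume : Measure ℝ), SchwartzMap.toLp a 2 volume = y ∧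
        y =ᵐ[volume] a := ⟨_, rfl, SchwartzMap.coeFn_toLp a 2 volume⟩
    obtain ⟨C', eC', hC'⟩ : ∃ y : Lp ℂ 2 (volume : Measure ℝ), SchwartzMap.toLp C 2 volume = y ∧
        y =ᵐ[volume] C := ⟨_, rfl, SchwartzMap.coeFn_toLp C 2 volume⟩
    obtain ⟨c', ec', hc'⟩ : ∃ y : Lp ℂ 2 (volume : Measure ℝ), SchwartzMap.toLp c 2 volume = y ∧
        y =ᵐ[volume] c := ⟨_, rfl, SchwartzMap.coeFn_toLp c 2 volume⟩
    rw [ea', ec']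
    have mB : MemLp (I.indicator (b : ℝ → ℂ)) 2 (volume : Measure ℝ) := (Lp.memLp b).indicator hI
    have mD : MemLp (J.indicator (d : ℝ → ℂ)) 2 volPos := (Lp.memLp d).indicator hJ
    obtain ⟨B, hB⟩ : ∃ y : Lp ℂ 2 (volume : Measure ℝ), y =ᵐ[volume] I.indicator (b : ℝ → ℂ) :=
      ⟨mB.toLp _, mB.coeFn_toLp⟩
    obtain ⟨D, hD⟩ : ∃ y : Lp ℂ 2 volPos, y =ᵐ[volPos] J.indicator (d : ℝ → ℂ) :=
      ⟨mD.toLp _, mD.coeFn_toLp⟩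
    have q1 := Measure.quasiMeasurePreserving_fst (μ := (volume : Measure ℝ).prod (volume : Measure ℝ))
      (ν := (volume : Measure ℝ).prod volPos)
    have q2 := Measure.quasiMeasurePreserving_snd (μ := (volume : Measure ℝ).prod (volume : Measure ℝ))
      (ν := (volume : Measure ℝ).prod volPos)
    have q11 := (Measure.quasiMeasurePreserving_fst (μ := (volume : Measure ℝ))
      (ν := (volume : Measure ℝ))).comp q1
    have q12 := (Measure.quasiMeasurePreserving_snd (μ := (volume : Measure ℝ))
      (ν := (volume : Measure ℝ))).comp q1
    have q21 := (Measure.quasiMeasurePreserving_fst (μ := (volume : Measure ℝ))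
      (ν := volPos)).comp q2
    have q22 := (Measure.quasiMeasurePreserving_snd (μ := (volume : Measure ℝ))
      (ν := volPos)).comp q2
    have h4 : ∀ᵐ w ∂flatMeasure, A w.1.1 * B w.1.2 * (C w.2.1 * D w.2.2) =
        m w * (a w.1.1 * b w.1.2 * (c w.2.1 * d w.2.2)) := by
      filter_upwards [q12.ae hB, q22.ae hD] with w h1 h2
      simp only [Function.comp] at h1 h2
      rw [h1, h2, hAe, hCe, hm]
      by_cases hw1 : w.1.2 ∈ I <;> by_cases hw2 : w.2.2 ∈ J <;> simp [hw1, hw2]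
      ring
    have h4' : ∀ᵐ w ∂flatMeasure,
        A' w.1.1 * B w.1.2 * (C' w.2.1 * D w.2.2) =
        m w * (a' w.1.1 * b w.1.2 * (c' w.2.1 * d w.2.2)) := by
      filter_upwards [h4, q11.ae hA', q21.ae hC',
        q11.ae ha', q21.ae hc'] with w e e1 e2 e3 e4
      simp only [Function.comp] at e1 e2 e3 e4
      rw [e1, e2, e3, e4, e]
    have h5 : ∀ᵐ w ∂flatMeasure,
        a' w.1.1 * b w.1.2 * (c' w.2.1 * d w.2.2) =
        (a w.1.1 * b w.1.2 * (c w.2.1 * d w.2.2)) := by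
      filter_upwards [q11.ae ha', q21.ae hc']
        with w e3 e4
      simp only [Function.comp] at e3 e4
      rw [e3, e4]
    obtain ⟨x1, i1⟩ := inner_tensor4 a' b c' d y1
    obtain ⟨x2, i2⟩ := inner_tensor4 a' b c' d y2
    obtain ⟨x3, i3⟩ := inner_tensor4 A' B C' D G0
    have e2 : ∀ᵐ w ∂flatMeasure, (starRingEnd ℂ)
        (a' w.1.1 * b w.1.2 * (c' w.2.1 * d w.2.2)) * y2 w =
        (starRingEnd ℂ) (A w.1.1 * B w.1.2 * (C w.2.1 * D w.2.2)) * G' w := by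
      filter_upwards [h4, h5, hy2] with w e1 e2 e3
      rw [e1, e2, e3, map_mul (starRingEnd ℂ) (m w : ℂ), Complex.conj_ofReal]; ring
    have e1 : ∀ᵐ w ∂flatMeasure, (starRingEnd ℂ)
        (a' w.1.1 * b w.1.2 * (c' w.2.1 * d w.2.2)) * y1 w =
        (starRingEnd ℂ) (A' w.1.1 * B w.1.2 * (C' w.2.1 * D w.2.2))
          * G0 w := by
      filter_upwards [h4', hy1] with w e1 e3
      rw [e1, e3, map_mul (starRingEnd ℂ) (m w : ℂ), Complex.conj_ofReal]; ring
    have k := key A C B D (i2.congr e2)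
    rw [eA', eC'] at k
    rw [inner_sub_right, x1, x2, integral_congr_ae e1, integral_congr_ae e2, k, x3, sub_self]
  rw [sub_eq_zero] at hzero
  filter_upwards [hy1, hy2] with w h1 h2
  rw [← h1, ← h2, hzero]

/-- A continuous function with the same pairings as an element of `L²(𝒟)` agrees with it. The
function need not be square integrable a priori, so it is localized to the boxes `[-n, n]³ ×
[1/(n+1), n]` by a weight `m` with compact support, which is smooth in the first and third
coordinate, where the test functions are Schwartz functions. -/
theorem ae_eq_of_pairing {G0 : L2Flat} {G' : (ℝ × ℝ) × (ℝ × ℝ) → ℂ}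
    (hc : ContinuousOn G' {w | 0 < w.2.2})
    (key : ∀ (a c : SchwartzMap ℝ ℂ) (b : Lp ℂ 2 (volume : Measure ℝ)) (d : Lp ℂ 2 volPos),
      Integrable (fun w => (starRingEnd ℂ) (a w.1.1 * b w.1.2 * (c w.2.1 * d w.2.2)) * G' w)
        flatMeasure →
      ∫ w, (starRingEnd ℂ) (a w.1.1 * b w.1.2 * (c w.2.1 * d w.2.2)) * G' w ∂flatMeasure =
        inner ℂ (tensor4 (a.toLp 2) b (c.toLp 2) d) G0) :
    G0 =ᵐ[flatMeasure] G' := by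
  have hbox : ∀ n : ℕ, ∀ᵐ w ∂flatMeasure, |w.1.1| ≤ (n : ℝ) → |w.1.2| ≤ (n : ℝ) →
      |w.2.1| ≤ (n : ℝ) → 1 / ((n : ℝ) + 1) ≤ w.2.2 → w.2.2 ≤ (n : ℝ) → G0 w = G' w := by
    intro n
    let bump : ContDiffBump (0 : ℝ) := ⟨n + 1, n + 2, by positivity, by linarith⟩
    have hbs : ContDiff ℝ (⊤ : ℕ∞) fun x => ((bump x : ℝ) : ℂ) :=
      Complex.ofRealCLM.contDiff.comp bump.contDiff
    have hbg : (fun x => ((bump x : ℝ) : ℂ)).HasTemperateGrowth := by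
      have hcs : HasCompactSupport fun x => ((bump x : ℝ) : ℂ) :=
        bump.hasCompactSupport.comp_left (g := fun x : ℝ => (x : ℂ)) (by simp)
      exact hcs.hasTemperateGrowth hbs
    have hb1 : ∀ x, |bump x| ≤ 1 := fun x => by
      rw [abs_of_nonneg bump.nonneg]; exact bump.le_one
    set I : Set ℝ := Icc (-((n : ℝ) + 2)) (n + 2)
    set J : Set ℝ := Icc (1 / ((n : ℝ) + 1)) n
    set m : (ℝ × ℝ) × (ℝ × ℝ) → ℝ := fun w =>
      bump w.1.1 * I.indicator 1 w.1.2 * (bump w.2.1 * J.indicator 1 w.2.2) with hm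
    set K : Set ((ℝ × ℝ) × (ℝ × ℝ)) := (I ×ˢ I) ×ˢ (I ×ˢ J)
    have hKc : IsCompact K := (isCompact_Icc.prod isCompact_Icc).prod (isCompact_Icc.prod isCompact_Icc)
    have hmK : ∀ w, w ∉ K → m w = 0 := by
      intro w hw
      by_contra hne
      simp only [hm, mul_ne_zero_iff] at hne
      obtain ⟨⟨h1, h2⟩, h3, h4⟩ := hne
      have hb : ∀ x, bump x ≠ 0 → x ∈ I := by
        intro x hx
        have : x ∈ Metric.ball (0 : ℝ) (n + 2) := by
          have := bump.support_eq; rw [← this]; exact hx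
        rw [Metric.mem_ball, dist_zero_right, Real.norm_eq_abs, abs_lt] at this
        exact ⟨this.1.le, this.2.le⟩
      exact hw ⟨⟨hb _ h1, mem_of_indicator_ne_zero h2⟩, hb _ h3, mem_of_indicator_ne_zero h4⟩
    have hKpos : K ⊆ {w | 0 < w.2.2} := fun w hw =>
      (by positivity : (0 : ℝ) < 1 / (n + 1)).trans_le hw.2.2.1
    obtain ⟨C, hC⟩ := hKc.exists_bound_of_continuousOn (hc.mono hKpos)
    have hKfin : flatMeasure K < ∞ := flatMeasure_box_lt_top _ _ _ _
    have hmm : Measurable m := by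
      have h1 : Measurable (I.indicator (1 : ℝ → ℝ)) := measurable_one.indicator measurableSet_Icc
      have h2 : Measurable (J.indicator (1 : ℝ → ℝ)) := measurable_one.indicator measurableSet_Icc
      have h3 : Measurable bump := bump.continuous.measurable
      fun_prop
    have hm1 : ∀ w, |m w| ≤ 1 := by
      intro w
      have i1 : ∀ (I : Set ℝ) x, |I.indicator (1 : ℝ → ℝ) x| ≤ 1 := fun I x => by
        by_cases h : x ∈ I <;> simp [h]
      simp only [hm, abs_mul]
      exact mul_le_one₀ (mul_le_one₀ (hb1 _) (abs_nonneg _) (i1 _ _)) (by positivity)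
        (mul_le_one₀ (hb1 _) (abs_nonneg _) (i1 _ _))
    have hL2 : MemLp (fun w => (m w : ℂ) * G' w) 2 flatMeasure := by
      have e : (fun w => (m w : ℂ) * G' w) = K.indicator fun w => (m w : ℂ) * G' w := by
        funext w
        by_cases hw : w ∈ K
        · rw [indicator_of_mem hw]
        · rw [indicator_of_notMem hw, hmK w hw]; simp
      rw [e, memLp_indicator_iff_restrict hKc.measurableSet]
      have : IsFiniteMeasure (flatMeasure.restrict K) := ⟨by simpa using hKfin⟩
      refine MemLp.of_bound ?_ C ?_
      · exact ((Complex.measurable_ofReal.comp hmm).aestronglyMeasurable.mul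
          (aestronglyMeasurable_of_continuousOn_flat hc)).restrict
      · filter_upwards [ae_restrict_mem hKc.measurableSet] with w hw
        rw [norm_mul, Complex.norm_real]
        exact (mul_le_of_le_one_left (norm_nonneg _) (hm1 w)).trans (hC w hw)
    filter_upwards [ae_eq_mul_of_pairing key hbg hb1 measurableSet_Icc measurableSet_Icc
      (m := m) (fun w => rfl) hL2] with w hw h1 h2 h3 h4 h5
    have hb : ∀ x : ℝ, |x| ≤ (n : ℝ) → bump x = 1 := fun x hx => by
      refine bump.one_of_mem_closedBall ?_
      rw [Metric.mem_closedBall, dist_zero_right, Real.norm_eq_abs]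
      exact hx.trans (by change (n : ℝ) ≤ n + 1; linarith)
    have hw2 : w.1.2 ∈ I := by
      rw [abs_le] at h2; constructor <;> linarith
    have hJ2 : w.2.2 ∈ J := ⟨h4, h5⟩
    have : m w = 1 := by
      simp [hm, hb _ h1, hb _ h3, hw2, hJ2]
    simpa [this] using hw
  filter_upwards [ae_all_iff.2 hbox, ae_flat_snd_pos] with w hw hpos
  obtain ⟨n1, h1⟩ := exists_nat_ge (|w.1.1| + |w.1.2| + |w.2.1| + w.2.2)
  obtain ⟨n2, h2⟩ := exists_nat_one_div_lt hpos
  have a1 := abs_nonneg w.1.1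
  have a2 := abs_nonneg w.1.2
  have a3 := abs_nonneg w.2.1
  have hn1 : (n1 : ℝ) ≤ (max n1 n2 : ℕ) := by exact_mod_cast le_max_left _ _
  have hn2 : (n2 : ℝ) ≤ (max n1 n2 : ℕ) := by exact_mod_cast le_max_right _ _
  refine hw (max n1 n2) (by linarith) (by linarith) (by linarith) ?_ (by linarith)
  refine le_trans ?_ h2.le
  exact one_div_le_one_div_of_le (by positivity) (by linarith)

/-- A function on `𝒟` whose slices are the inverse Fourier transforms of the integrable slices of a
square integrable function `Gh` is square integrable, and `U₁` maps it to `Gh`. -/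
theorem SliceFourier.opU1_symm_ae {Gh G' : (ℝ × ℝ) × (ℝ × ℝ) → ℂ} (h : SliceFourier Gh G')
    (hc : ContinuousOn G' {w | 0 < w.2.2}) {y : L2Flat} (hy : y =ᵐ[flatMeasure] Gh) :
    opU1.symm y =ᵐ[flatMeasure] G' :=
  ae_eq_of_pairing hc fun a c b d hi => h.pairing hy a c b d hi

/-! ### The image of a Fourier-Laplace integral under `U₁ U₀` -/

theorem kappa_mem_D2 {w : (ℝ × ℝ) × (ℝ × ℝ)} (hw : 0 < w.2.2) : kappa w ∈ D2 := by
  have hn : ((‖(⟨w.1.1, w.1.2⟩ : ℂ)‖ : ℂ)) ^ 2 = ((‖(⟨w.1.1, w.1.2⟩ : ℂ)‖ ^ 2 : ℝ) : ℂ) := by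
    norm_cast
  simp only [D2, kappa, mem_ofPred_eq, hn, Complex.add_im, Complex.mul_im,
    Complex.I_re, Complex.I_im, Complex.ofReal_re, Complex.ofReal_im]
  simpa using hw

theorem rho_kappa (w : (ℝ × ℝ) × (ℝ × ℝ)) : rho (kappa w) = w.2.2 := by
  have hn : ((‖(⟨w.1.1, w.1.2⟩ : ℂ)‖ : ℂ)) ^ 2 = ((‖(⟨w.1.1, w.1.2⟩ : ℂ)‖ ^ 2 : ℝ) : ℂ) := by
    norm_cast
  simp only [rho, kappa, hn, Complex.add_im, Complex.mul_im,
    Complex.I_re, Complex.I_im, Complex.ofReal_re, Complex.ofReal_im]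
  simp

theorem kappa_fst_im (w : (ℝ × ℝ) × (ℝ × ℝ)) : (kappa w).1.im = w.1.2 := rfl

theorem continuous_kappa : Continuous kappa := by
  have h : Continuous fun p : ℝ × ℝ => (⟨p.1, p.2⟩ : ℂ) :=
    Complex.equivRealProdCLM.symm.continuous
  have h1 : Continuous fun w : (ℝ × ℝ) × (ℝ × ℝ) => (⟨w.1.1, w.1.2⟩ : ℂ) := h.comp continuous_fst
  have h2 : Continuous fun w : (ℝ × ℝ) × (ℝ × ℝ) => (⟨w.2.1, w.2.2⟩ : ℂ) := h.comp continuous_snd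
  unfold kappa
  fun_prop

theorem memLp_comp_kappa_iff {F : ℂ × ℂ → ℂ} (hF : ContinuousOn F D2) :
    MemLp (fun w => F (kappa w)) 2 flatMeasure ↔ MemLp F 2 (volume.restrict D2) := by
  have h := memLp_map_measure_iff (p := 2) (f := kappa) (μ := flatMeasure) (g := F)
    (by rw [measurePreserving_kappa.map_eq]
        exact hF.aestronglyMeasurable isOpen_D2.measurableSet)
    measurePreserving_kappa.measurable.aemeasurable
  rw [measurePreserving_kappa.map_eq] at h
  exact h.symm

theorem opU0_ae (f : L2D) : opU0 f =ᵐ[flatMeasure] fun w => f (kappa w) := by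
  refine (weightedComp_ae _ _ _ _).trans (Eventually.of_forall fun w => ?_)
  simp

/-- A continuous function `F` on `D₂` for which the slices of `F ∘ κ` are inverse Fourier transforms
of the slices of `Gh ∈ L²(𝒟)` lies in `L²(D₂)`, and `U₁ U₀ F = Gh`. -/
theorem SliceFourier.exists_opU1_opU0_eq {Gh : (ℝ × ℝ) × (ℝ × ℝ) → ℂ} {F : ℂ × ℂ → ℂ}
    (h : SliceFourier Gh fun w => F (kappa w)) (hF : ContinuousOn F D2)
    (hGh : MemLp Gh 2 flatMeasure) :
    ∃ hF2 : MemLp F 2 (volume.restrict D2), opU1 (opU0 (hF2.toLp F)) =ᵐ[flatMeasure] Gh := by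
  have hc : ContinuousOn (fun w => F (kappa w)) {w | 0 < w.2.2} :=
    hF.comp continuous_kappa.continuousOn fun w hw => kappa_mem_D2 hw
  obtain ⟨y, hy⟩ : ∃ y : L2Flat, y =ᵐ[flatMeasure] Gh := ⟨hGh.toLp Gh, hGh.coeFn_toLp⟩
  have key := h.opU1_symm_ae hc hy
  have hF2 : MemLp F 2 (volume.restrict D2) :=
    (memLp_comp_kappa_iff hF).1 ((memLp_congr_ae key).1 (Lp.memLp _))
  refine ⟨hF2, ?_⟩
  have e : opU0 (hF2.toLp F) = opU1.symm y := by
    apply Lp.ext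
    refine (opU0_ae _).trans (EventuallyEq.trans ?_ key.symm)
    exact measurePreserving_kappa.quasiMeasurePreserving.ae_eq_comp hF2.coeFn_toLp
  rw [e, opU1.apply_symm_apply]
  exact hy

theorem SliceFourier.add {Gh G' Hh H' : (ℝ × ℝ) × (ℝ × ℝ) → ℂ} (h : SliceFourier Gh G')
    (h' : SliceFourier Hh H') :
    SliceFourier (fun w => Gh w + Hh w) (fun w => G' w + H' w) := by
  filter_upwards [h, h'] with X h1 h2
  refine ⟨h1.1.add h2.1, fun U => ?_⟩
  rw [h1.2 U, h2.2 U, ← mul_add, ← integral_add]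
  · simp only [add_mul]
  · exact integrable_mul_exp_I h1.1 (φ := fun T : ℝ × ℝ => T.1 * U.1 + T.2 * U.2) (by fun_prop)
  · exact integrable_mul_exp_I h2.1 (φ := fun T : ℝ × ℝ => T.1 * U.1 + T.2 * U.2) (by fun_prop)

theorem sliceFourier_zero : SliceFourier (fun _ => 0) (fun _ => 0) :=
  Eventually.of_forall fun X => ⟨integrable_zero _ _ _, fun U => by simp⟩

theorem SliceFourier.sum {ι : Type*} (s : Finset ι) {Gh G' : ι → (ℝ × ℝ) × (ℝ × ℝ) → ℂ}
    (h : ∀ i ∈ s, SliceFourier (Gh i) (G' i)) :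
    SliceFourier (fun w => ∑ i ∈ s, Gh i w) (fun w => ∑ i ∈ s, G' i w) := by
  induction s using Finset.cons_induction with
  | empty => simpa using sliceFourier_zero
  | cons a s ha ih =>
    simp only [Finset.sum_cons]
    exact (h a (Finset.mem_cons_self a s)).add (ih fun i hi => h i (Finset.mem_cons_of_mem hi))

/-- `((t₁, v), (t₂, s)) ↦ ((-t₁, v), (-t₂, s))`. -/
def negFreq (w : (ℝ × ℝ) × (ℝ × ℝ)) : (ℝ × ℝ) × (ℝ × ℝ) := ((-w.1.1, w.1.2), (-w.2.1, w.2.2))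

/-- Conjugation reverses the sign of the frequencies. -/
theorem SliceFourier.conj {Gh G' : (ℝ × ℝ) × (ℝ × ℝ) → ℂ} (h : SliceFourier Gh G') :
    SliceFourier (fun w => (starRingEnd ℂ) (Gh (negFreq w))) (fun w => (starRingEnd ℂ) (G' w)) := by
  filter_upwards [h] with X hX
  have hneg : MeasurePreserving (fun T : ℝ × ℝ => -T) planeMeasure planeMeasure := by
    have := Measure.measurePreserving_neg (volume : Measure (ℝ × ℝ))
    exact this
  have hemb : MeasurableEmbedding (fun T : ℝ × ℝ => -T) := (MeasurableEquiv.neg _).measurableEmbedding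
  refine ⟨?_, fun U => ?_⟩
  · have := (hneg.integrable_comp_emb hemb).2 hX.1
    exact (Complex.conjCLE : ℂ →L[ℝ] ℂ).integrable_comp this
  · rw [hX.2 U, map_mul, Complex.conj_ofReal, ← integral_conj, ← hneg.integral_comp hemb]
    congr 1
    refine integral_congr_ae (Eventually.of_forall fun T => ?_)
    simp only [map_mul, negFreq, Prod.fst_neg, Prod.snd_neg]
    rw [← Complex.exp_conj]
    congr 2
    simp
    ring

/-- The shear `(p, t) ↦ (p + 2 t v, t)`. -/
def shear (v : ℝ) : ℝ × ℝ ≃ᵐ ℝ × ℝ where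
  toFun q := (q.1 + 2 * q.2 * v, q.2)
  invFun q := (q.1 - 2 * q.2 * v, q.2)
  left_inv q := by simp
  right_inv q := by simp
  measurable_toFun := by change Measurable fun q : ℝ × ℝ => (q.1 + 2 * q.2 * v, q.2); fun_prop
  measurable_invFun := by change Measurable fun q : ℝ × ℝ => (q.1 - 2 * q.2 * v, q.2); fun_prop

theorem measurePreserving_shear (v : ℝ) : MeasurePreserving (shear v) halfMeasure halfMeasure := by
  have hg : MeasurePreserving (fun p : ℝ × ℝ => (p.1, p.2 + 2 * p.1 * v))
      (volPos.prod (volume : Measure ℝ)) (volPos.prod (volume : Measure ℝ)) := by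
    refine MeasurePreserving.skew_product (g := fun t p => p + 2 * t * v)
      (MeasurePreserving.id _) ?_ ?_
    · simp only [Function.uncurry_def]; fun_prop
    · exact Eventually.of_forall fun t => (measurePreserving_add_right (volume : Measure ℝ) _).map_eq
  exact Measure.measurePreserving_swap.comp (hg.comp Measure.measurePreserving_swap)

theorem integrable_indicator_plane {f : ℝ × ℝ → ℂ} :
    Integrable (fun q : ℝ × ℝ => (Ioi (0 : ℝ)).indicator 1 q.2 * f q) planeMeasure ↔
      Integrable f halfMeasure := by
  have e : (fun q : ℝ × ℝ => (Ioi (0 : ℝ)).indicator 1 q.2 * f q) =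
      (univ ×ˢ Ioi (0 : ℝ)).indicator f := by
    funext q
    by_cases hq : 0 < q.2 <;> simp [indicator, hq]
  rw [e, integrable_indicator_iff (MeasurableSet.univ.prod measurableSet_Ioi), halfMeasure_eq,
    IntegrableOn]

theorem integral_indicator_plane (f : ℝ × ℝ → ℂ) :
    ∫ q : ℝ × ℝ, (Ioi (0 : ℝ)).indicator 1 q.2 * f q ∂planeMeasure = ∫ q, f q ∂halfMeasure := by
  have e : (fun q : ℝ × ℝ => (Ioi (0 : ℝ)).indicator 1 q.2 * f q) =
      (univ ×ˢ Ioi (0 : ℝ)).indicator f := by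
    funext q
    by_cases hq : 0 < q.2 <;> simp [indicator, hq]
  rw [e, integral_indicator (MeasurableSet.univ.prod measurableSet_Ioi), halfMeasure_eq]

/-- The image under `U₁ U₀` of the function `b(Im ζ₁, ρ) expInt k`. -/
def spectral (b : ℝ → ℝ → ℂ) (k : ℝ × ℝ → ℂ) (w : (ℝ × ℝ) × (ℝ × ℝ)) : ℂ :=
  (Ioi (0 : ℝ)).indicator 1 w.2.1 * ((2 * Real.pi : ℝ) * b w.1.2 w.2.2 *
    (Real.exp (-(w.1.1 * w.1.2) - w.2.1 * w.2.2) : ℂ) * k (w.1.1 - 2 * w.2.1 * w.1.2, w.2.1))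

/-- On a slice, the exponential is a character in the frequencies `(p + 2 t v, t)`, up to a positive
factor. -/
theorem expKer_kappa (q U X : ℝ × ℝ) :
    expKer q (kappa ((U.1, X.1), (U.2, X.2))) =
      (Real.exp (-((q.1 + 2 * q.2 * X.1) * X.1) - q.2 * X.2) : ℂ) *
        Complex.exp (Complex.I * (((q.1 + 2 * q.2 * X.1) * U.1 + q.2 * U.2 : ℝ) : ℂ)) := by
  rw [expKer, Complex.ofReal_exp, ← Complex.exp_add]
  have hn : ((‖(⟨U.1, X.1⟩ : ℂ)‖ : ℂ)) ^ 2 = (U.1 ^ 2 + X.1 ^ 2 : ℂ) := by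
    have := norm_mk_sq U.1 X.1
    exact_mod_cast congrArg (fun x : ℝ => (x : ℂ)) this
  congr 1
  simp only [kappa, hn]
  have h1 : (⟨U.1, X.1⟩ : ℂ) = U.1 + X.1 * Complex.I := by apply Complex.ext <;> simp
  have h2 : (⟨U.2, X.2⟩ : ℂ) = U.2 + X.2 * Complex.I := by apply Complex.ext <;> simp
  rw [h1, h2]
  push_cast
  linear_combination (Complex.I ^ 2 * 0 + (q.1 * X.1 + q.2 * X.1 ^ 2 + q.2 * X.2 +
    q.2 * (U.1 ^ 2 + X.1 ^ 2)) : ℂ) * Complex.I_sq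

/-- The integral over `(p, t)` becomes an inverse Fourier transform after the shear
`(p, t) ↦ (p + 2 t v, t)`. -/
theorem sliceFourier_spectral {k : ℝ × ℝ → ℂ} (hk : Admissible k) (b : ℝ → ℝ → ℂ) :
    SliceFourier (spectral b k) fun w => b (kappa w).1.im (rho (kappa w)) * expInt k (kappa w) := by
  filter_upwards [ae_snd_pos] with X hX
  have hmp := measurePreserving_shear X.1
  have hemb := (shear X.1).measurableEmbedding
  have hint : ∀ U : ℝ × ℝ, Integrable (fun q => k q * expKer q (kappa ((U.1, X.1), (U.2, X.2))))
    halfMeasure := fun U => hk.integrable (kappa_mem_D2 hX)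
  obtain ⟨J, hJ⟩ : ∃ J : ℝ × ℝ → ℝ × ℝ → ℂ, ∀ U T, J U T =
      (Real.exp (-(T.1 * X.1) - T.2 * X.2) : ℂ) * k (T.1 - 2 * T.2 * X.1, T.2) *
        Complex.exp (Complex.I * ((T.1 * U.1 + T.2 * U.2 : ℝ) : ℂ)) := ⟨_, fun _ _ => rfl⟩
  have e : ∀ U q : ℝ × ℝ, k q * expKer q (kappa ((U.1, X.1), (U.2, X.2))) =
      J U (shear X.1 q) := by
    intro U q
    rw [expKer_kappa, hJ]
    simp only [shear, MeasurableEquiv.coe_mk, Equiv.coe_fn_mk, add_sub_cancel_right]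
    ring
  constructor
  · have h0 := hint 0
    simp only [e] at h0
    have h1 := ((hmp.integrable_comp_emb hemb (g := J 0)).1 h0).const_mul
      ((2 * Real.pi : ℝ) * b X.1 X.2)
    refine (integrable_indicator_plane.2 h1).congr (Eventually.of_forall fun T => ?_)
    simp only [spectral, hJ, Prod.fst_zero, Prod.snd_zero, mul_zero, add_zero, Complex.ofReal_zero,
      Complex.exp_zero, mul_one]
    ring
  · intro U
    simp only [rho_kappa, kappa_fst_im, expInt, e]
    rw [hmp.integral_comp hemb (J U), ← integral_indicator_plane, ← integral_const_mul,
      ← integral_const_mul]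
    refine integral_congr_ae (Eventually.of_forall fun T => ?_)
    have hpi : ((1 / (2 * Real.pi) : ℝ) : ℂ) * (2 * Real.pi : ℝ) = 1 := by
      rw [← Complex.ofReal_mul, one_div_mul_cancel (by positivity), Complex.ofReal_one]
    simp only [spectral, hJ]
    linear_combination (-((Ioi (0 : ℝ)).indicator 1 T.2 * b X.1 X.2 *
      (Real.exp (-(T.1 * X.1) - T.2 * X.2) : ℂ) * k (T.1 - 2 * T.2 * X.1, T.2) *
        Complex.exp (Complex.I * ((T.1 * U.1 + T.2 * U.2 : ℝ) : ℂ)))) * hpi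

/-! ### Laguerre functions -/

/-- The coefficient of `y ^ i` in the polynomial `(-1)^m L_m(y)`. -/
def laguerreCoeff (m i : ℕ) : ℝ := (-1) ^ m * (-1) ^ i * m.choose i / i.factorial

/-- The expansion of the Laguerre functions, with the explicit coefficients of the Laguerre
polynomials. -/
theorem laguerreFun_eq (m : ℕ) (y : ℝ) : laguerreFun m y =
    (∑ i ∈ Finset.range (m + 1), laguerreCoeff m i * y ^ i) * Real.exp (-y / 2) := by
  rw [laguerreFun, laguerre_eq, Finset.mul_sum]
  congr 1
  refine Finset.sum_congr rfl fun i hi => ?_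
  have him : i ≤ m := Nat.lt_succ_iff.1 (Finset.mem_range.1 hi)
  have hprod : ∀ d, d ≤ m → (∏ j ∈ Finset.range d, ((m : ℝ) - j)) * (m - d).factorial =
      m.factorial := by
    intro d
    induction d with
    | zero => simp
    | succ d ih =>
      intro hd
      rw [Finset.prod_range_succ, mul_assoc, ← ih (by omega)]
      congr 1
      rw [show m - d = (m - (d + 1)) + 1 by omega, Nat.factorial_succ]
      push_cast [Nat.cast_sub hd]
      ring
  have h1 := hprod (m - i) (by omega)
  rw [show m - (m - i) = i by omega] at h1 ⊢
  have hf : (i.factorial : ℝ) ≠ 0 := by positivity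
  have hf' : (m.factorial : ℝ) ≠ 0 := by positivity
  rw [laguerreCoeff]
  field_simp
  linear_combination (m.choose i * y ^ i : ℝ) * h1

theorem laguerreCoeff_eq_zero {m i : ℕ} (h : m < i) : laguerreCoeff m i = 0 := by
  simp [laguerreCoeff, Nat.choose_eq_zero_of_lt h]

theorem laguerreCoeff_self (m : ℕ) : laguerreCoeff m m = 1 / m.factorial := by
  rw [laguerreCoeff, ← mul_pow]; simp

theorem laguerreFun_eq_of_lt {m N : ℕ} (h : m < N) (y : ℝ) : laguerreFun m y =
    (∑ i ∈ Finset.range N, laguerreCoeff m i * y ^ i) * Real.exp (-y / 2) := by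
  rw [laguerreFun_eq]
  congr 1
  refine Finset.sum_subset (Finset.range_subset_range.2 h) fun i _ hi => ?_
  rw [laguerreCoeff_eq_zero (by simpa using hi), zero_mul]

/-- The Laguerre functions are obtained from the functions `y ^ i e^{-y/2}` by an invertible
triangular substitution. -/
theorem exists_pow_mul_exp_eq (m : ℕ) : ∃ μ : ℕ → ℝ, ∀ y : ℝ,
    y ^ m * Real.exp (-y / 2) = ∑ j ∈ Finset.range (m + 1), μ j * laguerreFun j y := by
  induction m using Nat.strong_induction_on with
  | _ m ih =>
    choose! ν hν using ih
    refine ⟨fun j => if j = m then (m.factorial : ℝ) else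
      -∑ i ∈ Finset.Ico j m, m.factorial * laguerreCoeff m i * ν i j, fun y => ?_⟩
    have hm : (m.factorial : ℝ) ≠ 0 := by positivity
    have h1 : m.factorial * laguerreFun m y = y ^ m * Real.exp (-y / 2) +
        ∑ i ∈ Finset.range m, m.factorial * laguerreCoeff m i *
          ∑ j ∈ Finset.range (i + 1), ν i j * laguerreFun j y := by
      rw [laguerreFun_eq, Finset.sum_range_succ, laguerreCoeff_self]
      have : ∀ i ∈ Finset.range m, m.factorial * laguerreCoeff m i *
          ∑ j ∈ Finset.range (i + 1), ν i j * laguerreFun j y =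
          m.factorial * laguerreCoeff m i * (y ^ i * Real.exp (-y / 2)) := fun i hi => by
        rw [hν i (Finset.mem_range.1 hi)]
      rw [Finset.sum_congr rfl this, add_mul, mul_add, Finset.sum_mul, Finset.mul_sum, add_comm]
      congr 1
      · field_simp
      · exact Finset.sum_congr rfl fun i _ => by ring
    have h2 : ∑ i ∈ Finset.range m, m.factorial * laguerreCoeff m i *
          ∑ j ∈ Finset.range (i + 1), ν i j * laguerreFun j y =
        ∑ j ∈ Finset.range m, (∑ i ∈ Finset.Ico j m, m.factorial * laguerreCoeff m i * ν i j) *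
          laguerreFun j y := by
      simp only [Finset.mul_sum, Finset.sum_mul]
      rw [Finset.sum_comm' (t' := Finset.range m) (s' := fun j => Finset.Ico j m)]
      · exact Finset.sum_congr rfl fun i _ => Finset.sum_congr rfl fun j _ => by ring
      · intro i j
        simp only [Finset.mem_range, Finset.mem_Ico]
        omega
    have h3 : ∀ j ∈ Finset.range m, (if j = m then (m.factorial : ℝ) else
      -∑ i ∈ Finset.Ico j m, m.factorial * laguerreCoeff m i * ν i j) * laguerreFun j y =
      -((∑ i ∈ Finset.Ico j m, m.factorial * laguerreCoeff m i * ν i j) * laguerreFun j y) := by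
      intro j hj
      rw [if_neg (Finset.mem_range.1 hj).ne]; ring
    beta_reduce
    rw [Finset.sum_range_succ, if_pos rfl, Finset.sum_congr rfl h3, Finset.sum_neg_distrib]
    linarith

theorem integrable_pow_mul_exp_neg (a : ℕ) :
    Integrable (fun y : ℝ => y ^ a * Real.exp (-y)) volPos := by
  have h := Real.GammaIntegral_convergent (s := a + 1) (by positivity)
  refine h.congr (Eventually.of_forall fun y => ?_)
  simp only [add_sub_cancel_right, Real.rpow_natCast]
  ring

theorem integral_pow_mul_exp_neg (a : ℕ) :
    ∫ y : ℝ, y ^ a * Real.exp (-y) ∂volPos = a.factorial := by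
  rw [← Real.Gamma_nat_eq_factorial, Real.Gamma_eq_integral (by positivity)]
  refine integral_congr_ae (Eventually.of_forall fun y => ?_)
  simp only [add_sub_cancel_right, Real.rpow_natCast]
  ring

/-- The `j`-th difference at `0` of the polynomial `x ↦ (x + i).choose i`, which has degree `i ≤
j`. -/
theorem sum_choose_mul_choose {i j : ℕ} (h : i ≤ j) :
    ∑ a ∈ Finset.range (j + 1), (-1 : ℝ) ^ (j - a) * j.choose a * ((a + i).choose i : ℝ) =
      if i = j then 1 else 0 := by
  have h0 := fwdDiff_iter_eq_sum_shift (1 : ℕ) (fun x : ℕ => ((x + i).choose i : ℤ)) j 0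
  have h1 : (fwdDiff 1)^[j] (fun x : ℕ => ((x + i).choose i : ℤ)) 0 = if i = j then 1 else 0 := by
    rw [fwdDiff_iter_comp_add (1 : ℕ) (fun x : ℕ => (x.choose i : ℤ)) i j 0]
    obtain ⟨d, rfl⟩ := Nat.exists_eq_add_of_le' h
    rw [Function.iterate_add_apply]
    have h2 := fwdDiff_iter_choose 0 i
    rw [add_zero] at h2
    rw [h2]
    cases d with
    | zero => simp
    | succ d =>
      rw [Function.iterate_succ_apply]
      simp [fwdDiff_iter_eq_sum_shift]
  rw [h1] at h0
  have h3 := congrArg (fun z : ℤ => (z : ℝ)) h0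
  simp only [smul_eq_mul, zero_add, mul_one] at h3
  push_cast at h3
  rw [← h3]

theorem integral_pow_mul_laguerreFun {i j : ℕ} (h : i ≤ j) :
    ∫ y : ℝ, y ^ i * Real.exp (-y / 2) * laguerreFun j y ∂volPos =
      if i = j then (j.factorial : ℝ) else 0 := by
  have e : ∀ y : ℝ, y ^ i * Real.exp (-y / 2) * laguerreFun j y =
      ∑ a ∈ Finset.range (j + 1), laguerreCoeff j a * (y ^ (a + i) * Real.exp (-y)) := by
    intro y
    rw [laguerreFun_eq, mul_comm, mul_assoc, Finset.sum_mul]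
    refine Finset.sum_congr rfl fun a _ => ?_
    have : Real.exp (-y) = Real.exp (-y / 2) * Real.exp (-y / 2) := by
      rw [← Real.exp_add]; congr 1; ring
    rw [this, pow_add]; ring
  simp only [e]
  rw [integral_finsetSum _ fun a _ => (integrable_pow_mul_exp_neg (a + i)).const_mul _]
  simp only [integral_const_mul, integral_pow_mul_exp_neg]
  have h1 := congrArg (fun z : ℝ => (i.factorial : ℝ) * z) (sum_choose_mul_choose h)
  simp only [Finset.mul_sum] at h1
  refine Eq.trans ?_ (h1.trans ?_)
  · refine Finset.sum_congr rfl fun a ha => ?_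
    have haj : a ≤ j := Nat.lt_succ_iff.1 (Finset.mem_range.1 ha)
    have hs : (-1 : ℝ) ^ (j - a) = (-1) ^ j * (-1) ^ a := by
      rw [← pow_add, show j + a = (j - a) + 2 * a by omega, pow_add, pow_mul]; simp
    have hc : ((a + i).factorial : ℝ) = (a + i).choose i * i.factorial * a.factorial := by
      have := Nat.choose_mul_factorial_mul_factorial (Nat.le_add_left i a)
      rw [Nat.add_sub_cancel] at this
      exact_mod_cast this.symm
    have hf : (a.factorial : ℝ) ≠ 0 := by positivity
    rw [laguerreCoeff, hs, hc]
    field_simp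
  · split_ifs with hij
    · rw [hij, mul_one]
    · rw [mul_zero]

theorem integrable_pow_mul_laguerreFun (i j : ℕ) :
    Integrable (fun y : ℝ => y ^ i * Real.exp (-y / 2) * laguerreFun j y) volPos := by
  have e : ∀ y : ℝ, y ^ i * Real.exp (-y / 2) * laguerreFun j y =
      ∑ a ∈ Finset.range (j + 1), laguerreCoeff j a * (y ^ (a + i) * Real.exp (-y)) := by
    intro y
    rw [laguerreFun_eq, mul_comm, mul_assoc, Finset.sum_mul]
    refine Finset.sum_congr rfl fun a _ => ?_
    have : Real.exp (-y) = Real.exp (-y / 2) * Real.exp (-y / 2) := by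
      rw [← Real.exp_add]; congr 1; ring
    rw [this, pow_add]; ring
  simp only [e]
  exact integrable_finsetSum _ fun a _ => (integrable_pow_mul_exp_neg (a + i)).const_mul _

/-- The Laguerre functions are orthonormal in `L²(ℝ₊)`. -/
theorem integral_laguerreFun_mul (j k : ℕ) :
    ∫ y : ℝ, laguerreFun j y * laguerreFun k y ∂volPos = if j = k then 1 else 0 := by
  wlog h : j ≤ k generalizing j k
  · simp only [mul_comm (laguerreFun j _), eq_comm (a := j)]
    exact this k j (by omega)
  have e : ∀ y : ℝ, laguerreFun j y * laguerreFun k y = ∑ i ∈ Finset.range (j + 1),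
      laguerreCoeff j i * (y ^ i * Real.exp (-y / 2) * laguerreFun k y) := by
    intro y
    rw [laguerreFun_eq j, Finset.sum_mul, Finset.sum_mul]
    exact Finset.sum_congr rfl fun i _ => by ring
  simp only [e]
  rw [integral_finsetSum _ fun i _ => (integrable_pow_mul_laguerreFun i k).const_mul _]
  simp only [integral_const_mul]
  have h1 : ∀ i ∈ Finset.range (j + 1), laguerreCoeff j i *
      ∫ y : ℝ, y ^ i * Real.exp (-y / 2) * laguerreFun k y ∂volPos =
      if i = k then laguerreCoeff j i * k.factorial else 0 := by
    intro i hi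
    rw [integral_pow_mul_laguerreFun (by have := Finset.mem_range.1 hi; omega)]
    split_ifs <;> simp
  rw [Finset.sum_congr rfl h1, Finset.sum_ite_eq']
  rcases h.eq_or_lt with rfl | h
  · rw [if_pos (by simp), if_pos rfl, laguerreCoeff_self]
    field_simp
  · rw [if_neg (by simpa using h), if_neg h.ne]

theorem integral_hermiteFun0_sq : ∫ y : ℝ, hermiteFun0 y ^ 2 = 1 := by
  have e : ∀ y : ℝ, hermiteFun0 y ^ 2 = (1 / √Real.pi) * Real.exp (-1 * y ^ 2) := by
    intro y
    rw [hermiteFun0, mul_pow, div_pow, Real.sq_sqrt (by positivity), one_pow, ← Real.exp_nat_mul]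
    congr 2
    push_cast; ring
  simp only [e]
  rw [integral_const_mul, integral_gaussian, div_one,
    one_div_mul_cancel (Real.sqrt_pos.2 Real.pi_pos).ne']

/-! ### Bounded densities with bounded support -/

theorem memLp_exp_neg_abs : MemLp (fun x : ℝ => ((Real.exp (-|x|) : ℝ) : ℂ)) 2 volume := by
  have hc : Continuous fun x : ℝ => ((Real.exp (-|x|) : ℝ) : ℂ) := by fun_prop
  refine (memLp_two_iff_integrable_sq_norm hc.aestronglyMeasurable).2 ?_
  refine integrable_inv_one_add_sq.mono (by fun_prop) (Eventually.of_forall fun x => ?_)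
  rw [Complex.norm_real, norm_pow, norm_norm, Real.norm_of_nonneg (Real.exp_nonneg _),
    ← Real.exp_nat_mul, Real.norm_of_nonneg (by positivity),
    show ((2 : ℕ) : ℝ) * -|x| = -(2 * |x|) by push_cast; ring, Real.exp_neg]
  refine inv_anti₀ (by positivity) ?_
  have := Real.quadratic_le_exp_of_nonneg (show 0 ≤ 2 * |x| by positivity)
  rw [mul_pow, sq_abs] at this
  nlinarith [abs_nonneg x, sq_nonneg x]

theorem memLp_exp_neg_mul {δ : ℝ} (hδ : 0 < δ) :
    MemLp (fun s : ℝ => ((Real.exp (-(δ * s)) : ℝ) : ℂ)) 2 volPos := by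
  have hc : Continuous fun s : ℝ => ((Real.exp (-(δ * s)) : ℝ) : ℂ) := by fun_prop
  refine (memLp_two_iff_integrable_sq_norm hc.aestronglyMeasurable).2 ?_
  refine (exp_neg_integrableOn_Ioi 0 (b := 2 * δ) (by positivity)).congr
    (Eventually.of_forall fun s => ?_)
  simp only
  rw [Complex.norm_real, Real.norm_of_nonneg (Real.exp_nonneg _), ← Real.exp_nat_mul]
  congr 1; push_cast; ring

/-- Bounded measurable functions on the half-plane `ℝ × ℝ₊` which are supported in one of the
compact boxes `[-R, R] × [1/R, R]`. One constant `R` serves as the bound and as the size of the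
box. -/
structure BoxBounded (k : ℝ × ℝ → ℂ) : Prop where
  measurable : Measurable k
  exists_bound : ∃ R > 0, ∀ q, ‖k q‖ ≤ R ∧ (k q ≠ 0 → |q.1| ≤ R ∧ R⁻¹ ≤ q.2 ∧ q.2 ≤ R)

theorem BoxBounded.mul {k m : ℝ × ℝ → ℂ} (hk : BoxBounded k) (hm : Measurable m)
    (hb : ∀ R > 0, ∃ C : ℝ, ∀ q : ℝ × ℝ, |q.1| ≤ R → R⁻¹ ≤ q.2 → q.2 ≤ R → ‖m q‖ ≤ C) :
    BoxBounded fun q => m q * k q := by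
  obtain ⟨R, hR, h⟩ := hk.exists_bound
  obtain ⟨C, hC⟩ := hb R hR
  refine ⟨hm.mul hk.measurable, max R (|C| * R), by positivity, fun q => ?_⟩
  by_cases hq : k q = 0
  · simp only [hq, mul_zero, norm_zero, ne_eq, not_true_eq_false, false_implies, and_true]
    positivity
  · obtain ⟨h1, h2, h3⟩ := (h q).2 hq
    refine ⟨?_, fun _ => ⟨h1.trans (le_max_left _ _), ?_, h3.trans (le_max_left _ _)⟩⟩
    · rw [norm_mul]
      refine le_trans ?_ (le_max_right _ _)
      exact mul_le_mul ((hC q h1 h2 h3).trans (le_abs_self C)) (h q).1 (norm_nonneg _)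
        (abs_nonneg _)
    · exact (inv_anti₀ hR (le_max_left _ _)).trans h2

theorem BoxBounded.mul_fst {k : ℝ × ℝ → ℂ} (hk : BoxBounded k) :
    BoxBounded fun q => (q.1 : ℂ) * k q :=
  hk.mul (by fun_prop) fun R _ => ⟨R, fun q h1 _ _ => by
    rwa [Complex.norm_real]⟩

theorem BoxBounded.mul_snd {k : ℝ × ℝ → ℂ} (hk : BoxBounded k) :
    BoxBounded fun q => (q.2 : ℂ) * k q :=
  hk.mul (by fun_prop) fun R hR => ⟨R, fun q _ h2 h3 => by
    rw [Complex.norm_real, Real.norm_of_nonneg ((inv_pos.2 hR).le.trans h2)]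
    exact h3⟩

theorem BoxBounded.mul_snd_pow {k : ℝ × ℝ → ℂ} (hk : BoxBounded k) (n : ℕ) :
    BoxBounded fun q => (q.2 : ℂ) ^ n * k q := by
  induction n with
  | zero => simpa using hk
  | succ n ih =>
    have := ih.mul_snd
    simpa only [← mul_assoc, ← pow_succ'] using this

theorem BoxBounded.snd_inv_mul {k : ℝ × ℝ → ℂ} (hk : BoxBounded k) :
    BoxBounded fun q => (q.2 : ℂ)⁻¹ * k q :=
  hk.mul (by fun_prop) fun R hR => ⟨R, fun q _ h2 _ => by
    rw [norm_inv, Complex.norm_real, Real.norm_of_nonneg ((inv_pos.2 hR).le.trans h2)]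
    exact inv_le_of_inv_le₀ hR h2⟩

theorem BoxBounded.snd_ne_zero {k : ℝ × ℝ → ℂ} (hk : BoxBounded k) {q : ℝ × ℝ} (hq : k q ≠ 0) :
    q.2 ≠ 0 := by
  obtain ⟨R, hR, h⟩ := hk.exists_bound
  exact ((inv_pos.2 hR).trans_le ((h q).2 hq).2.1).ne'

/-- Since `t` is bounded from below on the support of `k`, the weight `t^n` can be divided out. -/
theorem BoxBounded.exists_mul_snd_pow_eq {k : ℝ × ℝ → ℂ} (hk : BoxBounded k) (n : ℕ) :
    ∃ k', BoxBounded k' ∧ (fun q => (q.2 : ℂ) ^ n * k' q) = k := by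
  induction n with
  | zero => exact ⟨k, hk, by simp⟩
  | succ n ih =>
    obtain ⟨k', hk', e⟩ := ih
    refine ⟨_, hk'.snd_inv_mul, ?_⟩
    rw [← e]
    funext q
    by_cases hq : k' q = 0
    · simp [hq]
    · have := hk'.snd_ne_zero hq
      have h2 : (q.2 : ℂ) ≠ 0 := by exact_mod_cast this
      field_simp
      ring

theorem halfMeasure_box_lt_top (R : ℝ) : halfMeasure (Icc (-R) R ×ˢ Icc R⁻¹ R) < ∞ := by
  rw [Measure.prod_prod]
  exact ENNReal.mul_lt_top isCompact_Icc.measure_lt_top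
    ((Measure.restrict_apply_le _ _).trans_lt isCompact_Icc.measure_lt_top)

theorem BoxBounded.memLp {k : ℝ × ℝ → ℂ} (hk : BoxBounded k) (p : ℝ≥0∞) :
    MemLp k p halfMeasure := by
  obtain ⟨R, hR, h⟩ := hk.exists_bound
  have e : k = (Icc (-R) R ×ˢ Icc R⁻¹ R).indicator k := by
    funext q
    by_cases hq : k q = 0
    · simp [indicator, hq]
    · rw [indicator_of_mem]
      have := (h q).2 hq
      exact ⟨abs_le.1 this.1, this.2⟩
  have hs : MeasurableSet (Icc (-R) R ×ˢ Icc R⁻¹ R) := measurableSet_Icc.prod measurableSet_Icc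
  rw [e, memLp_indicator_iff_restrict hs]
  have : IsFiniteMeasure (halfMeasure.restrict (Icc (-R) R ×ˢ Icc R⁻¹ R)) :=
    ⟨by simpa using halfMeasure_box_lt_top R⟩
  exact MemLp.of_bound hk.measurable.aestronglyMeasurable R (Eventually.of_forall fun q => (h q).1)

theorem BoxBounded.admissible {k : ℝ × ℝ → ℂ} (hk : BoxBounded k) : Admissible k := by
  intro v σ _
  have := hk.mul (m := fun q : ℝ × ℝ => (Real.exp (-(q.1 * v) - q.2 * σ) : ℂ)) (by fun_prop)
    fun R hR => ⟨Real.exp (R * |v| + R * |σ|), fun q h1 h2 h3 => by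
      rw [Complex.norm_real, Real.norm_of_nonneg (Real.exp_nonneg _), Real.exp_le_exp]
      have a1 : -(q.1 * v) ≤ R * |v| := (neg_le_abs _).trans (by rw [abs_mul]; gcongr)
      have a2 : -(q.2 * σ) ≤ R * |σ| := (neg_le_abs _).trans (by
        rw [abs_mul, abs_of_nonneg ((inv_pos.2 hR).le.trans h2)]; gcongr)
      linarith⟩
  exact memLp_one_iff_integrable.1 (this.memLp 1)

theorem pow_mul_exp_le (l : ℕ) {a x : ℝ} (ha : 0 < a) (hx : 0 ≤ x) :
    x ^ l ≤ l.factorial / a ^ l * Real.exp (a * x) := by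
  have h := Real.pow_div_factorial_le_exp (a * x) (by positivity) l
  rw [div_le_iff₀ (by positivity), mul_pow] at h
  rw [div_mul_eq_mul_div, le_div_iff₀ (by positivity)]
  linarith

theorem measurable_spectral {b : ℝ → ℝ → ℂ} (hb : Measurable fun x : ℝ × ℝ => b x.1 x.2)
    {k : ℝ × ℝ → ℂ} (hk : Measurable k) : Measurable (spectral b k) := by
  have h1 : Measurable fun w : (ℝ × ℝ) × (ℝ × ℝ) => b w.1.2 w.2.2 :=
    hb.comp (by fun_prop : Measurable fun w : (ℝ × ℝ) × (ℝ × ℝ) => (w.1.2, w.2.2))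
  have h2 : Measurable fun w : (ℝ × ℝ) × (ℝ × ℝ) => k (w.1.1 - 2 * w.2.1 * w.1.2, w.2.1) :=
    hk.comp (by fun_prop)
  have h3 : Measurable fun w : (ℝ × ℝ) × (ℝ × ℝ) => (Ioi (0 : ℝ)).indicator (1 : ℝ → ℂ) w.2.1 :=
    (measurable_one.indicator measurableSet_Ioi).comp (by fun_prop)
  unfold spectral
  fun_prop

/-- The monomial weights `v ^ l s ^ m`. -/
def monom (l m : ℕ) (v s : ℝ) : ℂ := (v : ℂ) ^ l * (s : ℂ) ^ m

theorem measurable_monom (l m : ℕ) : Measurable fun x : ℝ × ℝ => monom l m x.1 x.2 := by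
  unfold monom; fun_prop

/-- On the support of the density, `|t₁ - 2 t v| ≤ R` and `t ≥ 1/R`, so that `exp(-t₁ v - t s)` has
Gaussian decay in `v` and exponential decay in `s`, and `|t₁|` is controlled by `|v|`. -/
theorem BoxBounded.memLp_spectral {k : ℝ × ℝ → ℂ} (hk : BoxBounded k) (l m : ℕ) :
    MemLp (spectral (monom l m) k) 2 flatMeasure := by
  obtain ⟨R, hR, h⟩ := hk.exists_bound
  have hd : 0 < 1 / (2 * R) := by positivity
  have hT := memLp_tensor (memLp_tensor memLp_exp_neg_abs memLp_exp_neg_abs)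
    (memLp_tensor memLp_exp_neg_abs (memLp_exp_neg_mul hd))
  set a := 3 * R + 2 with ha
  set C := 2 * Real.pi * R * (l.factorial / 1 ^ l * Real.exp (a ^ 2 * R / 8)) *
    (m.factorial / (1 / (2 * R)) ^ m) * Real.exp (2 * R) with hC
  refine (hT.const_mul (C : ℂ)).mono
    (measurable_spectral (measurable_monom l m) hk.measurable).aestronglyMeasurable ?_
  filter_upwards [ae_flat_snd_pos] with w hs
  by_cases hq : k (w.1.1 - 2 * w.2.1 * w.1.2, w.2.1) = 0
  · simp only [spectral, hq, mul_zero, norm_zero]; positivity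
  obtain ⟨hb, hsupp⟩ := h (w.1.1 - 2 * w.2.1 * w.1.2, w.2.1)
  obtain ⟨h1, h2, h3⟩ := hsupp hq
  simp only at h1 h2 h3
  have ht : 0 < w.2.1 := (inv_pos.2 hR).trans_le h2
  rw [spectral, indicator_of_mem (mem_Ioi.2 ht)]
  simp only [Pi.one_apply, one_mul, monom, norm_mul, norm_pow, Complex.norm_real, Real.norm_eq_abs,
    Real.abs_exp]
  obtain ⟨⟨t₁, v⟩, ⟨t, s⟩⟩ := w
  simp only at *
  have hC0 : 0 ≤ C := by positivity
  rw [abs_of_nonneg hC0, abs_of_pos ht, abs_of_pos hs, abs_of_pos (by positivity : (0 : ℝ) < 2),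
    abs_of_pos Real.pi_pos]
  -- The size of the exponential factor on the support of the density.
  have e1 : -(t₁ * v) - t * s ≤ R * |v| - 2 * R⁻¹ * |v| ^ 2 - R⁻¹ * s := by
    have x1 : -((t₁ - 2 * t * v) * v) ≤ R * |v| := (neg_le_abs _).trans (by rw [abs_mul]; gcongr)
    have x2 : R⁻¹ * s ≤ t * s := by gcongr
    have x3 : 2 * R⁻¹ * v ^ 2 ≤ 2 * t * v ^ 2 := by gcongr
    rw [sq_abs]
    nlinarith
  have e2 : |t₁| ≤ R + 2 * R * |v| := by
    have : |t₁| ≤ |t₁ - 2 * t * v| + |2 * t * v| := by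
      have := abs_add_le (t₁ - 2 * t * v) (2 * t * v); simpa using this
    rw [abs_mul, abs_mul, abs_of_pos ht, abs_of_pos (by norm_num : (0 : ℝ) < 2)] at this
    have : 2 * t * |v| ≤ 2 * R * |v| := by gcongr
    linarith
  have e3 : |v| ^ l ≤ l.factorial / 1 ^ l * Real.exp (1 * |v|) :=
    pow_mul_exp_le l one_pos (abs_nonneg v)
  have e4 : s ^ m ≤ m.factorial / (1 / (2 * R)) ^ m * Real.exp (1 / (2 * R) * s) :=
    pow_mul_exp_le m hd hs.le
  have e5 : a * |v| - 2 * R⁻¹ * |v| ^ 2 ≤ a ^ 2 * R / 8 := by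
    have : 0 ≤ 2 * R⁻¹ * (|v| - a * R / 4) ^ 2 := by positivity
    have e : 2 * R⁻¹ * (|v| - a * R / 4) ^ 2 = 2 * R⁻¹ * |v| ^ 2 - a * |v| + a ^ 2 * R / 8 := by
      field_simp; ring
    linarith
  calc 2 * Real.pi * (|v| ^ l * s ^ m) * Real.exp (-(t₁ * v) - t * s) *
        ‖k (t₁ - 2 * t * v, t)‖
      ≤ 2 * Real.pi * ((l.factorial / 1 ^ l * Real.exp (1 * |v|)) *
        (m.factorial / (1 / (2 * R)) ^ m * Real.exp (1 / (2 * R) * s))) *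
        Real.exp (R * |v| - 2 * R⁻¹ * |v| ^ 2 - R⁻¹ * s) * R := by
        gcongr
    _ = 2 * Real.pi * R * (l.factorial / 1 ^ l) * (m.factorial / (1 / (2 * R)) ^ m) *
        Real.exp (1 * |v| + 1 / (2 * R) * s + (R * |v| - 2 * R⁻¹ * |v| ^ 2 - R⁻¹ * s)) := by
        rw [Real.exp_add, Real.exp_add]; ring
    _ ≤ 2 * Real.pi * R * (l.factorial / 1 ^ l) * (m.factorial / (1 / (2 * R)) ^ m) *
        Real.exp (a ^ 2 * R / 8 + 2 * R + (-|t₁| + -|v| + (-t + -(1 / (2 * R) * s)))) := by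
        refine mul_le_mul_of_nonneg_left (Real.exp_le_exp.2 ?_) (by positivity)
        have : R⁻¹ * s = 1 / (2 * R) * s + 1 / (2 * R) * s := by field_simp; ring
        have e6 : a * |v| = 3 * (R * |v|) + 2 * |v| := by rw [ha]; ring
        linarith
    _ = _ := by
        simp only [Real.exp_add]; rw [hC]; ring

theorem contDiffOn_monom_mul_expInt {k : ℝ × ℝ → ℂ} (hk : Admissible k) (l m : ℕ) :
    ContDiffOn ℝ (⊤ : ℕ∞) (fun ζ => monom l m ζ.1.im (rho ζ) * expInt k ζ) D2 := by
  unfold monom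
  exact ((contDiff_ofReal_im_fst.pow l).mul (contDiff_ofReal_rho.pow m)).contDiffOn.mul
    (contDiffOn_expInt hk)

theorem BoxBounded.exists_opU1_opU0_eq {k : ℝ × ℝ → ℂ} (hk : BoxBounded k) (l m : ℕ) :
    ∃ h : MemLp (fun ζ => monom l m ζ.1.im (rho ζ) * expInt k ζ) 2 (volume.restrict D2),
      opU1 (opU0 (h.toLp _)) =ᵐ[flatMeasure] spectral (monom l m) k :=
  SliceFourier.exists_opU1_opU0_eq (sliceFourier_spectral hk.admissible (monom l m))
    (contDiffOn_monom_mul_expInt hk.admissible l m).continuousOn (hk.memLp_spectral l m)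

/-! ### Moments of a function in `A²_{(1,n)}(D₂)` -/

/-- Lebesgue measure on `D₂`. -/
abbrev D2Measure : Measure (ℂ × ℂ) := (volume : Measure (ℂ × ℂ)).restrict D2

theorem iterate_dbar2_rho_pow (m a : ℕ) : EqOn (dbar2^[a] fun ζ => (rho ζ : ℂ) ^ m)
    (fun ζ => (Complex.I / 2) ^ a * ((m.descFactorial a : ℂ) * (rho ζ : ℂ) ^ (m - a))) D2 := by
  intro ζ hζ
  have h := isDbarOp_dbar2.iterate_comp (φ := fun x => x ^ m) (r := rho) (c := Complex.I / 2)
    (contDiff_id.pow m) contDiff_rho (fun ζ _ => dbar2_rho ζ) a hζ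
  simp only [iteratedDeriv_pow] at h
  push_cast at h
  exact h

/-- The iterates of `∂/∂ζ̄₂` on `ρ^m G`, when they are known on `G`. -/
theorem iterate_dbar2_rho_pow_mul {G : ℂ × ℂ → ℂ} (hG : ContDiffOn ℝ (⊤ : ℕ∞) G D2)
    {Gb : ℕ → ℂ × ℂ → ℂ} (hGb : ∀ b, EqOn (dbar2^[b] G) (Gb b) D2) (m i : ℕ) :
    EqOn (dbar2^[i] fun ζ => (rho ζ : ℂ) ^ m * G ζ)
      (fun ζ => ∑ ab ∈ Finset.HasAntidiagonal.antidiagonal i,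
        (i.choose ab.1 * (Complex.I / 2) ^ ab.1 * m.descFactorial ab.1 : ℂ) *
          ((rho ζ : ℂ) ^ (m - ab.1) * Gb ab.2 ζ)) D2 := by
  intro ζ hζ
  rw [isDbarOp_dbar2.iterate_mul (contDiff_ofReal_rho.pow m).contDiffOn hG i hζ]
  refine Finset.sum_congr rfl fun ab _ => ?_
  rw [iterate_dbar2_rho_pow m ab.1 hζ, hGb ab.2 hζ, nsmul_eq_mul]
  ring

/-- Integration by parts against `ρ^m G` with `m ≥ n`: the factor `ρ^m` pays for the `n` factors
`1/ρ` that the cutoff functions can produce. -/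
theorem sum_integral_mul_rho_pow_eq_zero {n : ℕ} {F : ℂ × ℂ → ℂ} (hF : IsLAnalytic 1 n F)
    (hF2 : MemLp F 2 D2Measure) {G : ℂ × ℂ → ℂ} (hG : ContDiffOn ℝ (⊤ : ℕ∞) G D2)
    {Gb : ℕ → ℂ × ℂ → ℂ} (hGb : ∀ b, EqOn (dbar2^[b] G) (Gb b) D2)
    (hG2 : ∀ b j, MemLp (fun ζ => (rho ζ : ℂ) ^ j * Gb b ζ) 2 D2Measure) {m : ℕ} (hm : n ≤ m) :
    ∑ ab ∈ Finset.HasAntidiagonal.antidiagonal n,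
      (n.choose ab.1 * (Complex.I / 2) ^ ab.1 * m.descFactorial ab.1 : ℂ) *
        ∫ ζ in D2, F ζ * ((rho ζ : ℂ) ^ (m - ab.1) * Gb ab.2 ζ) = 0 := by
  have h := integral_mul_iterate_dbar2_eq_zero n hF.smooth hF2 hF.eq₂
    (Θ := fun ζ => (rho ζ : ℂ) ^ m * G ζ) ((contDiff_ofReal_rho.pow m).contDiffOn.mul hG)
    fun i j hij => ?_
  · have hi : ∀ ab ∈ Finset.HasAntidiagonal.antidiagonal n, Integrable (fun ζ =>
        (n.choose ab.1 * (Complex.I / 2) ^ ab.1 * m.descFactorial ab.1 : ℂ) *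
          (F ζ * ((rho ζ : ℂ) ^ (m - ab.1) * Gb ab.2 ζ))) D2Measure := fun ab _ =>
      (hF2.integrable_mul (hG2 _ _)).const_mul _
    rw [setIntegral_congr_fun isOpen_D2.measurableSet (g := fun ζ =>
      ∑ ab ∈ Finset.HasAntidiagonal.antidiagonal n,
        (n.choose ab.1 * (Complex.I / 2) ^ ab.1 * m.descFactorial ab.1 : ℂ) *
          (F ζ * ((rho ζ : ℂ) ^ (m - ab.1) * Gb ab.2 ζ))) fun ζ hζ => by
        simp only
        rw [iterate_dbar2_rho_pow_mul hG hGb m n hζ, Finset.mul_sum]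
        exact Finset.sum_congr rfl fun ab _ => by ring,
      integral_finsetSum _ hi] at h
    simpa only [integral_const_mul] using h
  · refine (memLp_congr_ae ?_).2 (memLp_finsetSum (Finset.HasAntidiagonal.antidiagonal i)
      (f := fun ab ζ => (i.choose ab.1 * (Complex.I / 2) ^ ab.1 * m.descFactorial ab.1 : ℂ) *
          ((rho ζ : ℂ) ^ (m - ab.1 - j) * Gb ab.2 ζ)) fun ab _ => (hG2 _ _).const_mul _)
    filter_upwards [ae_restrict_mem isOpen_D2.measurableSet] with ζ hζ
    rw [iterate_dbar2_rho_pow_mul hG hGb m i hζ, Finset.mul_sum]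
    refine Finset.sum_congr rfl fun ab hab => ?_
    have hab' := Finset.HasAntidiagonal.mem_antidiagonal.1 hab
    have hr : (rho ζ : ℂ) ≠ 0 := by
      have : 0 < rho ζ := hζ
      exact_mod_cast this.ne'
    rw [show m - ab.1 = (m - ab.1 - j) + j by omega, pow_add, Nat.add_sub_cancel]
    have hr' : ((rho ζ : ℂ)⁻¹) ^ j * (rho ζ : ℂ) ^ j = 1 := by
      rw [← mul_pow, inv_mul_cancel₀ hr, one_pow]
    push_cast
    linear_combination ((i.choose ab.1 * (Complex.I / 2) ^ ab.1 * m.descFactorial ab.1 : ℂ) *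
          ((rho ζ : ℂ) ^ (m - ab.1 - j) * Gb ab.2 ζ)) * hr'

theorem iterate_dbar2_conj_expInt (b : ℕ) : ∀ {k : ℝ × ℝ → ℂ}, BoxBounded k →
    EqOn (dbar2^[b] fun ζ => (starRingEnd ℂ) (expInt k ζ))
      (fun ζ => (-Complex.I) ^ b * (starRingEnd ℂ) (expInt (fun q => (q.2 : ℂ) ^ b * k q) ζ)) D2 := by
  induction b with
  | zero => intro k _ ζ _; simp
  | succ b ih =>
    intro k hk ζ hζ
    have hs := contDiffOn_conj (contDiffOn_expInt hk.mul_snd.admissible)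
    have e1 : EqOn (dbar2 fun ζ => (starRingEnd ℂ) (expInt k ζ)) (fun ζ => -Complex.I *
        (starRingEnd ℂ) (expInt (fun q => (q.2 : ℂ) * k q) ζ)) D2 :=
      fun ζ hζ => dbar2_conj_expInt hk.admissible hζ
    have hP := isDbarOp_dbar2.toIsLinearOp.iterate b
    rw [Function.iterate_succ_apply, hP.congr (contDiffOn_const.mul hs) e1 hζ,
      hP.map_const_mul hs _ hζ]
    beta_reduce
    rw [ih hk.mul_snd hζ]
    beta_reduce
    rw [← mul_assoc, ← pow_succ']
    simp only [pow_succ, mul_assoc]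

theorem iterate_dbar2_im_pow_mul_expInt {k : ℝ × ℝ → ℂ} (hk : Admissible k) (l b : ℕ) :
    EqOn (dbar2^[b] fun ζ => (ζ.1.im : ℂ) ^ l * expInt k ζ)
      (fun ζ => if b = 0 then (ζ.1.im : ℂ) ^ l * expInt k ζ else 0) D2 := by
  cases b with
  | zero => intro ζ _; simp
  | succ b =>
    intro ζ hζ
    have e1 : EqOn (dbar2 fun ζ => (ζ.1.im : ℂ) ^ l * expInt k ζ) (fun _ => 0) D2 := by
      intro ζ hζ
      have hd : DifferentiableAt ℝ (fun ζ : ℂ × ℂ => (ζ.1.im : ℂ) ^ l) ζ :=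
        ((contDiff_ofReal_im_fst (n := 1)).pow l).differentiable (by simp) ζ
      have h2 := isDbarOp_dbar2.comp (fun x => x ^ l) (fun ζ => ζ.1.im) ζ (by fun_prop)
        ((contDiff_im_complex (n := 1)).comp contDiff_fst |>.differentiable (by simp) ζ)
      rw [dbar2_im_fst, mul_zero] at h2
      push_cast at h2
      rw [isDbarOp_dbar2.mul _ _ ζ hd
        (ContDiffOn.differentiableAt_D2 (contDiffOn_expInt hk) hζ), h2,
        isDbarOp_dbar2.zero_of_holo _ _ (hasFDerivAt_expInt hk hζ).differentiableAt]
      ring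
    have hP := isDbarOp_dbar2.toIsLinearOp.iterate b
    rw [Function.iterate_succ_apply, hP.congr contDiffOn_const e1 hζ, hP.map_zero hζ]
    simp

theorem BoxBounded.memLp_rho_pow {k : ℝ × ℝ → ℂ} (hk : BoxBounded k) (l j : ℕ) :
    MemLp (fun ζ => (rho ζ : ℂ) ^ j * ((ζ.1.im : ℂ) ^ l * expInt k ζ)) 2 D2Measure := by
  obtain ⟨h, -⟩ := hk.exists_opU1_opU0_eq l j
  refine (memLp_congr_ae (Eventually.of_forall fun ζ => ?_)).1 h
  simp only [monom]; ring

theorem MemLp.conj_complex {α : Type*} [MeasurableSpace α] {μ : Measure α} {p : ℝ≥0∞} {f : α → ℂ}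
    (hf : MemLp f p μ) : MemLp (fun x => (starRingEnd ℂ) (f x)) p μ :=
  (Complex.conjCLE : ℂ →L[ℝ] ℂ).comp_memLp' hf

/-- The functions `v^l ρ^m expInt k` annihilate `A²_{(1,n)}(D₂)` in the bilinear pairing: they are
multiples of `(∂/∂ζ̄₂)^n` applied to `ρ^{m+n} v^l expInt k`, where only `ρ` depends on `ζ̄₂`. -/
theorem integral_mul_rho_pow_mul_expInt_eq_zero {n : ℕ} {F : ℂ × ℂ → ℂ} (hF : IsLAnalytic 1 n F)
    (hF2 : MemLp F 2 D2Measure) {k : ℝ × ℝ → ℂ} (hk : BoxBounded k) (l m : ℕ) :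
    ∫ ζ in D2, F ζ * ((rho ζ : ℂ) ^ m * ((ζ.1.im : ℂ) ^ l * expInt k ζ)) = 0 := by
  have h := sum_integral_mul_rho_pow_eq_zero hF hF2
    (G := fun ζ => (ζ.1.im : ℂ) ^ l * expInt k ζ)
    (Gb := fun b ζ => if b = 0 then (ζ.1.im : ℂ) ^ l * expInt k ζ else 0)
    ((contDiff_ofReal_im_fst.pow l).contDiffOn.mul (contDiffOn_expInt hk.admissible))
    (fun b => iterate_dbar2_im_pow_mul_expInt hk.admissible l b) (fun b j => ?_) (Nat.le_add_left n m)
  · rw [Finset.sum_eq_single (n, 0)] at h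
    · have hne : ((n.choose n : ℂ) * (Complex.I / 2) ^ n * ((m + n).descFactorial n : ℂ)) ≠ 0 := by
        have : (m + n).descFactorial n ≠ 0 := by
          rw [Ne, Nat.descFactorial_eq_zero_iff_lt]; omega
        simp [this]
      simpa using (mul_eq_zero.1 h).resolve_left hne
    · rintro ⟨a, b⟩ hab hne
      have := Finset.HasAntidiagonal.mem_antidiagonal.1 hab
      have hb : b ≠ 0 := by
        rintro rfl
        exact hne (by simpa using this)
      simp [hb]
    · intro hn
      exact absurd (Finset.HasAntidiagonal.mem_antidiagonal.2 (by simp)) hn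
  · by_cases hb : b = 0
    · simpa only [hb, if_true] using hk.memLp_rho_pow l j
    · simp [hb]

/-- The moments against `ρ^m conj(expInt k)` with `m < n` determine those with `m ≥ n`. -/
theorem integral_mul_rho_pow_conj_expInt_eq_zero {n : ℕ} {F : ℂ × ℂ → ℂ} (hF : IsLAnalytic 1 n F)
    (hF2 : MemLp F 2 D2Measure)
    (h0 : ∀ m < n, ∀ k, BoxBounded k →
      ∫ ζ in D2, F ζ * ((rho ζ : ℂ) ^ m * (starRingEnd ℂ) (expInt k ζ)) = 0)
    (m : ℕ) {k : ℝ × ℝ → ℂ} (hk : BoxBounded k) :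
    ∫ ζ in D2, F ζ * ((rho ζ : ℂ) ^ m * (starRingEnd ℂ) (expInt k ζ)) = 0 := by
  induction m using Nat.strong_induction_on generalizing k with
  | _ m ih =>
    rcases lt_or_ge m n with hmn | hmn
    · exact h0 m hmn k hk
    -- In `(∂/∂ζ̄₂)^n (ρ^m conj(expInt k'))` the term with the highest power of `ρ` is a multiple of
    -- `ρ^m conj(expInt (t^n k'))`, and all others are covered by the induction hypothesis.
    obtain ⟨k', hk', rfl⟩ := hk.exists_mul_snd_pow_eq n
    have h := sum_integral_mul_rho_pow_eq_zero hF hF2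
      (contDiffOn_conj (contDiffOn_expInt hk'.admissible))
      (fun b => iterate_dbar2_conj_expInt b hk') (fun b j => ?_) hmn
    · have e : ∀ a b, ∫ ζ in D2, F ζ * ((rho ζ : ℂ) ^ (m - a) * ((-Complex.I) ^ b *
          (starRingEnd ℂ) (expInt (fun q => (q.2 : ℂ) ^ b * k' q) ζ))) = (-Complex.I) ^ b *
          ∫ ζ in D2, F ζ * ((rho ζ : ℂ) ^ (m - a) *
          (starRingEnd ℂ) (expInt (fun q => (q.2 : ℂ) ^ b * k' q) ζ)) := by
        intro a b
        rw [← integral_const_mul]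
        congr 1
        funext ζ
        ring
      simp only [e] at h
      rw [Finset.sum_eq_single (0, n)] at h
      · simpa using h
      · rintro ⟨a, b⟩ hab hne
        have hab' := Finset.HasAntidiagonal.mem_antidiagonal.1 hab
        have ha : a ≠ 0 := by
          rintro rfl
          exact hne (by simpa using hab')
        simp only at hab' ⊢
        rw [ih (m - a) (by omega) (hk'.mul_snd_pow b), mul_zero, mul_zero]
      · intro hn
        exact absurd (Finset.HasAntidiagonal.mem_antidiagonal.2 (by simp)) hn
    · have := (MemLp.conj_complex ((hk'.mul_snd_pow b).memLp_rho_pow 0 j)).const_mul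
        ((-Complex.I) ^ b)
      refine (memLp_congr_ae (Eventually.of_forall fun ζ => ?_)).1 this
      simp only [map_mul, map_pow, Complex.conj_ofReal]
      ring

theorem tangentialCR_monom (l m : ℕ) (ζ : ℂ × ℂ) :
    tangentialCR (fun ζ => (rho ζ : ℂ) ^ m * (ζ.1.im : ℂ) ^ l) ζ =
      (rho ζ : ℂ) ^ m * ((l : ℂ) * (ζ.1.im : ℂ) ^ (l - 1) * (Complex.I / 2)) := by
  have d1 : DifferentiableAt ℝ (fun ζ : ℂ × ℂ => (ζ.1.im : ℂ) ^ l) ζ :=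
    ((contDiff_ofReal_im_fst (n := 1)).pow l).differentiable (by simp) ζ
  have d2 : DifferentiableAt ℝ (fun ζ : ℂ × ℂ => (rho ζ : ℂ) ^ m) ζ :=
    ((contDiff_ofReal_rho (n := 1)).pow m).differentiable (by simp) ζ
  have h1 := isDbarOp_tangentialCR.comp (fun x => x ^ l) (fun ζ => ζ.1.im) ζ (by fun_prop)
    ((contDiff_im_complex (n := 1)).comp contDiff_fst |>.differentiable (by simp) ζ)
  have h2 := isDbarOp_tangentialCR.comp (fun x => x ^ m) rho ζ (by fun_prop)
    ((contDiff_rho (n := 1)).differentiable (by simp) ζ)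
  rw [tangentialCR_im_fst] at h1
  rw [tangentialCR_rho, mul_zero] at h2
  simp only [deriv_pow_field] at h1
  push_cast at h1 h2
  rw [isDbarOp_tangentialCR.mul _ _ ζ d2 d1, h1, h2]
  ring

/-- The moments against `ρ^m conj(expInt k)` determine those against `v^l ρ^m conj(expInt k)`. -/
theorem integral_mul_monom_conj_expInt_eq_zero {n : ℕ} {F : ℂ × ℂ → ℂ} (hF : IsLAnalytic 1 n F)
    (hF2 : MemLp F 2 D2Measure)
    (h0 : ∀ m k, BoxBounded k →
      ∫ ζ in D2, F ζ * ((rho ζ : ℂ) ^ m * (starRingEnd ℂ) (expInt k ζ)) = 0)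
    (l m : ℕ) {k : ℝ × ℝ → ℂ} (hk : BoxBounded k) :
    ∫ ζ in D2, F ζ * ((rho ζ : ℂ) ^ m * ((ζ.1.im : ℂ) ^ l * (starRingEnd ℂ) (expInt k ζ))) = 0 := by
  have hmem : ∀ l k, BoxBounded k → MemLp (fun ζ => (rho ζ : ℂ) ^ m * ((ζ.1.im : ℂ) ^ l *
      (starRingEnd ℂ) (expInt k ζ))) 2 D2Measure := by
    intro l k hk
    refine (memLp_congr_ae (Eventually.of_forall fun ζ => ?_)).1
      (MemLp.conj_complex (hk.memLp_rho_pow l m))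
    simp only [map_mul, map_pow, Complex.conj_ofReal]
  induction l using Nat.strong_induction_on generalizing k with
  | _ l ih =>
    rcases l with _ | l
    · simpa using h0 m k hk
    -- The tangential derivative of `ρ^m v^l conj(expInt k')` contains `v^{l+1}` with the density
    -- `t k' = k`; the other terms have lower powers of `v`.
    obtain ⟨k', hk', e⟩ := hk.exists_mul_snd_pow_eq 1
    simp only [pow_one] at e
    have hs : ContDiffOn ℝ (⊤ : ℕ∞) (fun ζ : ℂ × ℂ => (rho ζ : ℂ) ^ m * (ζ.1.im : ℂ) ^ l) D2 :=
      ((contDiff_ofReal_rho.pow m).mul (contDiff_ofReal_im_fst.pow l)).contDiffOn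
    have hs' := contDiffOn_conj (contDiffOn_expInt hk'.admissible)
    have eP : EqOn (tangentialCR fun ζ => ((rho ζ : ℂ) ^ m * (ζ.1.im : ℂ) ^ l) *
        (starRingEnd ℂ) (expInt k' ζ)) (fun ζ =>
        (l * (Complex.I / 2)) * ((rho ζ : ℂ) ^ m * ((ζ.1.im : ℂ) ^ (l - 1) *
          (starRingEnd ℂ) (expInt k' ζ))) -
        Complex.I * ((rho ζ : ℂ) ^ m * ((ζ.1.im : ℂ) ^ l *
          (starRingEnd ℂ) (expInt (fun q => (q.1 : ℂ) * k' q) ζ))) -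
        (4 * Complex.I) * ((rho ζ : ℂ) ^ m * ((ζ.1.im : ℂ) ^ (l + 1) *
          (starRingEnd ℂ) (expInt k ζ)))) D2 := by
      intro ζ hζ
      rw [isDbarOp_tangentialCR.mul _ _ ζ (ContDiffOn.differentiableAt_D2 hs hζ)
        (ContDiffOn.differentiableAt_D2 hs' hζ), tangentialCR_monom,
        tangentialCR_conj_expInt hk'.admissible hζ, e]
      ring
    have m1 := hmem (l - 1) k' hk'
    have m2 := hmem l _ hk'.mul_fst
    have m3 := hmem (l + 1) k hk
    have h := integral_mul_tangentialCR_eq_zero hF.smooth hF2 (by simpa using hF.eq₁) (hs.mul hs')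
      (by simpa only [mul_assoc] using hmem l k' hk')
      ((memLp_congr_ae (by
        filter_upwards [ae_restrict_mem isOpen_D2.measurableSet] with ζ hζ
        exact eP hζ)).2 (((m1.const_mul _).sub (m2.const_mul _)).sub (m3.const_mul _)))
    have i1 := (hF2.integrable_mul m1).const_mul ((l * (Complex.I / 2)) : ℂ)
    have i2 := (hF2.integrable_mul m2).const_mul Complex.I
    have i3 := (hF2.integrable_mul m3).const_mul (4 * Complex.I)
    simp only [Pi.mul_apply] at i1 i2 i3
    have i12 : Integrable (fun ζ => (l * (Complex.I / 2)) * (F ζ * ((rho ζ : ℂ) ^ m *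
        ((ζ.1.im : ℂ) ^ (l - 1) * (starRingEnd ℂ) (expInt k' ζ)))) -
        Complex.I * (F ζ * ((rho ζ : ℂ) ^ m * ((ζ.1.im : ℂ) ^ l *
          (starRingEnd ℂ) (expInt (fun q => (q.1 : ℂ) * k' q) ζ))))) D2Measure := i1.sub i2
    rw [setIntegral_congr_fun isOpen_D2.measurableSet (g := fun ζ =>
        (l * (Complex.I / 2)) * (F ζ * ((rho ζ : ℂ) ^ m * ((ζ.1.im : ℂ) ^ (l - 1) *
          (starRingEnd ℂ) (expInt k' ζ)))) -
        Complex.I * (F ζ * ((rho ζ : ℂ) ^ m * ((ζ.1.im : ℂ) ^ l *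
          (starRingEnd ℂ) (expInt (fun q => (q.1 : ℂ) * k' q) ζ)))) -
        (4 * Complex.I) * (F ζ * ((rho ζ : ℂ) ^ m * ((ζ.1.im : ℂ) ^ (l + 1) *
          (starRingEnd ℂ) (expInt k ζ))))) fun ζ hζ => by
        simp only
        rw [eP hζ]; ring,
      integral_sub i12 i3, integral_sub i1 i2, integral_const_mul, integral_const_mul,
      integral_const_mul, ih l (by omega) hk'.mul_fst, mul_zero, sub_zero] at h
    have h1 : (l * (Complex.I / 2) : ℂ) * ∫ ζ in D2, F ζ * ((rho ζ : ℂ) ^ m *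
        ((ζ.1.im : ℂ) ^ (l - 1) * (starRingEnd ℂ) (expInt k' ζ))) = 0 := by
      rcases l with _ | l
      · simp
      · rw [ih _ (by omega) hk', mul_zero]
    rw [h1, zero_sub, neg_eq_zero] at h
    exact (mul_eq_zero.1 h).resolve_left (by simp)

/-! ### Completeness of the exponentials with polynomial weights -/

theorem ae_eq_zero_of_ae_ae {α β : Type*} [MeasurableSpace α] [MeasurableSpace β] {μ : Measure α}
    {ν : Measure β} [SFinite μ] [SFinite ν] {f : α × β → ℂ}
    (hf : AEStronglyMeasurable f (μ.prod ν)) (h : ∀ᵐ x ∂μ, ∀ᵐ y ∂ν, f (x, y) = 0) :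
    f =ᵐ[μ.prod ν] 0 := by
  have h0 : ∫⁻ z, ‖f z‖ₑ ∂(μ.prod ν) = 0 := by
    rw [lintegral_prod _ hf.enorm, lintegral_eq_zero_iff' hf.enorm.lintegral_prod_right']
    filter_upwards [h] with x hx
    rw [Pi.zero_apply, lintegral_congr_ae (g := fun _ => 0) (by
      filter_upwards [hx] with y hy
      rw [hy, enorm_zero]), lintegral_zero]
  rw [lintegral_eq_zero_iff' hf.enorm] at h0
  filter_upwards [h0] with z hz
  simpa using hz

theorem ae_eq_zero_of_ae_ae_symm {α β : Type*} [MeasurableSpace α] [MeasurableSpace β]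
    {μ : Measure α} {ν : Measure β} [SFinite μ] [SFinite ν] {f : α × β → ℂ}
    (hf : AEStronglyMeasurable f (μ.prod ν)) (h : ∀ᵐ y ∂ν, ∀ᵐ x ∂μ, f (x, y) = 0) :
    f =ᵐ[μ.prod ν] 0 := by
  have h1 := ae_eq_zero_of_ae_ae (f := fun z : β × α => f z.swap) (μ := ν) (ν := μ)
    (hf.comp_measurePreserving Measure.measurePreserving_swap) h
  have h2 := (Measure.measurePreserving_swap (μ := μ) (ν := ν)).quasiMeasurePreserving.ae h1
  filter_upwards [h2] with z hz
  simpa using hz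

/-- The Gaussian factor `exp(-2 t v²)` dominates `exp(|v| - p v)`; the constant comes from
completing the square. -/
theorem memLp_exp_abs_sub_sq {t : ℝ} (ht : 0 < t) (p : ℝ) :
    MemLp (fun v : ℝ => ((Real.exp (|v| - (p + 2 * t * v) * v) : ℝ) : ℂ)) 2 volume := by
  refine (memLp_exp_neg_abs.const_mul ((Real.exp ((2 + |p|) ^ 2 / (8 * t)) : ℝ) : ℂ)).mono
    (by fun_prop : Continuous _).aestronglyMeasurable (Eventually.of_forall fun v => ?_)
  rw [norm_mul, Complex.norm_real, Complex.norm_real, Complex.norm_real,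
    Real.norm_of_nonneg (Real.exp_nonneg _), Real.norm_of_nonneg (Real.exp_nonneg _),
    Real.norm_of_nonneg (Real.exp_nonneg _), ← Real.exp_add, Real.exp_le_exp]
  have h1 : -(p * v) ≤ |p| * |v| := by rw [← abs_mul]; exact neg_le_abs _
  have h2 : 0 ≤ 2 * t * (|v| - (2 + |p|) / (4 * t)) ^ 2 := by positivity
  have e : 2 * t * (|v| - (2 + |p|) / (4 * t)) ^ 2 =
      2 * t * v ^ 2 - (2 + |p|) * |v| + (2 + |p|) ^ 2 / (8 * t) := by
    rw [← sq_abs v]; field_simp; ring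
  nlinarith

theorem norm_pow_mul_le (l : ℕ) {δ : ℝ} (hδ : 0 < δ) (x : ℝ) (z : ℂ) :
    ‖(x : ℂ) ^ l * z‖ ≤ l.factorial / δ ^ l * ‖((Real.exp (δ * |x|) : ℝ) : ℂ) * z‖ := by
  rw [norm_mul, norm_mul, norm_pow, Complex.norm_real, Complex.norm_real,
    Real.norm_of_nonneg (Real.exp_nonneg _), Real.norm_eq_abs, ← mul_assoc]
  exact mul_le_mul_of_nonneg_right (pow_mul_exp_le l hδ (abs_nonneg x)) (norm_nonneg _)

/-- Completeness of the weights `v ^ l s ^ m` in a space of square integrable functions with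
Gaussian decay in `v` and exponential decay in `s`: the one-dimensional moment problem is solved
first in `s` and then in `v`. -/
theorem ae_eq_zero_of_monom_moments {t : ℝ} (ht : 0 < t) (p : ℝ) {h : ℝ × ℝ → ℂ}
    (hh : MemLp h 2 halfMeasure)
    (h0 : ∀ l m : ℕ, ∫ X : ℝ × ℝ, monom l m X.1 X.2 *
      ((Real.exp (-((p + 2 * t * X.1) * X.1) - t * X.2) : ℂ) * h X) ∂halfMeasure = 0) :
    h =ᵐ[halfMeasure] 0 := by
  set G : ℝ × ℝ → ℂ := fun X =>
    (Real.exp (-((p + 2 * t * X.1) * X.1) - t * X.2) : ℂ) * h X with hG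
  have ht2 : 0 < t / 2 := by positivity
  have hGm : AEStronglyMeasurable G halfMeasure :=
    AEStronglyMeasurable.mul (by fun_prop) hh.1
  -- The weight leaves room for the factors `exp(t s / 2)` and `exp(|v|)`, as the moment problems
  -- require.
  have hJ : Integrable (fun X : ℝ × ℝ => ((Real.exp (t / 2 * |X.2|) : ℝ) : ℂ) *
      (((Real.exp (1 * |X.1|) : ℝ) : ℂ) * G X)) halfMeasure := by
    have hT := memLp_tensor (memLp_exp_abs_sub_sq ht p) (memLp_exp_neg_mul ht2)
    refine (hT.integrable_mul hh).congr ?_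
    filter_upwards [ae_snd_pos] with X hX
    simp only [Pi.mul_apply, hG, ← Complex.ofReal_mul, ← mul_assoc, ← Real.exp_add]
    rw [abs_of_pos hX]
    congr 3
    ring
  have hI : ∀ l, Integrable (fun X : ℝ × ℝ => ((Real.exp (t / 2 * |X.2|) : ℝ) : ℂ) *
      ((X.1 : ℂ) ^ l * G X)) halfMeasure := by
    intro l
    refine (hJ.norm.const_mul (l.factorial / 1 ^ l)).mono
      (AEStronglyMeasurable.mul (by fun_prop) (AEStronglyMeasurable.mul (by fun_prop) hGm))
      (Eventually.of_forall fun X => ?_)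
    have h1 := norm_pow_mul_le l one_pos X.1 (((Real.exp (t / 2 * |X.2|) : ℝ) : ℂ) * G X)
    rw [Real.norm_of_nonneg (by positivity)]
    rwa [mul_left_comm, mul_left_comm ((Real.exp (1 * |X.1|) : ℝ) : ℂ)] at h1
  have hI2 : ∀ l m, Integrable (fun X : ℝ × ℝ => (X.2 : ℂ) ^ m * ((X.1 : ℂ) ^ l * G X))
      halfMeasure := by
    intro l m
    refine ((hI l).norm.const_mul (m.factorial / (t / 2) ^ m)).mono
      (AEStronglyMeasurable.mul (by fun_prop) (AEStronglyMeasurable.mul (by fun_prop) hGm))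
      (Eventually.of_forall fun X => ?_)
    rw [Real.norm_of_nonneg (by positivity)]
    exact norm_pow_mul_le m ht2 _ _
  have hs : ∀ l, (fun s : ℝ => ∫ v : ℝ, (v : ℂ) ^ l * G (v, s)) =ᵐ[volPos] 0 := by
    intro l
    have hi := (hI l).integral_prod_right
    simp only [integral_const_mul] at hi
    have hm : AEStronglyMeasurable (fun s : ℝ => ∫ v : ℝ, (v : ℂ) ^ l * G (v, s)) volPos := by
      have := (hI2 l 0).integral_prod_right.aestronglyMeasurable
      simpa using this
    refine ae_eq_zero_of_moments ht2 hm hi fun m => ?_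
    have h1 := integral_prod_symm _ (hI2 l m)
    simp only [integral_const_mul] at h1
    rw [← h1, ← h0 l m]
    refine integral_congr_ae (Eventually.of_forall fun X => ?_)
    simp only [monom, hG]
    ring
  have hGz : G =ᵐ[halfMeasure] 0 := by
    refine ae_eq_zero_of_ae_ae_symm hGm ?_
    have hJs := hJ.prod_left_ae
    have hJm := hGm.prod_swap.prodMk_left
    filter_upwards [ae_all_iff.2 hs, hJs, hJm] with s h1 h2 h3
    refine ae_eq_zero_of_moments (δ := 1) one_pos h3 ?_ h1
    have h4 := h2.const_mul (((Real.exp (t / 2 * |s|) : ℝ) : ℂ)⁻¹)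
    refine h4.congr (Eventually.of_forall fun v => ?_)
    have : ((Real.exp (t / 2 * |s|) : ℝ) : ℂ) ≠ 0 := by exact_mod_cast (Real.exp_pos _).ne'
    simp only
    rw [inv_mul_cancel_left₀ this]
  filter_upwards [hGz] with X hX
  simp only [hG, Pi.zero_apply, mul_eq_zero] at hX
  exact hX.resolve_left (by exact_mod_cast (Real.exp_pos _).ne')

/-- The coordinates `((p, t), (v, s))` on the part `t₂ > 0` of `𝒟`, where `t₁ = p + 2 t v` and
`t₂ = t`. -/
def flatShear : (ℝ × ℝ) × (ℝ × ℝ) ≃ᵐ (ℝ × ℝ) × (ℝ × ℝ) where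
  toFun y := ((y.1.1 + 2 * y.1.2 * y.2.1, y.2.1), (y.1.2, y.2.2))
  invFun w := ((w.1.1 - 2 * w.2.1 * w.1.2, w.2.1), (w.1.2, w.2.2))
  left_inv y := by simp
  right_inv w := by simp
  measurable_toFun := by
    change Measurable fun y : (ℝ × ℝ) × (ℝ × ℝ) =>
      ((y.1.1 + 2 * y.1.2 * y.2.1, y.2.1), (y.1.2, y.2.2))
    fun_prop
  measurable_invFun := by
    change Measurable fun w : (ℝ × ℝ) × (ℝ × ℝ) =>
      ((w.1.1 - 2 * w.2.1 * w.1.2, w.2.1), (w.1.2, w.2.2))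
    fun_prop

/-- The part of the flat domain where the frequency variable `t₂` is positive. -/
abbrev posFreq : Set ((ℝ × ℝ) × (ℝ × ℝ)) := {w | 0 < w.2.1}

theorem measurableSet_posFreq : MeasurableSet posFreq :=
  (isOpen_lt continuous_const (by fun_prop)).measurableSet

theorem measurePreserving_flatShear :
    MeasurePreserving flatShear (halfMeasure.prod halfMeasure) (flatMeasure.restrict posFreq) := by
  have h1 : MeasurePreserving (fun y : (ℝ × ℝ) × (ℝ × ℝ) => (y.1, shear y.1.1 y.2))
      (halfMeasure.prod halfMeasure) (halfMeasure.prod halfMeasure) := by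
    refine MeasurePreserving.skew_product (g := fun (X q : ℝ × ℝ) => shear X.1 q) (MeasurePreserving.id _) ?_
      (Eventually.of_forall fun X => (measurePreserving_shear X.1).map_eq)
    simp only [Function.uncurry_def, shear, MeasurableEquiv.coe_mk, Equiv.coe_fn_mk]
    fun_prop
  have h2 := Measure.measurePreserving_swap.comp (h1.comp
    (Measure.measurePreserving_swap (μ := halfMeasure) (ν := halfMeasure)))
  have h3 : MeasurePreserving rearrange (planeMeasure.prod halfMeasure) flatMeasure :=
    MeasurePreserving.symm rearrangeEquiv measurePreserving_rearrange
  have h4 := h3.restrict_preimage measurableSet_posFreq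
  have e : rearrange ⁻¹' posFreq = (univ ×ˢ Ioi (0 : ℝ)) ×ˢ univ := by
    ext y; simp [rearrange, posFreq]
  rw [e, ← Measure.prod_restrict, ← halfMeasure_eq, Measure.restrict_univ] at h4
  exact h4.comp h2

theorem conj_spectral_flatShear {l m : ℕ} (k : ℝ × ℝ → ℂ) {q : ℝ × ℝ} (hq : 0 < q.2)
    (X : ℝ × ℝ) : (starRingEnd ℂ) (spectral (monom l m) k (flatShear (q, X))) =
      (starRingEnd ℂ) (k q) * ((2 * Real.pi : ℝ) * (monom l m X.1 X.2 *
        (Real.exp (-((q.1 + 2 * q.2 * X.1) * X.1) - q.2 * X.2) : ℂ))) := by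
  simp only [spectral, flatShear, MeasurableEquiv.coe_mk, Equiv.coe_fn_mk, add_sub_cancel_right,
    indicator_of_mem (mem_Ioi.2 hq), Pi.one_apply, one_mul, monom, map_mul, map_pow,
    Complex.conj_ofReal, Prod.mk.eta]
  ring

/-- The pairing with `spectral (v ^ l s ^ m) k` as an iterated integral. -/
theorem integral_conj_spectral_mul {Q : (ℝ × ℝ) × (ℝ × ℝ) → ℂ} (hQ : MemLp Q 2 flatMeasure)
    {k : ℝ × ℝ → ℂ} (hk : BoxBounded k) (l m : ℕ) :
    Integrable (fun q => (starRingEnd ℂ) (k q) * ∫ X : ℝ × ℝ, monom l m X.1 X.2 *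
        ((Real.exp (-((q.1 + 2 * q.2 * X.1) * X.1) - q.2 * X.2) : ℂ) * Q (flatShear (q, X)))
          ∂halfMeasure) halfMeasure ∧
    ∫ w, (starRingEnd ℂ) (spectral (monom l m) k w) * Q w ∂flatMeasure =
      (2 * Real.pi : ℝ) * ∫ q, (starRingEnd ℂ) (k q) * ∫ X : ℝ × ℝ, monom l m X.1 X.2 *
        ((Real.exp (-((q.1 + 2 * q.2 * X.1) * X.1) - q.2 * X.2) : ℂ) * Q (flatShear (q, X)))
          ∂halfMeasure ∂halfMeasure := by
  have hmp := measurePreserving_flatShear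
  have hH : MemLp (fun y => Q (flatShear y)) 2 (halfMeasure.prod halfMeasure) :=
    (hQ.restrict posFreq).comp_measurePreserving hmp
  have hS : MemLp (fun y => (starRingEnd ℂ) (spectral (monom l m) k (flatShear y))) 2
      (halfMeasure.prod halfMeasure) :=
    MemLp.conj_complex (((hk.memLp_spectral l m).restrict posFreq).comp_measurePreserving hmp)
  have hi : Integrable (fun y => (starRingEnd ℂ) (spectral (monom l m) k (flatShear y)) *
      Q (flatShear y)) (halfMeasure.prod halfMeasure) := hS.integrable_mul hH
  have hq : ∀ᵐ q ∂halfMeasure, ∫ X, (starRingEnd ℂ) (spectral (monom l m) k (flatShear (q, X))) *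
      Q (flatShear (q, X)) ∂halfMeasure = (2 * Real.pi : ℝ) * ((starRingEnd ℂ) (k q) *
      ∫ X : ℝ × ℝ, monom l m X.1 X.2 *
        ((Real.exp (-((q.1 + 2 * q.2 * X.1) * X.1) - q.2 * X.2) : ℂ) * Q (flatShear (q, X)))
          ∂halfMeasure) := by
    filter_upwards [ae_snd_pos] with q hq
    rw [← integral_const_mul, ← integral_const_mul]
    refine integral_congr_ae (Eventually.of_forall fun X => ?_)
    simp only [conj_spectral_flatShear k hq]
    ring
  have hpi : ((2 * Real.pi : ℝ) : ℂ) ≠ 0 := by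
    exact_mod_cast (by positivity : (2 * Real.pi : ℝ) ≠ 0)
  constructor
  · have h1 := (hi.integral_prod_left.congr hq).const_mul (((2 * Real.pi : ℝ) : ℂ)⁻¹)
    refine h1.congr (Eventually.of_forall fun q => ?_)
    simp only
    rw [inv_mul_cancel_left₀ hpi]
  · rw [← setIntegral_eq_integral_of_forall_compl_eq_zero (s := posFreq) (fun w hw => by
        rw [spectral, indicator_of_notMem (by exact hw), zero_mul, map_zero, zero_mul]),
      ← hmp.integral_comp flatShear.measurableEmbedding (fun w =>
        (starRingEnd ℂ) (spectral (monom l m) k w) * Q w), integral_prod _ hi,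
      integral_congr_ae hq, integral_const_mul]

/-- The indicator function of a measurable part of a compact box. -/
theorem boxBounded_indicator {A : Set (ℝ × ℝ)} (hA : MeasurableSet A) {R : ℝ} (hR : 1 ≤ R) :
    BoxBounded ((A ∩ (Icc (-R) R ×ˢ Icc R⁻¹ R)).indicator 1) := by
  refine ⟨measurable_one.indicator (hA.inter (measurableSet_Icc.prod measurableSet_Icc)), R,
    by linarith, fun q => ⟨?_, fun h => ?_⟩⟩
  · by_cases hq : q ∈ A ∩ (Icc (-R) R ×ˢ Icc R⁻¹ R)
    · rw [indicator_of_mem hq]; simpa using hR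
    · rw [indicator_of_notMem hq]; simp; linarith
  · have hq := mem_of_indicator_ne_zero h
    exact ⟨abs_le.2 hq.2.1, hq.2.2⟩

/-- The class of densities separates functions, since it contains the indicator functions of the
measurable subsets of compact boxes. -/
theorem ae_eq_zero_of_boxBounded {M : ℝ × ℝ → ℂ}
    (hi : ∀ k, BoxBounded k → Integrable (fun q => (starRingEnd ℂ) (k q) * M q) halfMeasure)
    (h0 : ∀ k, BoxBounded k → ∫ q, (starRingEnd ℂ) (k q) * M q ∂halfMeasure = 0) :
    M =ᵐ[halfMeasure] 0 := by
  have hbox : ∀ n : ℕ, ∀ᵐ q ∂halfMeasure,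
      q ∈ Icc (-((n : ℝ) + 1)) (n + 1) ×ˢ Icc ((n : ℝ) + 1)⁻¹ (n + 1) → M q = 0 := by
    intro n
    have hn : (1 : ℝ) ≤ (n : ℝ) + 1 := by linarith [n.cast_nonneg (α := ℝ)]
    set B := Icc (-((n : ℝ) + 1)) (n + 1) ×ˢ Icc ((n : ℝ) + 1)⁻¹ ((n : ℝ) + 1) with hB
    have hBm : MeasurableSet B := measurableSet_Icc.prod measurableSet_Icc
    have e : ∀ A : Set (ℝ × ℝ), (fun q => (starRingEnd ℂ) ((A ∩ B).indicator 1 q) * M q) =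
        (A ∩ B).indicator M := by
      intro A
      funext q
      by_cases hq : q ∈ A ∩ B <;> simp [hq]
    have h1 : Integrable (B.indicator M) halfMeasure := by
      have := hi _ (boxBounded_indicator MeasurableSet.univ hn)
      rw [e, univ_inter] at this
      exact this
    have h2 := h1.ae_eq_zero_of_forall_setIntegral_eq_zero fun A hA _ => by
      have := h0 _ (boxBounded_indicator hA hn)
      rw [e, integral_indicator (hA.inter hBm)] at this
      rw [setIntegral_indicator hBm, this]
    filter_upwards [h2] with q hq hqB
    rwa [indicator_of_mem hqB] at hq
  filter_upwards [ae_all_iff.2 hbox, ae_snd_pos] with q hq hpos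
  obtain ⟨n1, h1⟩ := exists_nat_ge (|q.1| + q.2)
  obtain ⟨n2, h2⟩ := exists_nat_one_div_lt hpos
  have a1 := abs_nonneg q.1
  have hn1 : (n1 : ℝ) ≤ (max n1 n2 : ℕ) := by exact_mod_cast le_max_left _ _
  have hn2 : (n2 : ℝ) ≤ (max n1 n2 : ℕ) := by exact_mod_cast le_max_right _ _
  refine hq (max n1 n2) ⟨abs_le.1 (by linarith), ?_, by linarith⟩
  refine le_trans ?_ h2.le
  rw [← one_div]
  exact one_div_le_one_div_of_le (by positivity) (by linarith)

/-- Almost all slices of a square integrable function are square integrable. -/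
theorem MemLp.ae_prod_right {α β : Type*} [MeasurableSpace α] [MeasurableSpace β] {μ : Measure α}
    {ν : Measure β} [SFinite μ] [SFinite ν] {f : α × β → ℂ} (hf : MemLp f 2 (μ.prod ν)) :
    ∀ᵐ x ∂μ, MemLp (fun y => f (x, y)) 2 ν := by
  have h1 := ((memLp_two_iff_integrable_sq_norm hf.1).1 hf).prod_right_ae
  filter_upwards [h1, hf.1.prodMk_left] with x hx hx'
  exact (memLp_two_iff_integrable_sq_norm hx').2 hx

/-- The functions `spectral (v ^ l s ^ m) k` are complete in the part `t₂ > 0` of `L²(𝒟)`. -/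
theorem ae_eq_zero_of_integral_conj_spectral {Q : (ℝ × ℝ) × (ℝ × ℝ) → ℂ}
    (hQ : MemLp Q 2 flatMeasure) (h : ∀ l m k, BoxBounded k →
      ∫ w, (starRingEnd ℂ) (spectral (monom l m) k w) * Q w ∂flatMeasure = 0) :
    ∀ᵐ w ∂flatMeasure, 0 < w.2.1 → Q w = 0 := by
  have hmp := measurePreserving_flatShear
  have hH : MemLp (fun y => Q (flatShear y)) 2 (halfMeasure.prod halfMeasure) :=
    (hQ.restrict posFreq).comp_measurePreserving hmp
  have hpi : ((2 * Real.pi : ℝ) : ℂ) ≠ 0 := by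
    exact_mod_cast (by positivity : (2 * Real.pi : ℝ) ≠ 0)
  have h1 : ∀ l m, ∀ᵐ q ∂halfMeasure, ∫ X : ℝ × ℝ, monom l m X.1 X.2 *
        ((Real.exp (-((q.1 + 2 * q.2 * X.1) * X.1) - q.2 * X.2) : ℂ) * Q (flatShear (q, X)))
          ∂halfMeasure = 0 := fun l m =>
    ae_eq_zero_of_boxBounded (fun k hk => (integral_conj_spectral_mul hQ hk l m).1) fun k hk => by
      have := h l m k hk
      rw [(integral_conj_spectral_mul hQ hk l m).2] at this
      exact (mul_eq_zero.1 this).resolve_left hpi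
  have h2 : (fun y => Q (flatShear y)) =ᵐ[halfMeasure.prod halfMeasure] 0 := by
    refine ae_eq_zero_of_ae_ae hH.1 ?_
    filter_upwards [ae_all_iff.2 fun l => ae_all_iff.2 (h1 l), MemLp.ae_prod_right hH, ae_snd_pos]
      with q hq hq2 hpos
    exact ae_eq_zero_of_monom_moments hpos q.1 hq2 hq
  have h3 : ∀ᵐ w ∂(flatMeasure.restrict posFreq), Q w = 0 := by
    rw [← hmp.map_eq]
    exact (flatShear.measurableEmbedding.ae_map_iff).2 h2
  exact (ae_restrict_iff' measurableSet_posFreq).1 h3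

/-- `U₁ U₀` preserves inner products, in terms of representatives. -/
theorem integral_conj_mul_opU1_opU0 {Ψ F : ℂ × ℂ → ℂ} {Gh : (ℝ × ℝ) × (ℝ × ℝ) → ℂ}
    (hΨ : MemLp Ψ 2 D2Measure) (e : opU1 (opU0 (hΨ.toLp Ψ)) =ᵐ[flatMeasure] Gh) {f : L2D}
    (hf : f =ᵐ[D2Measure] F) :
    ∫ w, (starRingEnd ℂ) (Gh w) * opU1 (opU0 f) w ∂flatMeasure =
      ∫ ζ in D2, F ζ * (starRingEnd ℂ) (Ψ ζ) := by
  have h1 : inner ℂ (opU1 (opU0 (hΨ.toLp Ψ))) (opU1 (opU0 f)) = inner ℂ (hΨ.toLp Ψ) f := by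
    rw [LinearIsometryEquiv.inner_map_map, LinearIsometry.inner_map_map]
  rw [L2.inner_def, L2.inner_def] at h1
  refine Eq.trans (integral_congr_ae ?_) (h1.trans (integral_congr_ae ?_))
  · filter_upwards [e] with w hw
    rw [hw, RCLike.inner_apply, mul_comm]
  · filter_upwards [hf, hΨ.coeFn_toLp] with ζ h1 h2
    rw [h1, h2, RCLike.inner_apply]

theorem measurePreserving_negFreq : MeasurePreserving negFreq flatMeasure flatMeasure := by
  have h := Measure.measurePreserving_neg (volume : Measure ℝ)
  exact (h.prod (MeasurePreserving.id (volume : Measure ℝ))).prod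
    (h.prod (MeasurePreserving.id volPos))

theorem negFreq_negFreq (w : (ℝ × ℝ) × (ℝ × ℝ)) : negFreq (negFreq w) = w := by
  simp [negFreq]

theorem measurableEmbedding_negFreq : MeasurableEmbedding negFreq :=
  (MeasurableEquiv.mk ⟨negFreq, negFreq, negFreq_negFreq, negFreq_negFreq⟩
    measurePreserving_negFreq.measurable measurePreserving_negFreq.measurable).measurableEmbedding

theorem BoxBounded.exists_opU1_opU0_conj_eq {k : ℝ × ℝ → ℂ} (hk : BoxBounded k) (l m : ℕ) :
    ∃ h : MemLp (fun ζ => (starRingEnd ℂ) (monom l m ζ.1.im (rho ζ) * expInt k ζ)) 2 D2Measure,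
      opU1 (opU0 (h.toLp _)) =ᵐ[flatMeasure] fun w =>
        (starRingEnd ℂ) (spectral (monom l m) k (negFreq w)) :=
  SliceFourier.exists_opU1_opU0_eq
    (sliceFourier_spectral hk.admissible (monom l m)).conj
    (contDiffOn_conj (contDiffOn_monom_mul_expInt hk.admissible l m)).continuousOn
    (MemLp.conj_complex ((hk.memLp_spectral l m).comp_measurePreserving measurePreserving_negFreq))

/-- A function in `A²_{(1,n)}(D₂)` vanishes if it is orthogonal to the functions `ρ^m expInt k` with
`m < n`; the orthogonality is expressed in terms of the images under `U₁ U₀`. -/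
theorem eq_zero_of_mem_polyBergman {n : ℕ} {f : L2D} (hf : f ∈ polyBergman 1 n)
    (h0 : ∀ m < n, ∀ k, BoxBounded k →
      ∫ w, (starRingEnd ℂ) (spectral (monom 0 m) k w) * opU1 (opU0 f) w ∂flatMeasure = 0) :
    f = 0 := by
  obtain ⟨F, hF, hfF⟩ := hf
  have hF2 : MemLp F 2 D2Measure := (memLp_congr_ae hfF).1 (Lp.memLp f)
  set Q := opU1 (opU0 f) with hQ
  have hQ2 : MemLp Q 2 flatMeasure := Lp.memLp Q
  have e : ∀ l m k, BoxBounded k →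
      ∫ w, (starRingEnd ℂ) (spectral (monom l m) k w) * Q w ∂flatMeasure =
      ∫ ζ in D2, F ζ * ((rho ζ : ℂ) ^ m * ((ζ.1.im : ℂ) ^ l * (starRingEnd ℂ) (expInt k ζ))) := by
    intro l m k hk
    obtain ⟨h, e⟩ := hk.exists_opU1_opU0_eq l m
    rw [integral_conj_mul_opU1_opU0 h e hfF]
    congr 1
    funext ζ
    simp only [monom, map_mul, map_pow, Complex.conj_ofReal]
    ring
  -- Positive frequencies: the recursions extend the hypothesis to all moments.
  have hpos : ∀ l m k, BoxBounded k →
      ∫ w, (starRingEnd ℂ) (spectral (monom l m) k w) * Q w ∂flatMeasure = 0 := by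
    intro l m k hk
    rw [e l m k hk]
    refine integral_mul_monom_conj_expInt_eq_zero hF hF2 (fun m k hk => ?_) l m hk
    refine integral_mul_rho_pow_conj_expInt_eq_zero hF hF2 (fun m hm k hk => ?_) m hk
    have := h0 m hm k hk
    rw [e 0 m k hk] at this
    simpa using this
  -- Negative frequencies: the moments vanish for every function in the space.
  have hneg : ∀ l m k, BoxBounded k →
      ∫ w, (starRingEnd ℂ) (spectral (monom l m) k w) * (starRingEnd ℂ) (Q (negFreq w))
        ∂flatMeasure = 0 := by
    intro l m k hk
    obtain ⟨h, e⟩ := hk.exists_opU1_opU0_conj_eq l m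
    have h1 := integral_conj_mul_opU1_opU0 h e hfF
    have h2 : ∫ ζ in D2, F ζ * (starRingEnd ℂ) ((starRingEnd ℂ)
        (monom l m ζ.1.im (rho ζ) * expInt k ζ)) = 0 := by
      rw [← integral_mul_rho_pow_mul_expInt_eq_zero hF hF2 hk l m]
      congr 1
      funext ζ
      rw [Complex.conj_conj, monom]
      ring
    rw [h2] at h1
    rw [← measurePreserving_negFreq.integral_comp measurableEmbedding_negFreq] at h1
    simp only [negFreq_negFreq, Complex.conj_conj] at h1
    have h3 := congrArg (starRingEnd ℂ) h1
    rw [← integral_conj, map_zero] at h3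
    simpa only [map_mul] using h3
  have z1 := ae_eq_zero_of_integral_conj_spectral hQ2 hpos
  have z2 := ae_eq_zero_of_integral_conj_spectral (Q := fun w => (starRingEnd ℂ) (Q (negFreq w)))
    (MemLp.conj_complex (hQ2.comp_measurePreserving measurePreserving_negFreq)) hneg
  have z2' := measurePreserving_negFreq.quasiMeasurePreserving.ae z2
  have hQ0 : Q = 0 := by
    apply Lp.ext
    filter_upwards [z1, z2', Lp.coeFn_zero ℂ 2 flatMeasure,
      (Measure.quasiMeasurePreserving_snd (μ := (volume : Measure ℝ).prod volume)
      (ν := (volume : Measure ℝ).prod volPos)).ae ae_ne_zero_fst] with w h1 h2 h3 h4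
    rw [h3, Pi.zero_apply]
    rcases lt_or_gt_of_ne h4 with h | h
    · have := h2 (by simpa [negFreq] using h)
      rwa [negFreq_negFreq, map_eq_zero] at this
    · exact h1 h
  have h1 : opU0 f = 0 := by
    apply opU1.injective
    rw [map_zero]; exact hQ0
  apply opU0.injective
  rw [map_zero]; exact h1

/-! ### The range of `R₀` -/

theorem opV2_opV1_ae {y : L2Flat} {Gh : (ℝ × ℝ) × (ℝ × ℝ) → ℂ} (hy : y =ᵐ[flatMeasure] Gh) :
    opV2 (opV1 y) =ᵐ[flatMeasure] fun z =>
      ((1 / √(2 * |z.2.1|) : ℝ) : ℂ) * Gh (psi1 (psi2 z)) := by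
  have h1 : opV1 y =ᵐ[flatMeasure] fun ξ => ((1 / √(2 * |ξ.2.1|) : ℝ) : ℂ) * Gh (psi1 ξ) := by
    refine (weightedComp_ae _ _ _ _).trans ?_
    filter_upwards [isWeighted_psi1.quasi.ae_eq_comp hy] with ξ hξ
    simp only [Function.comp] at hξ
    rw [hξ]
  refine (weightedComp_ae _ _ _ _).trans ?_
  filter_upwards [measurePreserving_psi2.quasiMeasurePreserving.ae_eq_comp h1] with z hz
  simp only [Function.comp] at hz
  rw [hz, Complex.ofReal_one, one_mul]
  rfl

/-- Square integrability can be tested after applying `V₂ V₁`. -/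
theorem memLp_of_memLp_comp_psi {Gh : (ℝ × ℝ) × (ℝ × ℝ) → ℂ}
    (hG : AEStronglyMeasurable Gh flatMeasure)
    (h : MemLp (fun z => ((1 / √(2 * |z.2.1|) : ℝ) : ℂ) * Gh (psi1 (psi2 z))) 2 flatMeasure) :
    MemLp Gh 2 flatMeasure := by
  refine ⟨hG, ?_⟩
  rw [← isWeighted_psi1.eLpNorm_eq hG, ← measurePreserving_psi2.map_eq, eLpNorm_map_measure]
  · exact h.2
  · rw [measurePreserving_psi2.map_eq]
    exact (Complex.measurable_ofReal.comp isWeighted_psi1.measurable_weight).aestronglyMeasurable.mul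
      (hG.comp_quasiMeasurePreserving isWeighted_psi1.quasi)
  · exact measurePreserving_psi2.measurable.aemeasurable

/-- In the coordinates `z`, the exponential factor separates into `e^{x₁²/2} e^{-y₁²/2} e^{-y₂/2}`,
and the density depends on `(x₁, x₂)` only. -/
theorem spectral_psi (b : ℝ → ℝ → ℂ) (k : ℝ × ℝ → ℂ) {z : (ℝ × ℝ) × (ℝ × ℝ)} (hz : 0 < z.2.1) :
    spectral b k (psi1 (psi2 z)) = (2 * Real.pi : ℝ) *
      b (1 / (2 * √z.2.1) * (-z.1.1 + z.1.2)) (z.2.2 / (2 * z.2.1)) *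
      (Real.exp ((z.1.1 ^ 2 - z.1.2 ^ 2 - z.2.2) / 2) : ℂ) * k (2 * √z.2.1 * z.1.1, z.2.1) := by
  obtain ⟨⟨x₁, y₁⟩, ⟨x₂, y₂⟩⟩ := z
  simp only at hz
  have hr : 0 < √x₂ := Real.sqrt_pos.2 hz
  have hr2 : √x₂ * √x₂ = x₂ := Real.mul_self_sqrt hz.le
  have e1 : √x₂ * (x₁ + y₁) - 2 * x₂ * (1 / (2 * √x₂) * (-x₁ + y₁)) = 2 * √x₂ * x₁ := by
    rw [← hr2]; field_simp; rw [Real.sqrt_sq hr.le]; ring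
  have e2 : -(√x₂ * (x₁ + y₁) * (1 / (2 * √x₂) * (-x₁ + y₁))) - x₂ * (y₂ / (2 * x₂)) =
      (x₁ ^ 2 - y₁ ^ 2 - y₂) / 2 := by
    field_simp; ring
  simp only [spectral, psi1, psi2, abs_of_pos hz, indicator_of_mem (mem_Ioi.2 hz), Pi.one_apply,
    one_mul, e1, e2]

theorem spectral_psi_of_nonpos (b : ℝ → ℝ → ℂ) (k : ℝ × ℝ → ℂ) {z : (ℝ × ℝ) × (ℝ × ℝ)}
    (hz : ¬ 0 < z.2.1) : spectral b k (psi1 (psi2 z)) = 0 := by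
  rw [spectral, indicator_of_notMem (by exact hz), zero_mul]

theorem hermiteFun0_eq (y : ℝ) :
    Real.exp (-y ^ 2 / 2) = √(√Real.pi) * hermiteFun0 y := by
  have : 0 < √(√Real.pi) := by have := Real.pi_pos; positivity
  rw [hermiteFun0]; field_simp

/-- Substituting `(x₁, x₂) ↦ (2 √x₂ x₁, x₂)` preserves the class of densities. -/
theorem BoxBounded.comp_dilation {k : ℝ × ℝ → ℂ} (hk : BoxBounded k) :
    BoxBounded fun x => k (2 * √x.2 * x.1, x.2) := by
  obtain ⟨R, hR, h⟩ := hk.exists_bound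
  refine ⟨hk.measurable.comp (by fun_prop), R + R * √R, by positivity, fun q => ⟨?_, fun hq => ?_⟩⟩
  · exact (h _).1.trans (by have := Real.sqrt_nonneg R; nlinarith)
  · obtain ⟨h1, h2, h3⟩ := (h _).2 hq
    simp only at h1 h2 h3
    have hle : R ≤ R + R * √R := by have := Real.sqrt_nonneg R; nlinarith
    refine ⟨?_, (inv_anti₀ hR hle).trans h2, h3.trans hle⟩
    have hq2 : 0 < q.2 := (inv_pos.2 hR).trans_le h2
    have hs : (√R)⁻¹ ≤ √q.2 := by
      rw [← Real.sqrt_inv]; exact Real.sqrt_le_sqrt h2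
    have hR' : 0 < √R := Real.sqrt_pos.2 hR
    rw [abs_mul, abs_of_nonneg (by positivity : 0 ≤ 2 * √q.2)] at h1
    have h4 : (√R)⁻¹ * |q.1| ≤ R := by
      have : (√R)⁻¹ * |q.1| ≤ √q.2 * |q.1| := by gcongr
      nlinarith [mul_nonneg (Real.sqrt_nonneg q.2) (abs_nonneg q.1)]
    rw [inv_mul_le_iff₀ hR'] at h4
    linarith

/-- The functions `ρ^m expInt k` with `m < n` are mapped by `U` into the range of `R₀`: the image
is `h₀(y₁) y₂^m e^{-y₂/2}` times a function of `(x₁, x₂)`, and `y₂^m e^{-y₂/2}` is a combination of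
`ℓ_0, …, ℓ_m`. -/
theorem BoxBounded.exists_opR0_eq {k : ℝ × ℝ → ℂ} (hk : BoxBounded k) {n m : ℕ} (hm : m < n)
    {y : L2Flat} (hy : y =ᵐ[flatMeasure] spectral (monom 0 m) k) :
    ∃ g : L2Half n, opR0 n g = opV2 (opV1 y) := by
  obtain ⟨μ, hμ⟩ := exists_pow_mul_exp_eq m
  have hκ := hk.comp_dilation.mul
    (m := fun x : ℝ × ℝ => ((2 * Real.pi * √(√Real.pi) * (√(2 * x.2))⁻¹ * ((2 * x.2)⁻¹) ^ m *
      Real.exp (x.1 ^ 2 / 2) : ℝ) : ℂ)) (by fun_prop) fun R hR =>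
    ⟨2 * Real.pi * √(√Real.pi) * (√(2 * R⁻¹))⁻¹ * ((2 * R⁻¹)⁻¹) ^ m * Real.exp (R ^ 2 / 2),
      fun q h1 h2 _ => by
        have hq : 0 < q.2 := (inv_pos.2 hR).trans_le h2
        have : q.1 ^ 2 ≤ R ^ 2 := sq_le_sq' (abs_le.1 h1).1 (abs_le.1 h1).2
        rw [Complex.norm_real, Real.norm_of_nonneg (by positivity)]
        gcongr⟩
  set κ : ℝ × ℝ → ℂ := fun x => ((2 * Real.pi * √(√Real.pi) * (√(2 * x.2))⁻¹ * ((2 * x.2)⁻¹) ^ m *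
      Real.exp (x.1 ^ 2 / 2) : ℝ) : ℂ) * k (2 * √x.2 * x.1, x.2) with hκd
  have hκ2 : MemLp κ 2 halfMeasure := hκ.memLp 2
  let ν : ℕ → ℝ := fun j => if j ≤ m then μ j else 0
  let g : L2Half n := WithLp.toLp 2 fun j : Fin n => (ν j : ℂ) • hκ2.toLp κ
  have hg : ∀ j : Fin n, g j =ᵐ[halfMeasure] fun x => (ν j : ℂ) * κ x := by
    intro j
    filter_upwards [Lp.coeFn_smul (ν j : ℂ) (hκ2.toLp κ), hκ2.coeFn_toLp] with x h1 h2
    change ((ν j : ℂ) • hκ2.toLp κ : Lp ℂ 2 halfMeasure) x = _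
    rw [h1, Pi.smul_apply, h2, smul_eq_mul]
  refine ⟨g, ?_⟩
  apply Lp.ext
  refine (opR0_ae n g).trans (EventuallyEq.trans ?_ (opV2_opV1_ae hy).symm)
  have hgz := ae_zeroExt (ae_all_iff.2 hg)
  have hgf := measurePreserving_rearrange.quasiMeasurePreserving.ae
    ((Measure.quasiMeasurePreserving_fst (ν := halfMeasure)).ae hgz)
  filter_upwards [hgf] with z hz
  by_cases hx : 0 < z.2.1
  · have hz' : ∀ j : Fin n, g j (z.1.1, z.2.1) = (ν j : ℂ) * κ (z.1.1, z.2.1) :=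
      hz ⟨mem_univ _, hx⟩
    simp only [hz', indicator_of_mem (mem_Ioi.2 hx), Pi.one_apply, one_mul]
    rw [spectral_psi _ _ hx]
    have e1 : ∑ j : Fin n, (laguerreFun j z.2.2 : ℂ) * ((ν j : ℂ) * κ (z.1.1, z.2.1)) =
        ((z.2.2 ^ m * Real.exp (-z.2.2 / 2) : ℝ) : ℂ) * κ (z.1.1, z.2.1) := by
      rw [hμ, Finset.sum_fin_eq_sum_range]
      push_cast
      rw [Finset.sum_mul]
      symm
      refine Finset.sum_subset_zero_on_sdiff (Finset.range_subset_range.2 hm) ?_ ?_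
      · intro j hj
        simp only [Finset.mem_sdiff, Finset.mem_range, not_lt] at hj
        rw [dif_pos hj.1]
        simp only [ν]
        rw [if_neg (by omega)]
        simp
      · intro j hj
        have hj' := Finset.mem_range.1 hj
        rw [dif_pos (by omega)]
        simp only [ν]
        rw [if_pos (by omega)]
        ring
    have e2 : (Real.exp ((z.1.1 ^ 2 - z.1.2 ^ 2 - z.2.2) / 2) : ℂ) =
        ((Real.exp (z.1.1 ^ 2 / 2) * (√(√Real.pi) * hermiteFun0 z.1.2) * Real.exp (-z.2.2 / 2) : ℝ)
          : ℂ) := by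
      rw [← hermiteFun0_eq, ← Real.exp_add, ← Real.exp_add]
      congr 2; ring
    rw [e1, e2, hκd]
    simp only [monom, pow_zero, one_mul, abs_of_pos hx]
    push_cast
    have h1 : ((√(2 * z.2.1) : ℝ) : ℂ) ≠ 0 := by
      exact_mod_cast (Real.sqrt_pos.2 (by positivity)).ne'
    rw [div_pow, inv_pow]
    field_simp
  · rw [spectral_psi_of_nonpos _ _ hx, indicator_of_notMem (by exact hx)]
    simp

/-- `R` is injective on `A²_{(1,n)}(D₂)`. -/
theorem eq_zero_of_opR_eq_zero {n : ℕ} {f : L2D} (hf : f ∈ polyBergman 1 n) (h : opR n f = 0) :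
    f = 0 := by
  refine eq_zero_of_mem_polyBergman hf fun m hm k hk => ?_
  have hs := hk.memLp_spectral 0 m
  obtain ⟨y, hy⟩ : ∃ y : L2Flat, y =ᵐ[flatMeasure] spectral (monom 0 m) k :=
    ⟨hs.toLp _, hs.coeFn_toLp⟩
  obtain ⟨g, hg⟩ := hk.exists_opR0_eq hm hy
  have h1 : inner ℂ y (opU1 (opU0 f)) = 0 := by
    have e : opR n f = ContinuousLinearMap.adjoint (opR0 n) (opV2 (opV1 (opU1 (opU0 f)))) := rfl
    rw [← opV1.inner_map_map, ← opV2.inner_map_map, ← hg,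
      ← ContinuousLinearMap.adjoint_inner_right, ← e, h, inner_zero_right]
  rw [L2.inner_def] at h1
  rw [← h1]
  refine integral_congr_ae ?_
  filter_upwards [hy] with w hw
  rw [hw, RCLike.inner_apply, mul_comm]

/-! ### The preimage of the range of `R₀` -/

/-- `(p, t) ↦ (p / (2 √t), t)`. -/
def dilate (q : ℝ × ℝ) : ℝ × ℝ := ((2 * √q.2)⁻¹ * q.1, q.2)

theorem measurable_dilate : Measurable dilate := by unfold dilate; fun_prop

/-- The square root of the Jacobian makes the substitution `dilate` an isometry of `L²(ℝ × ℝ₊)`. -/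
theorem isWeighted_dilate :
    IsWeighted (fun q : ℝ × ℝ => √((2 * √q.2)⁻¹)) dilate halfMeasure halfMeasure := by
  have hw : Measurable (fun q : ℝ × ℝ => √((2 * √q.2)⁻¹)) := by fun_prop
  refine .of_ae_ne_zero hw measurable_dilate ?_ fun f hf => ?_
  · filter_upwards [ae_snd_pos] with q hq
    positivity
  · rw [lintegral_prod_symm _ (by
        exact ((hw.pow_const 2).ennreal_ofReal.mul (hf.comp measurable_dilate)).aemeasurable),
      lintegral_prod_symm _ hf.aemeasurable]
    refine lintegral_congr_ae ?_
    filter_upwards [ae_restrict_mem measurableSet_Ioi] with t ht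
    have ht' : 0 < (2 * √t)⁻¹ := by
      have := Real.sqrt_pos.2 (mem_Ioi.1 ht); positivity
    exact (isWeighted_dilation ht').lintegral_eq (fun x => f (x, t)) (by fun_prop)

theorem measurePreserving_sqrt_shear (v : ℝ) :
    MeasurePreserving (fun q : ℝ × ℝ => (q.1 + 2 * √q.2 * v, q.2)) halfMeasure halfMeasure := by
  have hg : MeasurePreserving (fun p : ℝ × ℝ => (p.1, p.2 + 2 * √p.1 * v))
      (volPos.prod (volume : Measure ℝ)) (volPos.prod (volume : Measure ℝ)) := by
    refine MeasurePreserving.skew_product (g := fun t p => p + 2 * √t * v)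
      (MeasurePreserving.id _) ?_ ?_
    · simp only [Function.uncurry_def]; fun_prop
    · exact Eventually.of_forall fun t => (measurePreserving_add_right (volume : Measure ℝ) _).map_eq
  exact Measure.measurePreserving_swap.comp (hg.comp Measure.measurePreserving_swap)

theorem memLp_gaussian : MemLp (fun x : ℝ => ((Real.exp (-x ^ 2 / 2) : ℝ) : ℂ)) 2 volume := by
  refine (memLp_hermiteFun0.const_mul ((√(√Real.pi) : ℝ) : ℂ)).congr_norm
    (by fun_prop : Continuous _).aestronglyMeasurable (Eventually.of_forall fun x => ?_)
  rw [hermiteFun0_eq, Complex.ofReal_mul]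

theorem memLp_mul_exp_neg {δ : ℝ} (hδ : 0 < δ) :
    MemLp (fun t : ℝ => ((t * Real.exp (-(δ * t)) : ℝ) : ℂ)) 2 volPos := by
  have hδ2 : 0 < δ / 2 := by positivity
  refine ((memLp_exp_neg_mul hδ2).const_mul ((1 / (δ / 2) : ℝ) : ℂ)).mono
    (by fun_prop : Continuous _).aestronglyMeasurable ?_
  filter_upwards [ae_restrict_mem measurableSet_Ioi] with t ht
  have ht' : 0 < t := ht
  have h := pow_mul_exp_le 1 hδ2 ht'.le
  simp only [pow_one, Nat.factorial_one, Nat.cast_one] at h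
  rw [← Complex.ofReal_mul, Complex.norm_real, Complex.norm_real, Real.norm_of_nonneg (by positivity),
    Real.norm_of_nonneg (by positivity)]
  calc t * Real.exp (-(δ * t)) ≤ (1 / (δ / 2) * Real.exp (δ / 2 * t)) * Real.exp (-(δ * t)) := by
        gcongr
    _ = 1 / (δ / 2) * Real.exp (-(δ / 2 * t)) := by
        rw [mul_assoc, ← Real.exp_add]; congr 2; ring

/-- The density `k` for which the image of `expInt k` under `U` is, up to a constant,
`h₀(y₁) e^{-y₂/2} g(x₁, x₂)`. -/
def gaussDensity (g : ℝ × ℝ → ℂ) (q : ℝ × ℝ) : ℂ :=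
  ((√(2 * q.2) * Real.exp (-q.1 ^ 2 / (8 * q.2)) : ℝ) : ℂ) * g (dilate q)

/-- The Cauchy-Schwarz inequality yields the convergence of `expInt (gaussDensity g)`. -/
theorem admissible_gaussDensity {g : ℝ × ℝ → ℂ} (hg : MemLp g 2 halfMeasure) :
    Admissible (gaussDensity g) := by
  intro v σ h
  have hδ : 0 < σ - 2 * v ^ 2 := by linarith
  have h1 := (memLp_tensor memLp_gaussian (memLp_mul_exp_neg hδ)).comp_measurePreserving
    (measurePreserving_sqrt_shear v)
  have h2 := isWeighted_dilate.memLp (h1.const_mul ((2 * √2 : ℝ) : ℂ))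
  refine (h2.integrable_mul (isWeighted_dilate.memLp hg)).congr ?_
  filter_upwards [ae_snd_pos] with q hq
  obtain ⟨p, t⟩ := q
  simp only at hq
  have hr : 0 < √t := Real.sqrt_pos.2 hq
  have hr2 : √t ^ 2 = t := Real.sq_sqrt hq.le
  have hw : √((2 * √t)⁻¹) * √((2 * √t)⁻¹) = (2 * √t)⁻¹ := Real.mul_self_sqrt (by positivity)
  have e1 : -((2 * √t)⁻¹ * p + 2 * √t * v) ^ 2 / 2 + -((σ - 2 * v ^ 2) * t) =
      (-(p * v) - t * σ) + -p ^ 2 / (8 * t) := by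
    field_simp
    rw [hr2]
    ring
  have e2 : √((2 * √t)⁻¹) * (2 * √2 * (Real.exp (-((2 * √t)⁻¹ * p + 2 * √t * v) ^ 2 / 2) *
      (t * Real.exp (-((σ - 2 * v ^ 2) * t))))) * √((2 * √t)⁻¹) =
      Real.exp (-(p * v) - t * σ) * (√(2 * t) * Real.exp (-p ^ 2 / (8 * t))) := by
    have : Real.exp (-((2 * √t)⁻¹ * p + 2 * √t * v) ^ 2 / 2) * Real.exp (-((σ - 2 * v ^ 2) * t)) =
        Real.exp (-(p * v) - t * σ) * Real.exp (-p ^ 2 / (8 * t)) := by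
      rw [← Real.exp_add, e1, Real.exp_add]
    have h3 : (2 * √t)⁻¹ * (2 * √2 * t) = √(2 * t) := by
      rw [Real.sqrt_mul (by norm_num), ← hr2, Real.sqrt_sq hr.le]; field_simp
    calc _ = (√((2 * √t)⁻¹) * √((2 * √t)⁻¹)) * (2 * √2 * t) *
        (Real.exp (-((2 * √t)⁻¹ * p + 2 * √t * v) ^ 2 / 2) *
          Real.exp (-((σ - 2 * v ^ 2) * t))) := by ring
      _ = _ := by rw [hw, this, h3]; ring
  simp only [Pi.mul_apply, Function.comp, dilate, gaussDensity]
  have e3 := congrArg (fun x : ℝ => (x : ℂ)) e2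
  push_cast at e3 ⊢
  linear_combination (g ((2 * √t)⁻¹ * p, t)) * e3

theorem gaussDensity_apply (g : ℝ × ℝ → ℂ) {x : ℝ × ℝ} (hx : 0 < x.2) :
    gaussDensity g (2 * √x.2 * x.1, x.2) =
      ((√(2 * x.2) * Real.exp (-x.1 ^ 2 / 2) : ℝ) : ℂ) * g x := by
  have hr : 0 < √x.2 := Real.sqrt_pos.2 hx
  have e1 : (2 * √x.2)⁻¹ * (2 * √x.2 * x.1) = x.1 := inv_mul_cancel_left₀ (by positivity) _
  have e2 : -(2 * √x.2 * x.1) ^ 2 / (8 * x.2) = -x.1 ^ 2 / 2 := by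
    rw [mul_pow, mul_pow, Real.sq_sqrt hx.le]; field_simp; ring
  simp only [gaussDensity, dilate, e1, e2, Prod.mk.eta]

/-- The densities `k_i` for which `∑ ρ^i expInt k_i` is the preimage of `R₀ g` under `U`. -/
def rangeDensity (n : ℕ) (g : L2Half n) (i : ℕ) (q : ℝ × ℝ) : ℂ :=
  (((2 * Real.pi)⁻¹ * (√(√Real.pi))⁻¹ : ℝ) : ℂ) * (((2 * q.2 : ℝ) : ℂ) ^ i *
    gaussDensity (fun x => ∑ j : Fin n, (laguerreCoeff j i : ℂ) * g j x) q)

theorem admissible_rangeDensity (n : ℕ) (g : L2Half n) (i : ℕ) :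
    Admissible (rangeDensity n g i) := by
  have h1 : MemLp (fun x => ∑ j : Fin n, (laguerreCoeff j i : ℂ) * g j x) 2 halfMeasure :=
    memLp_finsetSum _ fun j _ => (Lp.memLp (g j)).const_mul _
  have h2 : ∀ {G : ℝ × ℝ → ℂ}, Admissible G → ∀ a : ℕ,
      Admissible fun q => ((2 * q.2 : ℝ) : ℂ) ^ a * G q := by
    intro G hG a
    induction a with
    | zero => simpa using hG
    | succ a ih =>
      have := ih.mul_snd.const_mul 2
      convert this using 2 with q
      push_cast
      ring
  exact (h2 (admissible_gaussDensity h1) i).const_mul _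

theorem measurable_rangeDensity (n : ℕ) (g : L2Half n) (i : ℕ) :
    Measurable (rangeDensity n g i) := by
  have h1 : Measurable fun x => ∑ j : Fin n, (laguerreCoeff j i : ℂ) * g j x :=
    Finset.measurable_fun_sum _ fun j _ => (Lp.stronglyMeasurable (g j)).measurable.const_mul _
  have h2 := h1.comp measurable_dilate
  unfold rangeDensity gaussDensity
  exact (Measurable.mul (by fun_prop) (Measurable.mul (by fun_prop) h2)).const_mul _

/-- The image under `U₁ U₀` of the preimage of `R₀ g`. -/
def rangeSpectral (n : ℕ) (g : L2Half n) (w : (ℝ × ℝ) × (ℝ × ℝ)) : ℂ :=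
  ∑ i ∈ Finset.range n, spectral (monom 0 i) (rangeDensity n g i) w

theorem measurable_rangeSpectral (n : ℕ) (g : L2Half n) : Measurable (rangeSpectral n g) :=
  Finset.measurable_fun_sum _ fun i _ =>
    measurable_spectral (measurable_monom 0 i) (measurable_rangeDensity n g i)

/-- The image of `rangeSpectral n g` under `V₂ V₁` is `R₀ g`: the sum over `i` recombines the
coefficients of the Laguerre functions. -/
theorem rangeSpectral_psi (n : ℕ) (g : L2Half n) (z : (ℝ × ℝ) × (ℝ × ℝ)) :
    ((1 / √(2 * |z.2.1|) : ℝ) : ℂ) * rangeSpectral n g (psi1 (psi2 z)) =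
      (Ioi (0 : ℝ)).indicator 1 z.2.1 * (hermiteFun0 z.1.2 : ℂ) *
        ∑ k : Fin n, (laguerreFun k z.2.2 : ℂ) * g k (z.1.1, z.2.1) := by
  by_cases hz : 0 < z.2.1
  · have hs : 0 < √(2 * z.2.1) := Real.sqrt_pos.2 (by positivity)
    have hq : 0 < √(√Real.pi) := by have := Real.pi_pos; positivity
    have hterm : ∀ i, ((1 / √(2 * |z.2.1|) : ℝ) : ℂ) *
        spectral (monom 0 i) (rangeDensity n g i) (psi1 (psi2 z)) =
        (hermiteFun0 z.1.2 : ℂ) * ∑ j : Fin n, ((laguerreCoeff j i * z.2.2 ^ i : ℝ) : ℂ) *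
          (Real.exp (-z.2.2 / 2) : ℂ) * g j (z.1.1, z.2.1) := by
      intro i
      rw [spectral_psi _ _ hz, rangeDensity, gaussDensity_apply _ (x := (z.1.1, z.2.1)) hz]
      set S := ∑ j : Fin n, (laguerreCoeff j i : ℂ) * g j (z.1.1, z.2.1) with hS
      have e1 : ∑ j : Fin n, ((laguerreCoeff j i * z.2.2 ^ i : ℝ) : ℂ) *
          (Real.exp (-z.2.2 / 2) : ℂ) * g j (z.1.1, z.2.1) =
          ((z.2.2 ^ i * Real.exp (-z.2.2 / 2) : ℝ) : ℂ) * S := by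
        rw [hS, Finset.mul_sum]
        refine Finset.sum_congr rfl fun j _ => ?_
        push_cast; ring
      have e2 : 1 / √(2 * z.2.1) * (2 * Real.pi * (z.2.2 / (2 * z.2.1)) ^ i *
          Real.exp ((z.1.1 ^ 2 - z.1.2 ^ 2 - z.2.2) / 2) * ((2 * Real.pi)⁻¹ * (√(√Real.pi))⁻¹ *
          ((2 * z.2.1) ^ i * (√(2 * z.2.1) * Real.exp (-z.1.1 ^ 2 / 2))))) =
          hermiteFun0 z.1.2 * (z.2.2 ^ i * Real.exp (-z.2.2 / 2)) := by
        have e3 : Real.exp ((z.1.1 ^ 2 - z.1.2 ^ 2 - z.2.2) / 2) * Real.exp (-z.1.1 ^ 2 / 2) =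
            √(√Real.pi) * hermiteFun0 z.1.2 * Real.exp (-z.2.2 / 2) := by
          rw [← hermiteFun0_eq, ← Real.exp_add, ← Real.exp_add]; congr 1; ring
        calc _ = ((2 * Real.pi) * (2 * Real.pi)⁻¹) * ((√(2 * z.2.1))⁻¹ * √(2 * z.2.1)) *
              ((z.2.2 / (2 * z.2.1)) * (2 * z.2.1)) ^ i * (√(√Real.pi))⁻¹ *
              (Real.exp ((z.1.1 ^ 2 - z.1.2 ^ 2 - z.2.2) / 2) * Real.exp (-z.1.1 ^ 2 / 2)) := by
              rw [mul_pow (z.2.2 / (2 * z.2.1))]; generalize (z.2.2 / (2 * z.2.1)) ^ i = A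
              generalize (2 * z.2.1) ^ i = B
              ring
          _ = _ := by
            rw [e3, mul_inv_cancel₀ (by positivity), inv_mul_cancel₀ hs.ne',
              div_mul_cancel₀ _ (by positivity)]
            field_simp
      have e3 := congrArg (fun x : ℝ => (x : ℂ) * S) e2
      rw [e1]
      simp only [monom, pow_zero, one_mul, abs_of_pos hz]
      push_cast at e3 ⊢
      linear_combination e3
    rw [indicator_of_mem (mem_Ioi.2 hz), Pi.one_apply, one_mul, rangeSpectral, Finset.mul_sum,
      Finset.sum_congr rfl fun i _ => hterm i, ← Finset.mul_sum, Finset.sum_comm]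
    congr 1
    refine Finset.sum_congr rfl fun j _ => ?_
    rw [laguerreFun_eq_of_lt j.2, ← Finset.sum_mul, ← Finset.sum_mul]
    push_cast
    rfl
  · rw [indicator_of_notMem (by exact hz), rangeSpectral,
      Finset.sum_eq_zero fun i _ => spectral_psi_of_nonpos _ _ hz]
    simp

/-- The function on `D₂` whose image under `U` is `R₀ g`. -/
def rangeFun (n : ℕ) (g : L2Half n) (ζ : ℂ × ℂ) : ℂ :=
  ∑ i ∈ Finset.range n, (rho ζ : ℂ) ^ i * expInt (rangeDensity n g i) ζ

/-- The operators see `ρ` only: the tangential one annihilates it, and `(∂/∂ζ̄₂)^n` annihilates its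
powers of order less than `n`. -/
theorem isLAnalytic_rangeFun (n : ℕ) (g : L2Half n) : IsLAnalytic 1 n (rangeFun n g) := by
  have hs : ∀ i, ContDiffOn ℝ (⊤ : ℕ∞)
      (fun ζ => (rho ζ : ℂ) ^ i * expInt (rangeDensity n g i) ζ) D2 := fun i =>
    (contDiff_ofReal_rho.pow i).contDiffOn.mul (contDiffOn_expInt (admissible_rangeDensity n g i))
  refine ⟨ContDiffOn.sum fun i _ => hs i, fun ζ hζ => ?_, fun ζ hζ => ?_⟩
  · rw [Function.iterate_one]
    refine (isLinearOp_tangentialCR.map_sum _ _ (fun i _ => hs i) hζ).trans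
      (Finset.sum_eq_zero fun i _ => ?_)
    have hd := (hasFDerivAt_expInt (admissible_rangeDensity n g i) hζ).differentiableAt
    have hm := tangentialCR_monom 0 i ζ
    simp only [pow_zero, mul_one, Nat.cast_zero, zero_mul, mul_zero] at hm
    rw [isDbarOp_tangentialCR.mul _ _ ζ
      (((contDiff_ofReal_rho (n := 1)).pow i).differentiable (by simp) ζ)
      (hd.restrictScalars ℝ), isDbarOp_tangentialCR.zero_of_holo _ _ hd, hm]
    simp
  · refine ((isLinearOp_dbar2.iterate n).map_sum _ _ (fun i _ => hs i) hζ).trans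
      (Finset.sum_eq_zero fun i hi => ?_)
    have hi' := Finset.mem_range.1 hi
    rw [iterate_dbar2_rho_pow_mul (contDiffOn_expInt (admissible_rangeDensity n g i))
      (Gb := fun b ζ => if b = 0 then expInt (rangeDensity n g i) ζ else 0) (fun b => by
        simpa using iterate_dbar2_im_pow_mul_expInt (admissible_rangeDensity n g i) 0 b) i n hζ]
    refine Finset.sum_eq_zero fun ab hab => ?_
    have hab' := Finset.HasAntidiagonal.mem_antidiagonal.1 hab
    by_cases hb : ab.2 = 0
    · have : i.descFactorial ab.1 = 0 := Nat.descFactorial_eq_zero_iff_lt.2 (by omega)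
      simp [this]
    · simp [hb]

/-- The range of `R₀` lies in the image of `A²_{(1,n)}(D₂)` under `U`. -/
theorem exists_mem_polyBergman_opU_eq (n : ℕ) (g : L2Half n) :
    ∃ f ∈ polyBergman 1 n, opU f = opR0 n g := by
  have hR : (fun z => ((1 / √(2 * |z.2.1|) : ℝ) : ℂ) * rangeSpectral n g (psi1 (psi2 z)))
      =ᵐ[flatMeasure] opR0 n g := by
    refine EventuallyEq.trans (Eventually.of_forall fun z => ?_) (opR0_ae n g).symm
    exact rangeSpectral_psi n g z
  have hm : MemLp (rangeSpectral n g) 2 flatMeasure :=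
    memLp_of_memLp_comp_psi (measurable_rangeSpectral n g).aestronglyMeasurable
      ((memLp_congr_ae hR).2 (Lp.memLp _))
  have hF := isLAnalytic_rangeFun n g
  have hsl : SliceFourier (rangeSpectral n g) fun w => rangeFun n g (kappa w) := by
    have := SliceFourier.sum (Finset.range n) fun i _ =>
      sliceFourier_spectral (admissible_rangeDensity n g i) (monom 0 i)
    simp only [monom, pow_zero, one_mul] at this
    exact this
  obtain ⟨hF2, h⟩ := hsl.exists_opU1_opU0_eq hF.smooth.continuousOn hm
  refine ⟨hF2.toLp _, ⟨_, hF, hF2.coeFn_toLp⟩, Lp.ext ?_⟩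
  exact (opV2_opV1_ae h).trans hR

/-! ### The adjoint of `R₀` -/

theorem basisFun_ae (k : ℕ) :
    basisFun k =ᵐ[halfMeasure] fun q => ((hermiteFun0 q.1 * laguerreFun k q.2 : ℝ) : ℂ) := by
  refine (tensorFun_ae _ _).trans ?_
  filter_upwards [(Measure.quasiMeasurePreserving_fst (ν := volPos)).ae_eq_comp
      memLp_hermiteFun0.coeFn_toLp,
    (Measure.quasiMeasurePreserving_snd (μ := (volume : Measure ℝ))).ae_eq_comp
      (memLp_laguerreFun k).coeFn_toLp] with q h1 h2
  simp only [Function.comp] at h1 h2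
  rw [h1, h2, Complex.ofReal_mul]

theorem half_prod_half_eq : halfMeasure.prod halfMeasure =
    (planeMeasure.prod halfMeasure).restrict ((univ ×ˢ Ioi (0 : ℝ)) ×ˢ univ) := by
  rw [← Measure.prod_restrict, ← halfMeasure_eq, Measure.restrict_univ]

theorem measurePreserving_rearrange_symm :
    MeasurePreserving rearrange (planeMeasure.prod halfMeasure) flatMeasure :=
  MeasurePreserving.symm rearrangeEquiv measurePreserving_rearrange

theorem ae_rearrange_half {p : (ℝ × ℝ) × (ℝ × ℝ) → Prop} (h : ∀ᵐ w ∂flatMeasure, p w) :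
    ∀ᵐ x ∂halfMeasure, ∀ᵐ y ∂halfMeasure, p ((x.1, y.1), (x.2, y.2)) := by
  refine Measure.ae_ae_of_ae_prod (p := fun q => p (rearrange q)) ?_
  rw [half_prod_half_eq]
  exact ae_restrict_of_ae (measurePreserving_rearrange_symm.quasiMeasurePreserving.ae h)

/-- The restriction of an element of `L²(𝒟)` to `x₂ > 0`, in the order `((x₁, x₂), (y₁, y₂))`. -/
theorem memLp_rearrange_half (Y : L2Flat) :
    MemLp (fun q => Y (rearrange q)) 2 (halfMeasure.prod halfMeasure) := by
  rw [half_prod_half_eq]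
  exact ((Lp.memLp Y).comp_measurePreserving measurePreserving_rearrange_symm).restrict _

/-- The pairing of an element of `L²(𝒟)` with `χ_A ⊗ b`. -/
theorem inner_embedWith_indicator (b : Lp ℂ 2 halfMeasure) (Y : L2Flat) {A : Set (ℝ × ℝ)}
    (hA : MeasurableSet A) (hμ : halfMeasure A ≠ ∞) :
    IntegrableOn (fun x => ∫ y, (starRingEnd ℂ) (b y) * Y (rearrange (x, y)) ∂halfMeasure) A
      halfMeasure ∧
    inner ℂ (embedWith b (indicatorConstLp 2 hA hμ (1 : ℂ))) Y =
      ∫ x in A, ∫ y, (starRingEnd ℂ) (b y) * Y (rearrange (x, y)) ∂halfMeasure ∂halfMeasure := by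
  set F : (ℝ × ℝ) × (ℝ × ℝ) → ℂ := fun q =>
    (starRingEnd ℂ) (A.indicator (fun _ => (1 : ℂ)) q.1 * b q.2) * Y (rearrange q) with hF
  have hi : Integrable F (halfMeasure.prod halfMeasure) :=
    (MemLp.conj_complex (memLp_tensor (memLp_indicator_const 2 hA 1 (Or.inr hμ))
      (Lp.memLp b))).integrable_mul (memLp_rearrange_half Y)
  have e1 : ∀ x, ∫ y, F (x, y) ∂halfMeasure = A.indicator (fun x =>
      ∫ y, (starRingEnd ℂ) (b y) * Y (rearrange (x, y)) ∂halfMeasure) x := by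
    intro x
    by_cases hx : x ∈ A <;> simp [hF, hx]
  have e2 : inner ℂ (embedWith b (indicatorConstLp 2 hA hμ (1 : ℂ))) Y =
      ∫ q, F q ∂(halfMeasure.prod halfMeasure) := by
    rw [half_prod_half_eq, ← integral_indicator
      ((MeasurableSet.univ.prod measurableSet_Ioi).prod MeasurableSet.univ),
      ← integral_rearrange, L2.inner_def]
    refine integral_congr_ae ?_
    have h1 := ae_zeroExt (indicatorConstLp_coeFn (p := 2) (hs := hA) (hμs := hμ) (c := (1 : ℂ)))
    have h2 := measurePreserving_rearrange.quasiMeasurePreserving.ae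
      ((Measure.quasiMeasurePreserving_fst (ν := halfMeasure)).ae h1)
    filter_upwards [embedWith_ae b (indicatorConstLp 2 hA hμ (1 : ℂ)), h2] with w h3 h4
    rw [RCLike.inner_apply, h3]
    by_cases hw : 0 < w.2.1
    · rw [indicator_of_mem (by exact ⟨mem_univ _, hw⟩),
        indicator_of_mem (by exact ⟨⟨mem_univ _, hw⟩, mem_univ _⟩)]
      have h5 := h4 ⟨mem_univ _, hw⟩
      simp only [rearrange] at h5
      rw [h5, mul_comm]
      rfl
    · rw [indicator_of_notMem (by exact fun h => hw h.2),
        indicator_of_notMem (by exact fun h => hw h.1.2)]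
      simp
  constructor
  · rw [← integrable_indicator_iff hA]
    exact hi.integral_prod_left.congr (Eventually.of_forall e1)
  · rw [e2, integral_prod _ hi]
    simp only [e1]
    rw [integral_indicator hA]

theorem opR0_single {n : ℕ} (j : Fin n) (v : Lp ℂ 2 halfMeasure) :
    opR0 n (PiLp.single 2 j v) = embedWith (basisFun j) v := by
  have : opR0 n (PiLp.single 2 j v) =
      ∑ k : Fin n, embedWith (basisFun k) ((PiLp.single 2 j v : L2Half n) k) := by simp [opR0]
  rw [this, Finset.sum_eq_single j (fun k _ hk => by simp [hk]) (by simp)]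
  simp

theorem adjoint_opR0_apply {n : ℕ} (j : Fin n) (Y : L2Flat) :
    ContinuousLinearMap.adjoint (opR0 n) Y j =
      ContinuousLinearMap.adjoint (embedWith (basisFun j)) Y := by
  refine ext_inner_left ℂ fun v => ?_
  rw [ContinuousLinearMap.adjoint_inner_right, ← opR0_single, ←
    ContinuousLinearMap.adjoint_inner_right, PiLp.inner_apply,
    Finset.sum_eq_single j (fun k _ hk => by simp [hk]) (by simp)]
  simp

/-- `R₀^*` integrates against the functions `h₀(y₁) ℓ_j(y₂)`. -/
theorem adjoint_opR0_ae {n : ℕ} (j : Fin n) (Y : L2Flat) :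
    ContinuousLinearMap.adjoint (opR0 n) Y j =ᵐ[halfMeasure] fun x =>
      ∫ y : ℝ × ℝ, ((hermiteFun0 y.1 * laguerreFun j y.2 : ℝ) : ℂ) * Y ((x.1, y.1), (x.2, y.2))
        ∂halfMeasure := by
  have e : ∀ x : ℝ × ℝ, ∫ y : ℝ × ℝ, ((hermiteFun0 y.1 * laguerreFun j y.2 : ℝ) : ℂ) *
      Y ((x.1, y.1), (x.2, y.2)) ∂halfMeasure =
      ∫ y, (starRingEnd ℂ) (basisFun j y) * Y (rearrange (x, y)) ∂halfMeasure := by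
    intro x
    refine integral_congr_ae ?_
    filter_upwards [basisFun_ae j] with y hy
    rw [hy, Complex.conj_ofReal]
    rfl
  simp only [e, adjoint_opR0_apply]
  refine ae_eq_of_forall_setIntegral_eq_of_sigmaFinite (fun A hA hμ => ?_) (fun A hA hμ => ?_)
    fun A hA hμ => ?_
  · exact integrableOn_Lp_of_measure_ne_top _ fact_one_le_two_ennreal.elim hμ.ne
  · exact (inner_embedWith_indicator (basisFun j) Y hA hμ.ne).1
  · rw [← (inner_embedWith_indicator (basisFun j) Y hA hμ.ne).2,
      ← ContinuousLinearMap.adjoint_inner_right, L2.inner_indicatorConstLp_one]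

/-- If `Y = C · R₀ g`, then `R₀^* Y` is obtained by multiplication of `g` with a matrix. -/
theorem adjoint_opR0_mul_ae {n : ℕ} {g : L2Half n} {Y : L2Flat} {C : (ℝ × ℝ) × (ℝ × ℝ) → ℂ}
    (hY : Y =ᵐ[flatMeasure] fun z => C z * opR0 n g z) (j : Fin n)
    (hC : ∀ᵐ x ∂halfMeasure, ∀ k : Fin n, Integrable (fun y : ℝ × ℝ =>
      C ((x.1, y.1), (x.2, y.2)) * (hermiteFun0 y.1 : ℂ) ^ 2 *
        ((laguerreFun j y.2 : ℂ) * (laguerreFun k y.2 : ℂ))) halfMeasure) :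
    ContinuousLinearMap.adjoint (opR0 n) Y j =ᵐ[halfMeasure] fun x =>
      ∑ k : Fin n, (∫ y : ℝ × ℝ, C ((x.1, y.1), (x.2, y.2)) * (hermiteFun0 y.1 : ℂ) ^ 2 *
        ((laguerreFun j y.2 : ℂ) * (laguerreFun k y.2 : ℂ)) ∂halfMeasure) * g k x := by
  filter_upwards [adjoint_opR0_ae j Y, hC, ae_snd_pos, ae_rearrange_half hY,
    ae_rearrange_half (opR0_ae n g)] with x h1 h2 h3 h4 h5
  rw [h1]
  simp only [← integral_mul_const]
  rw [← integral_finsetSum _ fun k _ => (h2 k).mul_const _]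
  refine integral_congr_ae ?_
  filter_upwards [h4, h5] with y h6 h7
  rw [h6, h7, indicator_of_mem (mem_Ioi.2 h3), Pi.one_apply, one_mul, Finset.mul_sum,
    Finset.mul_sum, Finset.mul_sum]
  refine Finset.sum_congr rfl fun k _ => ?_
  push_cast
  ring

theorem integrable_hermiteFun0_sq_mul_laguerreFun (j k : ℕ) :
    Integrable (fun y : ℝ × ℝ => (hermiteFun0 y.1 : ℂ) ^ 2 *
      ((laguerreFun j y.2 : ℂ) * (laguerreFun k y.2 : ℂ))) halfMeasure := by
  have h1 := memLp_hermiteFun0.integrable_mul memLp_hermiteFun0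
  have h2 := (memLp_laguerreFun j).integrable_mul (memLp_laguerreFun k)
  refine (h1.mul_prod h2).congr (Eventually.of_forall fun y => ?_)
  simp only [Pi.mul_apply]
  ring

theorem integral_hermiteFun0_sq_mul_laguerreFun (j k : ℕ) :
    ∫ y : ℝ × ℝ, (hermiteFun0 y.1 : ℂ) ^ 2 *
      ((laguerreFun j y.2 : ℂ) * (laguerreFun k y.2 : ℂ)) ∂halfMeasure = if j = k then 1 else 0 := by
  have h1 : ∫ x : ℝ, (hermiteFun0 x : ℂ) ^ 2 = 1 := by
    have := integral_hermiteFun0_sq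
    have h := integral_ofReal (μ := (volume : Measure ℝ)) (f := fun y : ℝ => hermiteFun0 y ^ 2) (𝕜 := ℂ)
    rw [this] at h
    simpa using h
  have h2 : ∫ x : ℝ, (laguerreFun j x : ℂ) * (laguerreFun k x : ℂ) ∂volPos =
      if j = k then 1 else 0 := by
    have h := integral_ofReal (μ := volPos) (f := fun y : ℝ => laguerreFun j y * laguerreFun k y)
      (𝕜 := ℂ)
    rw [integral_laguerreFun_mul] at h
    rw [show (∫ x : ℝ, (laguerreFun j x : ℂ) * (laguerreFun k x : ℂ) ∂volPos) =
      ∫ x : ℝ, ((laguerreFun j x * laguerreFun k x : ℝ) : ℂ) ∂volPos by push_cast; rfl]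
    refine h.trans ?_
    split_ifs <;> simp
  rw [integral_prod_mul (f := fun x : ℝ => (hermiteFun0 x : ℂ) ^ 2)
    (g := fun x : ℝ => (laguerreFun j x : ℂ) * (laguerreFun k x : ℂ)), h1, h2, one_mul]

/-- `R₀` is an isometry, because `h₀` and the Laguerre functions are orthonormal. -/
theorem adjoint_opR0_opR0 {n : ℕ} (g : L2Half n) :
    ContinuousLinearMap.adjoint (opR0 n) (opR0 n g) = g := by
  ext j : 1
  apply Lp.ext
  have h := adjoint_opR0_mul_ae (g := g) (Y := opR0 n g) (C := fun _ => 1)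
    (Eventually.of_forall fun z => (one_mul _).symm) j
    (Eventually.of_forall fun x k => by
      simpa only [one_mul] using integrable_hermiteFun0_sq_mul_laguerreFun j k)
  filter_upwards [h] with x hx
  rw [hx]
  simp only [one_mul, integral_hermiteFun0_sq_mul_laguerreFun]
  simp [Fin.val_inj]

/-! ### Multiplication by functions of `(v₁, v₂)` -/

/-- Multiplication on `L²(𝒟)` by a bounded function. -/
def mulFlat (a : Lp ℂ ∞ flatMeasure) : L2Flat →L[ℂ] L2Flat :=
  (ContinuousLinearMap.mul ℂ ℂ).holderL flatMeasure ∞ 2 2 a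

theorem mulFlat_ae (a : Lp ℂ ∞ flatMeasure) (y : L2Flat) :
    mulFlat a y =ᵐ[flatMeasure] fun w => a w * y w :=
  ContinuousLinearMap.coeFn_holder (r := 2) (ContinuousLinearMap.mul ℂ ℂ) a y

/-- Matrix entries between tensors of the multiplication by a function of `v₁` and `v₂`. -/
theorem inner_tensor4_mul_tensor4 {m : ℝ → ℝ → ℂ} {Y : L2Flat}
    {a b c a' b' c' : Lp ℂ 2 (volume : Measure ℝ)} {d d' : Lp ℂ 2 volPos}
    (hY : Y =ᵐ[flatMeasure] fun w => m w.1.2 w.2.2 * tensor4 a b c d w) :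
    inner ℂ (tensor4 a' b' c' d') Y = (inner ℂ a' a * inner ℂ c' c) *
      ∫ X : ℝ × ℝ, m X.1 X.2 * (inner ℂ (b' X.1) (b X.1) * inner ℂ (d' X.2) (d X.2))
        ∂halfMeasure := by
  rw [L2.inner_def, L2.inner_def, L2.inner_def, ← integral_prod_mul, ← integral_prod_mul
    (μ := (volume : Measure ℝ).prod volume) (ν := halfMeasure)
    (f := fun U : ℝ × ℝ => inner ℂ (a' U.1) (a U.1) * inner ℂ (c' U.2) (c U.2))
    (g := fun X : ℝ × ℝ => m X.1 X.2 * (inner ℂ (b' X.1) (b X.1) * inner ℂ (d' X.2) (d X.2))),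
    ← integral_rearrange (fun q : (ℝ × ℝ) × (ℝ × ℝ) => inner ℂ (a' q.1.1) (a q.1.1) *
      inner ℂ (c' q.1.2) (c q.1.2) *
        (m q.2.1 q.2.2 * (inner ℂ (b' q.2.1) (b q.2.1) * inner ℂ (d' q.2.2) (d q.2.2))))]
  refine integral_congr_ae ?_
  filter_upwards [hY, tensor4_ae a b c d, tensor4_ae a' b' c' d'] with w h1 h2 h3
  rw [h1, h2, h3]
  simp only [RCLike.inner_apply, map_mul, rearrange]
  ring

/-- `U₁` commutes with multiplication by functions of `v₁` and `v₂`, in which it acts trivially. -/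
theorem opU1_mul_ae {m : ℝ → ℝ → ℂ}
    (hm : MemLp (fun w : (ℝ × ℝ) × (ℝ × ℝ) => m w.1.2 w.2.2) ∞ flatMeasure) {y y' : L2Flat}
    (h : y' =ᵐ[flatMeasure] fun w => m w.1.2 w.2.2 * y w) :
    opU1 y' =ᵐ[flatMeasure] fun w => m w.1.2 w.2.2 * opU1 y w := by
  set M := mulFlat (hm.toLp _) with hM
  have hMae : ∀ y : L2Flat, M y =ᵐ[flatMeasure] fun w => m w.1.2 w.2.2 * y w := by
    intro y
    filter_upwards [mulFlat_ae (hm.toLp _) y, hm.coeFn_toLp] with w h1 h2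
    rw [h1, h2]
  have hy' : y' = M y := Lp.ext (h.trans (hMae y).symm)
  set L : L2Flat →L[ℂ] L2Flat := opU1.toLinearIsometry.toContinuousLinearMap with hL
  have hLa : ∀ y, L y = opU1 y := fun _ => rfl
  -- The commutator `D` vanishes: its matrix entries between tensors do, since the Fourier
  -- transforms act on the first and third factor and `m` on the other two.
  set D := M.comp L - L.comp M with hD
  have h0 : ∀ a b c d a' b' c' d', inner ℂ (tensor4 a' b' c' d') (D (tensor4 a b c d)) = 0 := by
    intro a b c d a' b' c' d'
    have h1 : D (tensor4 a b c d) = M (opU1 (tensor4 a b c d)) - opU1 (M (tensor4 a b c d)) := rfl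
    have h2 : tensor4 a' b' c' d' = opU1 (tensor4 (fourierL2.symm a') b' (fourierL2.symm c') d') := by
      rw [opU1_tensor4]; simp
    rw [h1, inner_sub_right, sub_eq_zero]
    conv_rhs => rw [h2, opU1.inner_map_map, inner_tensor4_mul_tensor4 (hMae _)]
    rw [opU1_tensor4, inner_tensor4_mul_tensor4 (hMae _)]
    have h3 : ∀ p q, inner ℂ (fourierL2.symm p) q = inner ℂ p (fourierL2 q) := by
      intro p q
      rw [← fourierL2.inner_map_map, fourierL2.apply_symm_apply]
    rw [h3, h3]
  have hadj : ∀ a' b' c' d', ContinuousLinearMap.adjoint D (tensor4 a' b' c' d') = 0 := by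
    intro a' b' c' d'
    refine eq_zero_of_inner_tensor4 dense_univ fun a _ b c _ d => ?_
    rw [ContinuousLinearMap.adjoint_inner_right, ← inner_conj_symm, h0, map_zero]
  have hDy : D y = 0 := by
    refine eq_zero_of_inner_tensor4 dense_univ fun a _ b c _ d => ?_
    rw [← ContinuousLinearMap.adjoint_inner_left, hadj, inner_zero_left]
  have h4 : opU1 y' = M (opU1 y) := by
    rw [hy']
    exact (sub_eq_zero.1 hDy).symm
  rw [h4]
  exact hMae _

theorem nilpotentSymbol_kappa (c : ℝ → ℝ → ℂ) (w : (ℝ × ℝ) × (ℝ × ℝ)) :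
    nilpotentSymbol c (kappa w) = c w.1.2 w.2.2 := by
  have := rho_kappa w
  rw [rho] at this
  rw [nilpotentSymbol, this, kappa_fst_im]

theorem memLp_symbol_flat {c : ℝ → ℝ → ℂ} (hc : MemLp (nilpotentSymbol c) ∞ D2Measure) :
    MemLp (fun w : (ℝ × ℝ) × (ℝ × ℝ) => c w.1.2 w.2.2) ∞ flatMeasure := by
  have := hc.comp_measurePreserving measurePreserving_kappa
  simpa only [Function.comp_def, nilpotentSymbol_kappa] using this

/-- The symbol in the coordinates `z`. -/
def transportedSymbol (c : ℝ → ℝ → ℂ) (z : (ℝ × ℝ) × (ℝ × ℝ)) : ℂ :=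
  c (1 / (2 * √|z.2.1|) * (-z.1.1 + z.1.2)) (z.2.2 / (2 * |z.2.1|))

/-- `U` transforms multiplication by `c̃` into multiplication by the transported symbol. -/
theorem opU_mulOp_ae {c : ℝ → ℝ → ℂ} (hc : MemLp (nilpotentSymbol c) ∞ D2Measure) (f : L2D) :
    opU (mulOp (hc.toLp _) f) =ᵐ[flatMeasure] fun z => transportedSymbol c z * opU f z := by
  have h0 : mulOp (hc.toLp _) f =ᵐ[D2Measure] fun ζ => nilpotentSymbol c ζ * f ζ := by
    filter_upwards [ContinuousLinearMap.coeFn_holder (r := 2) (ContinuousLinearMap.mul ℂ ℂ)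
      (hc.toLp _) f, hc.coeFn_toLp] with ζ h1 h2
    refine h1.trans ?_
    rw [h2]
    rfl
  have h1 : opU0 (mulOp (hc.toLp _) f) =ᵐ[flatMeasure] fun w => c w.1.2 w.2.2 * opU0 f w := by
    filter_upwards [opU0_ae (mulOp (hc.toLp _) f), opU0_ae f,
      measurePreserving_kappa.quasiMeasurePreserving.ae_eq_comp h0] with w h2 h3 h4
    simp only [Function.comp, nilpotentSymbol_kappa] at h4
    rw [h2, h3, h4]
  have h2 := opU1_mul_ae (memLp_symbol_flat hc) h1
  have h3 := opV2_opV1_ae h2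
  have h4 := opV2_opV1_ae (y := opU1 (opU0 f)) (EventuallyEq.refl _ _)
  filter_upwards [h3, h4] with z h5 h6
  refine h5.trans ?_
  refine Eq.trans ?_ (congrArg (fun t => transportedSymbol c z * t) h6.symm)
  simp only [transportedSymbol, psi1, psi2]
  ring

/-! ### Integrability of the entries of `γ^c` -/

/-- The symbol, as a function on the half-plane, is measurable and bounded almost everywhere, since
it is a slice of a function on `𝒟` with these properties. -/
theorem memLp_symbol_half {c : ℝ → ℝ → ℂ} (hc : MemLp (nilpotentSymbol c) ∞ D2Measure) :
    MemLp (fun X : ℝ × ℝ => c X.1 X.2) ∞ halfMeasure := by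
  have h1 : MemLp (fun q : (ℝ × ℝ) × (ℝ × ℝ) => c q.2.1 q.2.2) ∞
      (planeMeasure.prod halfMeasure) :=
    (memLp_symbol_flat hc).comp_measurePreserving measurePreserving_rearrange_symm
  have h2 := Measure.ae_ae_of_ae_prod (ae_le_eLpNormEssSup (f := fun q : (ℝ × ℝ) × (ℝ × ℝ) =>
    c q.2.1 q.2.2) (μ := planeMeasure.prod halfMeasure))
  obtain ⟨x, h3, h4⟩ := (h1.1.prodMk_left.and h2).exists
  refine ⟨h3, ?_⟩
  rw [eLpNorm_exponent_top]
  refine (essSup_le_of_ae_le _ h4).trans_lt ?_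
  have := h1.2
  rwa [eLpNorm_exponent_top] at this

theorem quasiMeasurePreserving_affine (x : ℝ × ℝ) (hx : 0 < x.2) :
    Measure.QuasiMeasurePreserving
      (fun y : ℝ × ℝ => ((-x.1 + y.1) / (2 * √x.2), y.2 / (2 * x.2))) halfMeasure halfMeasure := by
  have hr : 0 < (2 * √x.2)⁻¹ := by have := Real.sqrt_pos.2 hx; positivity
  have hx' : 0 < (2 * x.2)⁻¹ := by positivity
  have h1 : Measure.QuasiMeasurePreserving (fun y : ℝ => (-x.1 + y) / (2 * √x.2)) := by
    have := (isWeighted_dilation hr).quasi.comp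
      (measurePreserving_add_left (volume : Measure ℝ) (-x.1)).quasiMeasurePreserving
    simpa only [Function.comp_def, div_eq_inv_mul] using this
  have h2 : Measure.QuasiMeasurePreserving (fun y : ℝ => y / (2 * x.2)) volPos volPos := by
    have := (isWeighted_dilation hx').quasi.restrict (s := Ioi 0) (t := Ioi 0)
      fun y hy => mul_pos hx' hy
    simpa only [div_eq_inv_mul] using this
  exact QuasiMeasurePreserving.prodMap h1 h2

/-- The symbol is bounded outside a null set, whose preimage under the affine substitution is again
a null set; hence the statement holds for every point `(x₁, x₂)`. -/
theorem integrable_gammaIntegrand {c : ℝ → ℝ → ℂ} (hc : MemLp (nilpotentSymbol c) ∞ D2Measure)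
    (j k : ℕ) (x₁ x₂ : ℝ) (hx : 0 < x₂) :
    Integrable (fun y : ℝ × ℝ => gammaIntegrand c j k x₁ x₂ y.1 y.2) halfMeasure := by
  have hq := quasiMeasurePreserving_affine (x₁, x₂) hx
  have hh := memLp_symbol_half hc
  have hb : ∀ᵐ X : ℝ × ℝ ∂halfMeasure, ‖c X.1 X.2‖ ≤
      (eLpNormEssSup (fun X : ℝ × ℝ => c X.1 X.2) halfMeasure).toReal := by
    filter_upwards [ae_le_eLpNormEssSup (f := fun X : ℝ × ℝ => c X.1 X.2) (μ := halfMeasure)]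
      with X hX
    have := hh.2
    rw [eLpNorm_exponent_top] at this
    rwa [← toReal_enorm, ENNReal.toReal_le_toReal (by simp) this.ne]
  have := (integrable_hermiteFun0_sq_mul_laguerreFun j k).bdd_mul
    (hh.1.comp_quasiMeasurePreserving hq) (hq.ae hb)
  refine this.congr (Eventually.of_forall fun y => ?_)
  simp only [gammaIntegrand, Function.comp]
  ring

theorem gammaMatrix_apply {n : ℕ} {c : ℝ → ℝ → ℂ} (hc : MemLp (nilpotentSymbol c) ∞ D2Measure)
    (j k : Fin n) (x₁ x₂ : ℝ) (hx : 0 < x₂) : gammaMatrix n c x₁ x₂ j k =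
      ∫ y : ℝ × ℝ, gammaIntegrand c j k x₁ x₂ y.1 y.2 ∂halfMeasure := by
  rw [integral_prod _ (integrable_gammaIntegrand hc j k x₁ x₂ hx)]
  rfl

/-! ### The unitary operator and the Toeplitz operators -/

theorem norm_opR0 {n : ℕ} (g : L2Half n) : ‖opR0 n g‖ = ‖g‖ := by
  rw [@norm_eq_sqrt_re_inner ℂ, @norm_eq_sqrt_re_inner ℂ _ _ _ _ g,
    ← ContinuousLinearMap.adjoint_inner_right, adjoint_opR0_opR0]

theorem opR_apply {n : ℕ} (f : L2D) :
    opR n f = ContinuousLinearMap.adjoint (opR0 n) (opU f) := rfl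

theorem opR_eq_of_opU_eq {n : ℕ} {f : L2D} {g : L2Half n} (h : opU f = opR0 n g) :
    opR n f = g := by
  rw [opR_apply, h, adjoint_opR0_opR0]

/-- `U` maps `A²_{(1,n)}(D₂)` into the range of `R₀`. -/
theorem opU_eq_opR0_opR {n : ℕ} {f : L2D} (hf : f ∈ polyBergman 1 n) :
    opU f = opR0 n (opR n f) := by
  obtain ⟨f', hf', h⟩ := exists_mem_polyBergman_opU_eq n (opR n f)
  have h0 : f - f' = 0 := eq_zero_of_opR_eq_zero (sub_mem hf hf') (by
    rw [map_sub, opR_eq_of_opU_eq h, sub_self])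
  rw [← h, sub_eq_zero.1 h0]

/-- The restriction of `R` to `A²_{(1,n)}(D₂)`, as a unitary operator. -/
def bargmann (n : ℕ) : polyBergman 1 n ≃ₗᵢ[ℂ] L2Half n :=
  LinearIsometryEquiv.ofSurjective
    { toLinearMap := (opR n).toLinearMap ∘ₗ (polyBergman 1 n).subtype
      norm_map' := fun f => by
        change ‖opR n f‖ = ‖(f : L2D)‖
        rw [← norm_opR0, ← opU_eq_opR0_opR f.2, opU.norm_map] }
    fun g => by
      obtain ⟨f, hf, h⟩ := exists_mem_polyBergman_opU_eq n g
      exact ⟨⟨f, hf⟩, opR_eq_of_opU_eq h⟩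

theorem bargmann_apply {n : ℕ} (f : polyBergman 1 n) : bargmann n f = opR n f := rfl

theorem opR_bargmann_symm {n : ℕ} (g : L2Half n) : opR n ((bargmann n).symm g) = g := by
  rw [← bargmann_apply, LinearIsometryEquiv.apply_symm_apply]

theorem opU_bargmann_symm {n : ℕ} (g : L2Half n) : opU ((bargmann n).symm g) = opR0 n g := by
  rw [opU_eq_opR0_opR ((bargmann n).symm g).2, opR_bargmann_symm]

theorem hasOrthogonalProjection_polyBergman (n : ℕ) :
    (polyBergman 1 n).HasOrthogonalProjection := by
  have : CompleteSpace (polyBergman 1 n) :=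
    (bargmann n).toIsometryEquiv.completeSpace
  infer_instance

/-- On `(L²(ℝ × ℝ₊))^n`, the adjoint of `R` is the inverse of its restriction to `A²_{(1,n)}(D₂)`.
-/
theorem adjoint_opR_apply {n : ℕ} (g : L2Half n) :
    ContinuousLinearMap.adjoint (opR n) g = (bargmann n).symm g := by
  refine ext_inner_left ℂ fun f => ?_
  rw [ContinuousLinearMap.adjoint_inner_right, opR_apply, ContinuousLinearMap.adjoint_inner_left,
    ← opU_bargmann_symm, opU.inner_map_map]

/-- `R` vanishes on the orthogonal complement of `A²_{(1,n)}(D₂)`. -/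
theorem opR_orthogonalProjection {n : ℕ} [(polyBergman 1 n).HasOrthogonalProjection] (f : L2D) :
    opR n ((polyBergman 1 n).orthogonalProjectionOnto f) = opR n f := by
  refine ext_inner_left ℂ fun g => ?_
  rw [← ContinuousLinearMap.adjoint_inner_left, ← ContinuousLinearMap.adjoint_inner_left,
    adjoint_opR_apply, ← sub_eq_zero, ← inner_sub_right, ← neg_eq_zero, ← inner_neg_right, neg_sub]
  exact Submodule.inner_right_of_mem_orthogonal ((bargmann n).symm g).2
    ((polyBergman 1 n).sub_starProjection_mem_orthogonal f)

/-- `R T_c R^*` is `R₀^*` applied to the transported symbol times `R₀ g`. -/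
theorem bargmann_toeplitz_ae {n : ℕ} [(polyBergman 1 n).HasOrthogonalProjection]
    {c : ℝ → ℝ → ℂ} (hc : MemLp (nilpotentSymbol c) ∞ D2Measure) (g : L2Half n) :
    ∀ᵐ x ∂halfMeasure, (fun j => bargmann n (toeplitz n (hc.toLp (nilpotentSymbol c))
      ((bargmann n).symm g)) j x) = (gammaMatrix n c x.1 x.2).mulVec (fun k => g k x) := by
  have h1 : bargmann n (toeplitz n (hc.toLp (nilpotentSymbol c)) ((bargmann n).symm g)) =
      ContinuousLinearMap.adjoint (opR0 n)
        (opU (mulOp (hc.toLp _) ((bargmann n).symm g))) :=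
    opR_orthogonalProjection _
  have h2 := opU_mulOp_ae hc ((bargmann n).symm g)
  rw [opU_bargmann_symm] at h2
  have e : ∀ x : ℝ × ℝ, 0 < x.2 → ∀ (j k : Fin n) (y : ℝ × ℝ),
      transportedSymbol c ((x.1, y.1), (x.2, y.2)) * (hermiteFun0 y.1 : ℂ) ^ 2 *
        ((laguerreFun j y.2 : ℂ) * (laguerreFun k y.2 : ℂ)) =
      gammaIntegrand c j k x.1 x.2 y.1 y.2 := by
    intro x hx j k y
    simp only [transportedSymbol, gammaIntegrand, abs_of_pos hx, one_div_mul_eq_div]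
  have h3 := fun j : Fin n => adjoint_opR0_mul_ae h2 j (by
    filter_upwards [ae_snd_pos] with x hx k
    simp only [e x hx]
    exact integrable_gammaIntegrand hc j k x.1 x.2 hx)
  filter_upwards [ae_snd_pos, ae_all_iff.2 h3] with x hx h4
  funext j
  rw [h1, h4 j, Matrix.mulVec, dotProduct]
  refine Finset.sum_congr rfl fun k _ => ?_
  simp only [e x hx]
  rw [gammaMatrix_apply hc j k x.1 x.2 hx]

end Siegel

theorem mainTheorem3 (n : ℕ) (hn : 1 ≤ n) (c : ℝ → ℝ → ℂ)
    (hc : MeasureTheory.MemLp (Siegel.nilpotentSymbol c) ⊤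
      (MeasureTheory.volume.restrict Siegel.D2)) :
    (∀ (j k : Fin n) (x₁ x₂ : ℝ), 0 < x₂ →
      MeasureTheory.Integrable
        (fun y : ℝ × ℝ => Siegel.gammaIntegrand c j k x₁ x₂ y.1 y.2) Siegel.halfMeasure) ∧
    ∃ _ : (Siegel.polyBergman 1 n).HasOrthogonalProjection,
      ∃ W : Siegel.polyBergman 1 n ≃ₗᵢ[ℂ] Siegel.L2Half n,
        (∀ f, W f = Siegel.opR n f) ∧
        (∀ g, ContinuousLinearMap.adjoint (Siegel.opR n) g = W.symm g) ∧
        ∀ (g : Siegel.L2Half n),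
          ∀ᵐ x ∂Siegel.halfMeasure,
            (fun j => W (Siegel.toeplitz n (hc.toLp (Siegel.nilpotentSymbol c)) (W.symm g)) j x) =
              (Siegel.gammaMatrix n c x.1 x.2).mulVec (fun k => g k x) := by
  refine ⟨fun j k x₁ x₂ hx => Siegel.integrable_gammaIntegrand hc j k x₁ x₂ hx,
    Siegel.hasOrthogonalProjection_polyBergman n, Siegel.bargmann n, Siegel.bargmann_apply,
    Siegel.adjoint_opR_apply, fun g => ?_⟩
  have := Siegel.hasOrthogonalProjection_polyBergman n
  exact Siegel.bargmann_toeplitz_ae hc g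
end
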